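/- Let $G$ be a connected, simply connected, simple complex Lie group. Let $\Phi\subset\mathfrak t^*$ be its root system (an irreducible reduced crystallographic root system spanning the real vector space $\mathfrak t^*$), with simple roots $\alpha_1,\dots,\alpha_l$, positive roots $\Phi^+$, coroots $\alpha^\vee\in\mathfrak t$, fundamental weights $\lambda_i$ (so $\lambda_i(\alpha_j^\vee)=\delta_{ij}$), Weyl group $W$ generated by $s_i=s_{\alpha_i}$, length function $\ell$, and longest element $w_0$. The group $W$ acts on $\mathbb R[\lambda]=\mathbb R[\lambda_1,\dots,\lambda_l]=S(\mathfrak t^*)$. Let $I_W\subset\mathbb R[\lambda]$ be the ideal generated by the homogeneous $W$-invariant polynomials of positive degree, and put $\mathcal H=\mathbb R[\lambda]/I_W$ (which is $H^*(G/B;\mathbb R)$ in Borel's presentation). For a root $\alpha$ let $\Delta_\alpha(f)=(f-s_\alpha f)/\alpha$, and for a reduced expression $w=s_{i_1}\cdots s_{i_k}$ let $\Delta_w=\Delta_{\alpha_{i_1}}\circ\cdots\circ\Delta_{\alpha_{i_k}}$. Put $c_{w_0}=\frac1{|W|}\prod_{\alpha\in\Phi^+}\alpha$, $c_w=\Delta_{w^{-1}w_0}c_{w_0}$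 and $\sigma_w=[c_w]\in\mathcal H$ (the Schubert classes). For $\alpha\in\Phi^+$ write $\alpha^\vee=m_1\alpha_1^\vee+\dots+m_l\alpha_l^\vee$, $\mathrm{ht}(\alpha^\vee)=m_1+\dots+m_l$ and $q^{\alpha^\vee}=q_1^{m_1}\cdots q_l^{m_l}$, and let $\tilde\Phi^+=\{\alpha\in\Phi^+:\ell(s_\alpha)=2\,\mathrm{ht}(\alpha^\vee)-1\}$. On $\mathbb R[\lambda,q]=\mathbb R[\lambda_1,\dots,\lambda_l,q_1,\dots,q_l]$, with $\Delta_w$ extended $\mathbb R[q]$-linearly, define $$\Lambda_j=\lambda_j+\sum_{\alpha\in\tilde\Phi^+}\lambda_j(\alpha^\vee)\,q^{\alpha^\vee}\Delta_{s_\alpha}\quad(1\le j\le l),\qquad \psi(f)=f(\Lambda_1,\dots,\Lambda_l,q_1,\dots,q_l)(1).$$ The operators $\Lambda_1,\dots,\Lambda_l$ commute (so $\psi$ is unambiguous), $\psi:\mathbb R[\lambda,q]\to\mathbb R[\lambda,q]$ is a bijective $\mathbb R[q]$-linear map, and the composition law on the $\mathbb R[q]$-module $\mathcal H\otimes\mathbb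 R[q]=\mathbb R[\lambda,q]/(I_W\otimes\mathbb R[q])$ given by $$[f]\star[g]=[\psi(\psi^{-1}(f)\,\psi^{-1}(g))],\qquad f,g\in\mathbb R[\lambda,q],$$ is well defined, commutative, associative and $\mathbb R[q]$-bilinear. Moreover: - With $\deg[\lambda_i]=2$ and $\deg q_i=4$, the space $\mathcal H\otimes\mathbb R[q]$ is the direct sum of its subspaces of homogeneous elements of degree $d\ge 0$, and if $a,b$ are homogeneous of degrees $d,e$, then $a\star b$ is homogeneous of degree $d+e$ (possibly zero). - (Frobenius property) There is a unique $\mathbb R$-bilinear form $(\ ,\ )$ on $\mathcal H$, the Poincaré pairing, with $(\sigma_u,\sigma_v)=1$ if $u=w_0v$ and $(\sigma_u,\sigma_v)=0$ otherwise. It has a unique $\mathbb R[q]$-bilinear extension to $\mathcal H\otimes\mathbb R[q]$, and this extension satisfies $(a\star b,c)=(a,b\star c)$ for all $a,b,c\in\mathcal H\otimes\mathbb R[q]$. -/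

import Mathlib

noncomputable section

namespace QFlag

open MvPolynomial

variable {ι M N : Type*} [AddCommGroup M] [Module ℝ M] [AddCommGroup N] [Module ℝ N]
variable {P : RootPairing ι ℝ M N}

/-! ### Weyl group, length, longest element -/

/-- The simple reflection `s_i`, as an element of the Weyl group. -/
def simpleRefl (b : P.Base) (i : b.support) : P.weylGroup :=
  RootPairing.weylGroup.ofIdx P i

/-- The element of the Weyl group spelled by a word in the simple reflections. -/
def wordProd (b : P.Base) (L : List b.support) : P.weylGroup :=
  (L.map (simpleRefl b)).prod

/-- The length `l(w)`: the least number of factors in an expression of `w` as a product of simple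
reflections. -/
def length (b : P.Base) (w : P.weylGroup) : ℕ :=
  sInf {n | ∃ L : List b.support, L.length = n ∧ wordProd b L = w}

/-- The simple reflections generate the Weyl group. -/
theorem exists_word [Finite ι] [P.IsRootSystem] [P.IsCrystallographic] [P.IsReduced]
    (b : P.Base) (w : P.weylGroup) : ∃ L : List b.support, wordProd b L = w := by
  have hmul : ∀ x y : P.weylGroup, (∃ L : List b.support, wordProd b L = x) →
      (∃ L : List b.support, wordProd b L = y) →
      ∃ L : List b.support, wordProd b L = x * y := by
    rintro x y ⟨L, rfl⟩ ⟨L', rfl⟩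
    exact ⟨L ++ L', by simp [wordProd]⟩
  have hinj : Function.Injective (RootPairing.Equiv.weightHom P) :=
    RootPairing.Equiv.weightHom_injective P
  have hrefl : ∀ i : ι, ∃ L : List b.support,
      wordProd b L = RootPairing.weylGroup.ofIdx P i := by
    intro i
    induction i using b.induction_reflect with
    | h₀ i hi =>
      obtain ⟨L, hL⟩ := hi
      refine ⟨L, hL.trans (Subtype.ext (hinj (LinearEquiv.ext fun x => ?_)))⟩
      change P.reflection i x = P.reflection (P.reflectionPerm i i) x
      simp [RootPairing.reflection_apply, two_smul]
    | h₁ i hi => exact ⟨[⟨i, hi⟩], by simp [wordProd, simpleRefl]⟩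
    | h₂ i j hi hj =>
      have hs : ∃ L : List b.support, wordProd b L = RootPairing.weylGroup.ofIdx P j :=
        ⟨[⟨j, hj⟩], by simp [wordProd, simpleRefl]⟩
      obtain ⟨L, hL⟩ := hmul _ _ (hmul _ _ hs hi) hs
      refine ⟨L, hL.trans (Subtype.ext (hinj (LinearEquiv.ext fun x => ?_)))⟩
      change P.reflection j (P.reflection i (P.reflection j x)) =
        P.reflection (P.reflectionPerm j i) x
      rw [RootPairing.reflection_reflectionPerm]
      rfl
  obtain ⟨w, hw⟩ := w
  induction hw using RootPairing.weylGroup.induction with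
  | mem i => exact hrefl i
  | one => exact ⟨[], rfl⟩
  | mul x y hx hy h₁ h₂ => exact hmul ⟨x, hx⟩ ⟨y, hy⟩ h₁ h₂

theorem exists_reduced_word [Finite ι] [P.IsRootSystem] [P.IsCrystallographic] [P.IsReduced]
    (b : P.Base) (w : P.weylGroup) :
    ∃ L : List b.support, L.length = length b w ∧ wordProd b L = w :=
  Nat.sInf_mem (s := {n | ∃ L : List b.support, L.length = n ∧ wordProd b L = w})
    (let ⟨L, hL⟩ := exists_word b w; ⟨L.length, L, rfl, hL⟩)

/-- A reduced expression of `w` in the simple reflections. -/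
def reducedWord [Finite ι] [P.IsRootSystem] [P.IsCrystallographic] [P.IsReduced]
    (b : P.Base) (w : P.weylGroup) : List b.support :=
  (exists_reduced_word b w).choose

instance finite_weylGroup [Finite ι] [P.IsRootSystem] : Finite P.weylGroup := by
  refine Finite.of_injective (fun (w : P.weylGroup) (i : ι) => w.1 • i) fun v w h => ?_
  refine Subtype.ext (RootPairing.Equiv.weightHom_injective P (LinearEquiv.toLinearMap_injective ?_))
  refine LinearMap.ext_on_range (v := P.root) RootPairing.IsRootSystem.span_root_eq_top fun i => ?_
  change v.1 • P.root i = w.1 • P.root i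
  rw [← RootPairing.Equiv.root_indexEquiv_eq_smul, ← RootPairing.Equiv.root_indexEquiv_eq_smul]
  exact congrArg P.root (congrFun h i)

/-- The longest element `w₀` of the Weyl group. -/
def longest [Finite ι] [P.IsRootSystem] (b : P.Base) : P.weylGroup :=
  (Finite.exists_max (length b)).choose

/-! ### The polynomial ring `A[λ_1, …, λ_l]` and the action of the Weyl group

Here `A` is an `ℝ`-algebra: `A = ℝ` gives `S(𝔱^*) = ℝ[λ]`, and `A = ℝ[q]` gives `ℝ[λ, q]`, seen as
the polynomials in the `λ_i` with coefficients in `ℝ[q]`. -/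

variable (A : Type*) [CommRing A] [Algebra ℝ A]

/-- The element `x = ∑ j, x(α_j^∨) λ_j` of `𝔱^*`, as a linear polynomial in the `λ_j`. -/
def linPoly (b : P.Base) : M →ₗ[ℝ] MvPolynomial b.support A :=
  ∑ j : b.support, LinearMap.smulRight (P.coroot' j) (X j : MvPolynomial b.support A)

variable [P.IsRootSystem]

/-- The fundamental weight `λ_i`, defined by `λ_i(α_j^∨) = δ_ij`. -/
def fundWeight (b : P.Base) (i : b.support) : M :=
  P.toLinearMap.toPerfPair.symm (b.toCoweightBasis.coord i)

/-- The action of `w` on `A[λ]`: the `A`-algebra map extending the action of `w` on `𝔱^*`. -/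
def weylAct (b : P.Base) (w : P.weylGroup) :
    MvPolynomial b.support A →ₐ[A] MvPolynomial b.support A :=
  aeval fun i => linPoly A b (w • fundWeight b i)

open Classical in
theorem linPoly_fundWeight (b : P.Base) (i : b.support) :
    linPoly A b (fundWeight b i) = X i := by
  have h : ∀ j : b.support, P.toLinearMap (fundWeight b i) (P.coroot j) =
      if j = i then 1 else 0 := by
    intro j
    rw [← LinearMap.toPerfPair_apply, fundWeight, LinearEquiv.apply_symm_apply,
      Module.Basis.coord_apply, RootPairing.Base.toCoweightBasis_repr_coroot,
      Finsupp.single_apply]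
  simp [linPoly, RootPairing.coroot', h]

theorem dvd_sub_weylAct (b : P.Base) (k : ι) (f : MvPolynomial b.support A) :
    linPoly A b (P.root k) ∣ f - weylAct A b (RootPairing.weylGroup.ofIdx P k) f := by
  induction f using MvPolynomial.induction_on with
  | C a => simp [weylAct]
  | add f g hf hg => 
    rw [map_add, add_sub_add_comm]
    exact dvd_add hf hg
  | mul_X f i hf =>
    have hX : linPoly A b (P.root k) ∣
        X i - weylAct A b (RootPairing.weylGroup.ofIdx P k) (X i) := by
      rw [weylAct, aeval_X, RootPairing.weylGroup.ofIdx_smul,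
        RootPairing.Equiv.reflection_smul, RootPairing.reflection_apply, map_sub,
        linPoly_fundWeight, sub_sub_cancel, map_smul]
      rw [Algebra.smul_def]
      exact dvd_mul_left _ _
    rw [map_mul]
    have : f * X i - weylAct A b (RootPairing.weylGroup.ofIdx P k) f *
          weylAct A b (RootPairing.weylGroup.ofIdx P k) (X i) =
        (f - weylAct A b (RootPairing.weylGroup.ofIdx P k) f) * X i +
          weylAct A b (RootPairing.weylGroup.ofIdx P k) f *
            (X i - weylAct A b (RootPairing.weylGroup.ofIdx P k) (X i)) := by ring
    rw [this]
    exact dvd_add (hf.mul_right _) (hX.mul_left _)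

open Classical in
theorem linPoly_root_ne_zero [Nontrivial A] (b : P.Base) (k : ι) :
    linPoly A b (P.root k) ≠ 0 := by
  intro h
  refine P.ne_zero k (P.toLinearMap.toPerfPair.injective ?_)
  rw [map_zero]
  refine b.toCoweightBasis.ext fun j => ?_
  have h' := congrArg (aeval (fun i => if i = j then (1 : A) else 0)) h
  have h'' : algebraMap ℝ A (P.toLinearMap (P.root k) (P.coroot j)) = 0 := by
    rw [map_zero, linPoly, LinearMap.sum_apply, map_sum, Finset.sum_eq_single j] at h'
    · simpa [Algebra.smul_def, IsScalarTower.algebraMap_apply ℝ A (MvPolynomial b.support A),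
        RootPairing.coroot'] using h'
    · intro i _ hi
      simp [Algebra.smul_def, hi]
    · simp
  simpa using (map_eq_zero_iff _ (algebraMap ℝ A).injective).1 h''

/-! ### The classical cohomology ring -/

/-- The ideal `I_W` of `ℝ[λ]` generated by the homogeneous `W`-invariant polynomials of strictly
positive degree. -/
def invIdeal (b : P.Base) : Ideal (MvPolynomial b.support ℝ) :=
  Ideal.span {f | (∃ d, 0 < d ∧ f.IsHomogeneous d) ∧ ∀ w : P.weylGroup, weylAct ℝ b w f = f}

/-- `ℋ = ℝ[λ] / I_W`. -/
abbrev Coh (b : P.Base) : Type _ := MvPolynomial b.support ℝ ⧸ invIdeal b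

/-! ### Divided difference operators -/

variable [IsDomain A]

/-- The divided difference operator `Δ_α(f) = (f - s_α f) / α`, for the root `α` with index `k`. -/
def divDiff (b : P.Base) (k : ι) :
    MvPolynomial b.support A →ₗ[A] MvPolynomial b.support A where
  toFun f := (dvd_sub_weylAct A b k f).choose
  map_add' f g := by
    refine mul_left_cancel₀ (linPoly_root_ne_zero A b k) ?_
    rw [mul_add, ← (dvd_sub_weylAct A b k (f + g)).choose_spec,
      ← (dvd_sub_weylAct A b k f).choose_spec, ← (dvd_sub_weylAct A b k g).choose_spec, map_add]
    ring
  map_smul' a f := by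
    refine mul_left_cancel₀ (linPoly_root_ne_zero A b k) ?_
    rw [RingHom.id_apply, mul_smul_comm, ← (dvd_sub_weylAct A b k (a • f)).choose_spec,
      ← (dvd_sub_weylAct A b k f).choose_spec, map_smul, smul_sub]

/-- The defining property of `Δ_α`. -/
theorem root_mul_divDiff (b : P.Base) (k : ι) (f : MvPolynomial b.support A) :
    linPoly A b (P.root k) * divDiff A b k f =
      f - weylAct A b (RootPairing.weylGroup.ofIdx P k) f :=
  (dvd_sub_weylAct A b k f).choose_spec.symm

variable [Fintype ι] [P.IsCrystallographic] [P.IsReduced]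

/-- `Δ_w = Δ_{α_{i_1}} ∘ ⋯ ∘ Δ_{α_{i_k}}` for a reduced expression `w = s_{i_1} ⋯ s_{i_k}`. -/
def divDiffW (b : P.Base) (w : P.weylGroup) : Module.End A (MvPolynomial b.support A) :=
  ((reducedWord b w).map fun i => (divDiff A b i : Module.End A _)).prod

/-! ### Schubert classes -/

open Classical in
/-- `c_{w₀} = |W|⁻¹ ∏_{α > 0} α`. -/
def topPoly (b : P.Base) : MvPolynomial b.support ℝ :=
  (Nat.card P.weylGroup : ℝ)⁻¹ • ∏ k with b.IsPos k, linPoly ℝ b (P.root k)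

/-- `c_w = Δ_{w⁻¹ w₀} c_{w₀}`. -/
def bggPoly (b : P.Base) (w : P.weylGroup) : MvPolynomial b.support ℝ :=
  divDiffW ℝ b (w⁻¹ * longest b) (topPoly b)

/-- The Schubert class `σ_w = [c_w]`. -/
def schubert (b : P.Base) (w : P.weylGroup) : Coh b := Ideal.Quotient.mk _ (bggPoly b w)

/-- `B` is the Poincaré pairing on `ℋ`: `(σ_u, σ_v) = 1` if `u = w₀ v`, and `0` otherwise. -/
def IsPoincarePairing (b : P.Base) (B : LinearMap.BilinForm ℝ (Coh b)) : Prop :=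
  (∀ v : P.weylGroup, B (schubert b (longest b * v)) (schubert b v) = 1) ∧
    ∀ u v : P.weylGroup, u ≠ longest b * v → B (schubert b u) (schubert b v) = 0

/-! ### The operators `Λ_j` and `ψ` on `ℝ[λ, q]` -/

/-- The ring `ℝ[q_1, …, q_l]`. -/
abbrev QRing (b : P.Base) : Type _ := MvPolynomial b.support ℝ

/-- The ring `ℝ[λ, q]`, as the polynomials in the `λ_i` with coefficients in `ℝ[q]`. -/
abbrev QPoly (b : P.Base) : Type _ := MvPolynomial b.support (QRing b)

/-- The coefficient `m_i` in `α^∨ = m_1 α_1^∨ + ⋯ + m_l α_l^∨`. For a positive root `α` it is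
a natural number, so that nothing is rounded here. -/
def corootCoeff (b : P.Base) (k : ι) (i : b.support) : ℕ :=
  ⌊b.toCoweightBasis.repr (P.coroot k) i⌋₊

/-- The set of positive roots `α` with `l(s_α) = 2 ht(α^∨) - 1`. -/
def minRoots (b : P.Base) : Set ι :=
  {k | b.IsPos k ∧ length b (RootPairing.weylGroup.ofIdx P k) + 1 = 2 * ∑ i, corootCoeff b k i}

/-- The monomial `q^{α^∨} = q_1^{m_1} ⋯ q_l^{m_l}`. -/
def qMonomial (b : P.Base) (k : ι) : QRing b := ∏ i, X i ^ corootCoeff b k i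

open Classical in
/-- The operator
`Λ_j = λ_j + ∑ α, λ_j(α^∨) q^{α^∨} Δ_{s_α}`, the sum running over the set `minRoots b`. -/
def lambdaOp (b : P.Base) (j : b.support) : Module.End (QRing b) (QPoly b) :=
  LinearMap.mulLeft (QRing b) (X j : QPoly b) +
    ∑ k with k ∈ minRoots b,
      (C (P.toLinearMap (fundWeight b j) (P.coroot k)) * qMonomial b k : QRing b) •
        divDiffW (QRing b) b (RootPairing.weylGroup.ofIdx P k)

/-- The evaluation `f(T_1, …, T_l)` of a polynomial `f` at operators `T_i`: the monomial
`λ_1^{n_1} ⋯ λ_l^{n_l}` goes to `T_1^{n_1} ∘ ⋯ ∘ T_l^{n_l}`. The order of the factors (that of some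
enumeration of the indices) is immaterial when the `T_i` commute. -/
def evalOp {σ R V : Type*} [Fintype σ] [CommRing R] [AddCommGroup V] [Module R V]
    (T : σ → Module.End R V) : MvPolynomial σ R →ₗ[R] Module.End R V :=
  (basisMonomials σ R).constr R fun n => ((Finset.univ.toList).map fun i => T i ^ n i).prod

/-- `ψ(f) = f(Λ_1, …, Λ_l, q_1, …, q_l)(1)`. -/
def psi (b : P.Base) : QPoly b →ₗ[QRing b] QPoly b :=
  (evalOp (lambdaOp b)).flip 1

/-- The inverse of `ψ`. -/
def psiInv (b : P.Base) : QPoly b → QPoly b := Function.invFun (psi b)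

/-! ### The module `ℋ ⊗ ℝ[q]` -/

/-- The ideal `I_W ⊗ ℝ[q]` of `ℝ[λ, q]`, generated by `I_W`. -/
def quantIdeal (b : P.Base) : Ideal (QPoly b) :=
  (invIdeal b).map (MvPolynomial.map (C : ℝ →+* QRing b))

/-- `ℋ ⊗ ℝ[q] = ℝ[λ, q] / (I_W ⊗ ℝ[q])`. -/
abbrev QCoh (b : P.Base) : Type _ := QPoly b ⧸ quantIdeal b

/-- The class `[f]` of a polynomial `f`. -/
def qClass (b : P.Base) : QPoly b →ₗ[QRing b] QCoh b :=
  (Ideal.Quotient.mkₐ (QRing b) (quantIdeal b)).toLinearMap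

/-- The inclusion `ℋ → ℋ ⊗ ℝ[q]`, `a ↦ a ⊗ 1`. -/
def incl (b : P.Base) : Coh b →+* QCoh b :=
  Ideal.quotientMap (quantIdeal b) (MvPolynomial.map (C : ℝ →+* QRing b)) Ideal.le_comap_map

/-- The homogeneous elements of degree `d`, where `deg λ_i = 2` and `deg q_i = 4`: the real span of
the classes of the monomials `q^m λ^n` with `2|n| + 4|m| = d`. -/
def gradedPiece (b : P.Base) (d : ℕ) : Submodule ℝ (QCoh b) :=
  Submodule.span ℝ {x | ∃ n m : b.support →₀ ℕ,
    2 * n.degree + 4 * m.degree = d ∧ x = qClass b (monomial n (monomial m 1))}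

/-- `Bq` is the `ℝ[q]`-bilinear extension to `ℋ ⊗ ℝ[q]` of the bilinear form `B` on `ℋ`. -/
def IsExtension (b : P.Base) (B : LinearMap.BilinForm ℝ (Coh b))
    (Bq : LinearMap.BilinForm (QRing b) (QCoh b)) : Prop :=
  ∀ x y : Coh b, Bq (incl b x) (incl b y) = C (B x y)

end QFlag

end

/-! Everything follows from the calculus of divided differences. Moving a linear form through a word
of operators `Δ_i` deletes one letter at a time, and the deletions sum up to the inversions of the
product (`sum_deletions`). Hence a word gives `Δ_w` if it is reduced and zero otherwise
(`wordOp_eq`), and `Δ_w (x f) = (w x) Δ_w f + ∑ x(β^∨) Δ_{w s_β} f` over the inversions `β` with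
`l(w s_β) = l(w) - 1`.

Commutativity of the `Λ_j`: the commutator of `Λ_x` and `Λ_y` has terms `q^{δ^∨} Δ_{s_δ s_γ}` from
this rule and terms `q^{α^∨ + β^∨} Δ_{s_α s_β}` from products of two quantum parts. The bound
`l(s_α) ≤ 2 ht(α^∨) - 1`, with equality on `minRoots`, forces a sign-reversing matching between the
two families, with `δ^∨ = α^∨ + β^∨`; orthogonal pairs cancel among themselves
(`sum_coverTerm_add_sum_reducedTerm`).

Bijectivity and grading: a quantum term multiplies by `q^{α^∨}`, of degree `4 ht(α^∨)`, and lowers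
the `λ`-degree by `2 ht(α^∨) - 1 ≥ 1`. So `Λ_j` raises the total degree by 2, and `ψ` preserves it
and is the identity up to terms of lower `λ`-degree.

The product: `ψ(F G) = F(Λ) ψ(G)`, and the `Λ_j` preserve `I_W ⊗ ℝ[q]` because the `Δ_w` are linear
over invariants. So multiplication of polynomials, transported by `ψ`, descends to the quotient, and
commutativity and associativity come for free.

Frobenius property: up to a nonzero constant the Poincaré pairing is `(f, g) ↦ (Δ_{w₀} (f g))(0)`.
For it `Δ_w` is adjoint to `Δ_{w⁻¹}`; reflections are involutions, so every `Λ_j` is self-adjoint,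
and so is every polynomial in them. The constant is nonzero because `c_{w₀}` does not lie in `I_W`,
as antisymmetrization shows. -/

noncomputable section

namespace QFlag

set_option linter.unusedSectionVars false

open MvPolynomial

/-! ### Roots and coroots under the Weyl group -/

section Indices

variable {ι M N : Type*} [AddCommGroup M] [Module ℝ M] [AddCommGroup N] [Module ℝ N]
variable {P : RootPairing ι ℝ M N}

/-- The index of the opposite root. -/
def negIdx (P : RootPairing ι ℝ M N) (i : ι) : ι := P.reflectionPerm i i

/-- The reflection in a root, as an element of the Weyl group. -/
abbrev refl (P : RootPairing ι ℝ M N) (i : ι) : P.weylGroup := RootPairing.weylGroup.ofIdx P i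

@[simp] theorem root_negIdx (i : ι) : P.root (negIdx P i) = -P.root i := by
  simp [negIdx]

@[simp] theorem coroot_negIdx (i : ι) : P.coroot (negIdx P i) = -P.coroot i := by
  simp [negIdx]

@[simp] theorem negIdx_negIdx (i : ι) : negIdx P (negIdx P i) = i :=
  P.root.injective (by simp)

theorem negIdx_ne (i : ι) : negIdx P i ≠ i := fun h => by
  have h' := congrArg P.root h
  rw [root_negIdx, neg_eq_iff_add_eq_zero, ← two_smul ℝ, smul_eq_zero] at h'
  exact h'.elim two_ne_zero (P.ne_zero i)

theorem root_smul (w : P.weylGroup) (i : ι) : P.root (w • i) = w • P.root i :=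
  RootPairing.Equiv.root_indexEquiv_eq_smul P i w.1

theorem coroot'_smul (w : P.weylGroup) (i : ι) (x : M) :
    P.coroot' (w • i) (w • x) = P.coroot' i x := by
  obtain ⟨w, hw⟩ := w
  induction hw using RootPairing.weylGroup.induction generalizing i x with
  | mem k =>
    change P.coroot' (P.reflectionPerm k i) (P.reflection k x) = _
    rw [RootPairing.coroot'_reflectionPerm]
    simp
  | one => exact congrArg₂ (fun j y => P.coroot' j y) (one_smul _ i) (one_smul _ x)
  | mul u v hu hv h₁ h₂ =>
    have := h₁ ((⟨v, hv⟩ : P.weylGroup) • i) ((⟨v, hv⟩ : P.weylGroup) • x)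
    rw [h₂] at this
    exact this

theorem smul_real (w : P.weylGroup) (c : ℝ) (x : M) : w • c • x = c • w • x :=
  smul_comm w.1 c x

theorem refl_smul_idx (k i : ι) : refl P k • i = P.reflectionPerm k i := rfl

theorem refl_smul_weight (k : ι) (x : M) : refl P k • x = x - P.coroot' k x • P.root k :=
  P.reflection_apply k x

@[simp] theorem refl_mul_self (k : ι) : refl P k * refl P k = 1 := by
  rw [mul_eq_one_iff_inv_eq]
  exact Subtype.ext (RootPairing.Equiv.reflection_inv P k)

@[simp] theorem refl_inv (k : ι) : (refl P k)⁻¹ = refl P k :=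
  inv_eq_of_mul_eq_one_left (refl_mul_self k)

@[simp] theorem refl_smul_self (k : ι) : refl P k • k = negIdx P k := rfl

theorem smul_negIdx (w : P.weylGroup) (i : ι) : w • negIdx P i = negIdx P (w • i) :=
  P.root.injective (by rw [root_smul, root_negIdx, root_negIdx, root_smul, smul_neg])

theorem weylGroup_ext {u v : P.weylGroup} (h : ∀ x : M, u • x = v • x) : u = v :=
  Subtype.ext (RootPairing.Equiv.weightHom_injective P (LinearEquiv.ext h))

theorem refl_smul_eq (w : P.weylGroup) (i : ι) : refl P (w • i) = w * refl P i * w⁻¹ := by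
  refine weylGroup_ext fun x => ?_
  have h := coroot'_smul w i (w⁻¹ • x)
  rw [smul_inv_smul] at h
  rw [mul_smul, mul_smul, refl_smul_weight, refl_smul_weight, smul_sub, smul_inv_smul, smul_real,
    root_smul, h]

theorem refl_negIdx (i : ι) : refl P (negIdx P i) = refl P i := by
  rw [← refl_smul_self, refl_smul_eq, refl_mul_self, one_mul, refl_inv]

theorem refl_mul_refl (i j : ι) : refl P i * refl P j = refl P (refl P i • j) * refl P i := by
  rw [refl_smul_eq, refl_inv, mul_assoc, refl_mul_self, mul_one]

theorem refl_mul_refl' (i j : ι) : refl P i * refl P j = refl P j * refl P (refl P j • i) := by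
  rw [refl_smul_eq, refl_inv, ← mul_assoc, ← mul_assoc, refl_mul_self, one_mul]

end Indices

/-! ### Positive roots and inversions -/

section Positive

variable {ι M N : Type*} [AddCommGroup M] [Module ℝ M] [AddCommGroup N] [Module ℝ N]
variable {P : RootPairing ι ℝ M N} {b : P.Base}

theorem isPos_negIdx {i : ι} : b.IsPos (negIdx P i) ↔ ¬ b.IsPos i :=
  RootPairing.Base.IsPos.neg_iff_not b i

variable [Fintype ι] [P.IsRootSystem] [P.IsCrystallographic] [P.IsReduced]

theorem isPos_refl_smul {i j : ι} (hj : j ∈ b.support) (h₁ : i ≠ j) (h₂ : i ≠ negIdx P j) :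
    b.IsPos (refl P j • i) ↔ b.IsPos i := by
  refine ⟨fun h => ?_, fun h => h.reflectionPerm hj h₁⟩
  by_contra hi
  -- A negative root is handled through its opposite.
  have hn := (isPos_negIdx.2 hi).reflectionPerm hj fun h => h₂ (by rw [← h, negIdx_negIdx])
  rw [← refl_smul_idx, smul_negIdx, isPos_negIdx] at hn
  exact hn h

open Classical in
/-- The inversions of `w`: the positive roots that `w` makes negative. -/
def inversions (b : P.Base) (w : P.weylGroup) : Finset ι := {i | b.IsPos i ∧ ¬ b.IsPos (w • i)}

theorem mem_inversions {w : P.weylGroup} {i : ι} :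
    i ∈ inversions b w ↔ b.IsPos i ∧ ¬ b.IsPos (w • i) := by
  classical
  simp [inversions]

theorem inv_smul_notMem_inversions (w : P.weylGroup) (i : b.support) :
    w⁻¹ • (i : ι) ∉ inversions b w := fun h => by
  rw [mem_inversions, smul_inv_smul] at h
  exact h.2 (b.isPos_of_mem_support i.2)

-- A simple reflection `s_i` changes the sign of `±α_i` only, so the inversion sets of `w` and `s_i
-- w` can differ only at the positive one of `±w⁻¹ α_i`.
open Classical in
theorem inversions_simpleRefl_mul {w : P.weylGroup} {i : b.support}
    (h : b.IsPos (w⁻¹ • (i : ι))) :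
    inversions b (simpleRefl b i * w) = insert (w⁻¹ • (i : ι)) (inversions b w) := by
  have hi := b.isPos_of_mem_support i.2
  ext β
  rw [Finset.mem_insert, mem_inversions, mem_inversions, mul_smul]
  by_cases h₁ : w • β = i
  · have hβ : β = w⁻¹ • (i : ι) := by rw [← h₁, inv_smul_smul]
    have : ¬ b.IsPos (simpleRefl b i • (i : ι)) := by
      change ¬ b.IsPos (negIdx P i)
      rwa [isPos_negIdx, not_not]
    rw [h₁, hβ]
    tauto
  by_cases h₂ : w • β = negIdx P i
  · have hβ : β = negIdx P (w⁻¹ • (i : ι)) := by rw [← smul_negIdx, ← h₂, inv_smul_smul]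
    have hn : ¬ b.IsPos β := by rwa [hβ, isPos_negIdx, not_not]
    have hne : β ≠ w⁻¹ • (i : ι) := fun h' => hn (h' ▸ h)
    tauto
  · have hne : β ≠ w⁻¹ • (i : ι) := fun h' => h₁ (by rw [h', smul_inv_smul])
    have := isPos_refl_smul (b := b) i.2 h₁ h₂
    change _ ∧ ¬ b.IsPos (refl P i • w • β) ↔ _
    tauto

theorem simpleRefl_mul_cancel (w : P.weylGroup) (i : b.support) :
    simpleRefl b i * (simpleRefl b i * w) = w := by
  rw [← mul_assoc, simpleRefl, refl_mul_self, one_mul]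

theorem simpleRefl_mul_inv_smul (w : P.weylGroup) (i : b.support) :
    (simpleRefl b i * w)⁻¹ • (i : ι) = negIdx P (w⁻¹ • (i : ι)) := by
  rw [mul_inv_rev, mul_smul, ← smul_negIdx, simpleRefl, refl_inv, refl_smul_self]

open Classical in
theorem inversions_eq_insert {w : P.weylGroup} {i : b.support}
    (h : ¬ b.IsPos (w⁻¹ • (i : ι))) :
    inversions b w = insert (negIdx P (w⁻¹ • (i : ι))) (inversions b (simpleRefl b i * w)) := by
  have := inversions_simpleRefl_mul (w := simpleRefl b i * w) (i := i)
    (by rwa [simpleRefl_mul_inv_smul, isPos_negIdx])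
  rwa [simpleRefl_mul_cancel, simpleRefl_mul_inv_smul] at this

theorem card_inversions_of_pos {w : P.weylGroup} {i : b.support}
    (h : b.IsPos (w⁻¹ • (i : ι))) :
    (inversions b (simpleRefl b i * w)).card = (inversions b w).card + 1 := by
  classical
  rw [inversions_simpleRefl_mul h, Finset.card_insert_of_notMem (inv_smul_notMem_inversions w i)]

theorem card_inversions_of_neg {w : P.weylGroup} {i : b.support}
    (h : ¬ b.IsPos (w⁻¹ • (i : ι))) :
    (inversions b w).card = (inversions b (simpleRefl b i * w)).card + 1 := by
  have := card_inversions_of_pos (w := simpleRefl b i * w) (i := i)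
    (by rwa [simpleRefl_mul_inv_smul, isPos_negIdx])
  rwa [simpleRefl_mul_cancel] at this

/-- Oddness of `F` merges two cases: a gained inversion `w⁻¹ α_i` adds its value, and a lost
inversion `-w⁻¹ α_i` removes the opposite value. No assumption on lengths is then needed. -/
theorem sum_inversions_simpleRefl_mul {V : Type*} [AddCommGroup V] {F : ι → V}
    (hF : ∀ i, F (negIdx P i) = -F i) (w : P.weylGroup) (i : b.support) :
    ∑ β ∈ inversions b (simpleRefl b i * w), F β =
      F (w⁻¹ • (i : ι)) + ∑ β ∈ inversions b w, F β := by
  classical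
  by_cases h : b.IsPos (w⁻¹ • (i : ι))
  · rw [inversions_simpleRefl_mul h, Finset.sum_insert (inv_smul_notMem_inversions w i)]
  · rw [inversions_eq_insert h, Finset.sum_insert, hF, add_neg_cancel_left]
    have := inv_smul_notMem_inversions (simpleRefl b i * w) i
    rwa [simpleRefl_mul_inv_smul] at this

/-! ### Words and deletions -/

@[simp] theorem wordProd_nil : wordProd b [] = 1 := rfl

@[simp] theorem wordProd_cons (i : b.support) (L : List b.support) :
    wordProd b (i :: L) = simpleRefl b i * wordProd b L := by simp [wordProd]

theorem wordProd_append (L L' : List b.support) :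
    wordProd b (L ++ L') = wordProd b L * wordProd b L' := by simp [wordProd]

/-- The words obtained from a word by deleting one letter, each with the root whose reflection
accounts for the deletion. -/
def deletions (b : P.Base) : List b.support → List (ι × List b.support)
  | [] => []
  | i :: L => ((wordProd b L)⁻¹ • (i : ι), L) ::
      (deletions b L).map fun p => (p.1, i :: p.2)

theorem length_of_mem_deletions {L : List b.support} {p : ι × List b.support}
    (hp : p ∈ deletions b L) : p.2.length + 1 = L.length := by
  induction L generalizing p with
  | nil => simp [deletions] at hp
  | cons i L ih =>
    simp only [deletions, List.mem_cons, List.mem_map] at hp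
    rcases hp with rfl | ⟨p, hp, rfl⟩
    · rfl
    · simp [← ih hp]

theorem wordProd_of_mem_deletions {L : List b.support} {p : ι × List b.support}
    (hp : p ∈ deletions b L) : wordProd b p.2 = wordProd b L * refl P p.1 := by
  induction L generalizing p with
  | nil => simp [deletions] at hp
  | cons i L ih =>
    simp only [deletions, List.mem_cons, List.mem_map] at hp
    rcases hp with rfl | ⟨p, hp, rfl⟩
    · simp only [wordProd_cons, refl_smul_eq, inv_inv, simpleRefl]
      simp only [mul_assoc, mul_inv_cancel_left]
      rw [← mul_assoc, refl_mul_self, one_mul]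
    · simp only [wordProd_cons, mul_assoc, ih hp]

/-- In a non-reduced word the roots of the deletions repeat up to sign; an odd `F` cancels these
repetitions and leaves exactly the inversions of the product. -/
theorem sum_deletions {V : Type*} [AddCommGroup V] {F : ι → V}
    (hF : ∀ i, F (negIdx P i) = -F i) (L : List b.support) :
    ((deletions b L).map fun p => F p.1).sum = ∑ β ∈ inversions b (wordProd b L), F β := by
  induction L with
  | nil =>
    rw [Finset.sum_eq_zero]
    · rfl
    · intro β hβ
      rw [mem_inversions, wordProd_nil, one_smul] at hβ
      exact absurd hβ.1 hβ.2
  | cons i L ih =>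
    rw [wordProd_cons, sum_inversions_simpleRefl_mul hF, ← ih]
    simp [deletions, Function.comp_def]

/-- The strong exchange property. `sum_deletions` is applied to the odd indicator of `±β`: the sum
over inversions is 1, so the root of some deletion is `±β`. -/
theorem exists_deletion {L : List b.support} {β : ι} (hβ : β ∈ inversions b (wordProd b L)) :
    ∃ L' : List b.support, L'.length + 1 = L.length ∧
      wordProd b L' = wordProd b L * refl P β := by
  classical
  let F : ι → ℤ := fun i => if i = β then 1 else if i = negIdx P β then -1 else 0
  have hF : ∀ i, F (negIdx P i) = -F i := by
    intro i
    have h₁ : negIdx P i = β ↔ i = negIdx P β :=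
      ⟨fun h => by rw [← h, negIdx_negIdx], fun h => by rw [h, negIdx_negIdx]⟩
    have h₂ : negIdx P i = negIdx P β ↔ i = β :=
      ⟨fun h => by rw [← negIdx_negIdx (P := P) i, h, negIdx_negIdx], fun h => by rw [h]⟩
    have := negIdx_ne (P := P) β
    simp only [F, h₁, h₂]
    split_ifs <;> simp_all
  have hs : ∑ i ∈ inversions b (wordProd b L), F i = 1 := by
    rw [Finset.sum_eq_single β]
    · simp [F]
    · intro i hi hne
      have : i ≠ negIdx P β := by
        rintro rfl
        exact isPos_negIdx.1 (mem_inversions.1 hi).1 (mem_inversions.1 hβ).1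
      simp [F, hne, this]
    · exact fun h => absurd hβ h
  rw [← sum_deletions hF] at hs
  obtain ⟨p, hp, hpF⟩ : ∃ p ∈ deletions b L, F p.1 ≠ 0 := by
    by_contra! h
    rw [List.sum_eq_zero fun x hx => by
      obtain ⟨p, hp, rfl⟩ := List.mem_map.1 hx
      exact h p hp] at hs
    exact zero_ne_one hs
  refine ⟨p.2, length_of_mem_deletions hp, ?_⟩
  rw [wordProd_of_mem_deletions hp]
  have : p.1 = β ∨ p.1 = negIdx P β := by
    by_contra! h
    exact hpF (by simp [F, h.1, h.2])
  rcases this with h | h <;> rw [h]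
  rw [refl_negIdx]

/-! ### The length function -/

theorem card_inversions_le (L : List b.support) :
    (inversions b (wordProd b L)).card ≤ L.length := by
  induction L with
  | nil =>
    rw [Finset.card_eq_zero.2]
    · rfl
    · refine Finset.eq_empty_of_forall_notMem fun β hβ => ?_
      rw [mem_inversions, wordProd_nil, one_smul] at hβ
      exact hβ.2 hβ.1
  | cons i L ih =>
    rw [wordProd_cons, List.length_cons]
    by_cases h : b.IsPos ((wordProd b L)⁻¹ • (i : ι))
    · rw [card_inversions_of_pos h]
      lia
    · have := card_inversions_of_neg h
      lia

/-- Reading from the right, take the first letter `i` that does not add an inversion. Then `-w⁻¹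
α_i` is an inversion of the tail product `w`, and the exchange property spells `s_i w` by the tail
with one letter deleted. -/
theorem exists_shorter_word {L : List b.support}
    (h : (inversions b (wordProd b L)).card < L.length) :
    ∃ L' : List b.support, L'.length < L.length ∧ wordProd b L' = wordProd b L := by
  induction L with
  | nil => simp at h
  | cons i L ih =>
    by_cases h' : (inversions b (wordProd b L)).card < L.length
    · obtain ⟨L', h₁, h₂⟩ := ih h'
      exact ⟨i :: L', by simpa using h₁, by simp [h₂]⟩
    have hneg : ¬ b.IsPos ((wordProd b L)⁻¹ • (i : ι)) := fun hp => by
      rw [wordProd_cons, card_inversions_of_pos hp, List.length_cons] at h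
      lia
    have hmem : negIdx P ((wordProd b L)⁻¹ • (i : ι)) ∈ inversions b (wordProd b L) := by
      classical
      rw [inversions_eq_insert hneg]
      exact Finset.mem_insert_self _ _
    obtain ⟨L', h₁, h₂⟩ := exists_deletion hmem
    refine ⟨L', by rw [List.length_cons]; lia, ?_⟩
    rw [h₂, refl_negIdx, refl_smul_eq, inv_inv, wordProd_cons, simpleRefl]
    simp only [mul_assoc, mul_inv_cancel_left]

theorem length_le (L : List b.support) : length b (wordProd b L) ≤ L.length :=
  Nat.sInf_le ⟨L, rfl, rfl⟩

theorem length_reducedWord (w : P.weylGroup) : (reducedWord b w).length = length b w :=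
  (exists_reduced_word b w).choose_spec.1

@[simp] theorem wordProd_reducedWord (w : P.weylGroup) : wordProd b (reducedWord b w) = w :=
  (exists_reduced_word b w).choose_spec.2

/-- The length is the number of inversions. -/
theorem length_eq_card_inversions (w : P.weylGroup) : length b w = (inversions b w).card := by
  rw [← wordProd_reducedWord (b := b) w]
  refine le_antisymm ?_ ?_
  · by_contra! h
    rw [wordProd_reducedWord, ← length_reducedWord, ← wordProd_reducedWord (b := b) w,
      wordProd_reducedWord (b := b) w] at h
    obtain ⟨L', h₁, h₂⟩ := exists_shorter_word (L := reducedWord b w)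
      (by rwa [wordProd_reducedWord])
    have := length_le L'
    rw [h₂, wordProd_reducedWord, ← length_reducedWord] at this
    lia
  · rw [wordProd_reducedWord (b := b) w, ← length_reducedWord (b := b) w]
    simpa using card_inversions_le (reducedWord b w)

@[simp] theorem length_one : length b (1 : P.weylGroup) = 0 :=
  Nat.le_zero.1 (length_le (b := b) [])

theorem eq_one_of_length_eq_zero {w : P.weylGroup} (h : length b w = 0) : w = 1 := by
  rw [← length_reducedWord, List.length_eq_zero_iff] at h
  rw [← wordProd_reducedWord (b := b) w, h, wordProd_nil]

theorem length_mul_le (u v : P.weylGroup) : length b (u * v) ≤ length b u + length b v := by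
  have := length_le (reducedWord b u ++ reducedWord b v)
  rwa [wordProd_append, List.length_append, length_reducedWord, length_reducedWord,
    wordProd_reducedWord, wordProd_reducedWord] at this

theorem length_inv (w : P.weylGroup) : length b w⁻¹ = length b w := by
  simp only [length_eq_card_inversions]
  -- `i ↦ -w⁻¹ i` carries the inversions of `w⁻¹` to those of `w`.
  refine Finset.card_bij (fun i _ => negIdx P (w⁻¹ • i)) ?_ ?_ ?_
  · intro i hi
    rw [mem_inversions] at hi ⊢
    rw [isPos_negIdx, smul_negIdx, isPos_negIdx, smul_inv_smul, not_not]
    exact hi.symm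
  · intro i _ j _ h
    have := congrArg (negIdx P) h
    simpa using this
  · intro i hi
    rw [mem_inversions] at hi
    refine ⟨negIdx P (w • i), ?_, ?_⟩
    · rw [mem_inversions, isPos_negIdx, smul_negIdx, isPos_negIdx, inv_smul_smul, not_not]
      exact hi.symm
    · rw [smul_negIdx, inv_smul_smul, negIdx_negIdx]

theorem length_simpleRefl_mul_of_pos {w : P.weylGroup} {i : b.support}
    (h : b.IsPos (w⁻¹ • (i : ι))) : length b (simpleRefl b i * w) = length b w + 1 := by
  rw [length_eq_card_inversions, length_eq_card_inversions, card_inversions_of_pos h]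

theorem length_of_neg {w : P.weylGroup} {i : b.support}
    (h : ¬ b.IsPos (w⁻¹ • (i : ι))) : length b w = length b (simpleRefl b i * w) + 1 := by
  rw [length_eq_card_inversions, length_eq_card_inversions, card_inversions_of_neg h]

theorem length_simpleRefl (i : b.support) : length b (simpleRefl b i) = 1 := by
  have := length_simpleRefl_mul_of_pos (b := b) (w := 1) (i := i)
    (by simpa using b.isPos_of_mem_support i.2)
  simpa using this

theorem length_mul_refl_lt {w : P.weylGroup} {β : ι} (h : β ∈ inversions b w) :
    length b (w * refl P β) < length b w := by
  obtain ⟨L', h₁, h₂⟩ := exists_deletion (L := reducedWord b w) (β := β)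
    (by rwa [wordProd_reducedWord])
  have := length_le L'
  rw [h₂, wordProd_reducedWord] at this
  rw [length_reducedWord] at h₁
  lia

theorem lt_length_mul_refl {w : P.weylGroup} {β : ι} (hβ : b.IsPos β) (h : b.IsPos (w • β)) :
    length b w < length b (w * refl P β) := by
  have := length_mul_refl_lt (b := b) (w := w * refl P β) (β := β)
    (mem_inversions.2 ⟨hβ, by rwa [mul_smul, refl_smul_self, smul_negIdx, isPos_negIdx, not_not]⟩)
  rwa [mul_assoc, refl_mul_self, mul_one] at this

/-- The sign of an element of the Weyl group. -/
def sgn (b : P.Base) (w : P.weylGroup) : ℤ := (-1) ^ length b w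

theorem sgn_simpleRefl_mul (w : P.weylGroup) (i : b.support) :
    sgn b (simpleRefl b i * w) = -sgn b w := by
  by_cases h : b.IsPos (w⁻¹ • (i : ι))
  · rw [sgn, sgn, length_simpleRefl_mul_of_pos h, pow_succ, mul_neg_one]
  · rw [sgn, sgn, length_of_neg h, pow_succ, mul_neg_one, neg_neg]

theorem sgn_wordProd_mul (L : List b.support) (w : P.weylGroup) :
    sgn b (wordProd b L * w) = (-1) ^ L.length * sgn b w := by
  induction L with
  | nil => simp
  | cons i L ih => 
    rw [wordProd_cons, mul_assoc, sgn_simpleRefl_mul, ih, List.length_cons, pow_succ]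
    ring

theorem sgn_mul (u v : P.weylGroup) : sgn b (u * v) = sgn b u * sgn b v := by
  conv_lhs => rw [← wordProd_reducedWord (b := b) u, sgn_wordProd_mul, length_reducedWord]
  rfl

theorem sgn_sq (w : P.weylGroup) : sgn b w * sgn b w = 1 := by
  rw [sgn, ← pow_add, ← two_mul, pow_mul]
  simp

theorem exists_smul_simple (β : ι) : ∃ (w : P.weylGroup) (i : b.support), β = w • (i : ι) := by
  induction β using b.induction_reflect with
  | h₀ β h =>
    obtain ⟨w, i, h⟩ := h
    refine ⟨refl P β * w, i, ?_⟩
    rw [mul_smul, ← h]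
    rfl
  | h₁ i hi => exact ⟨1, ⟨i, hi⟩, (one_smul _ _).symm⟩
  | h₂ β j h hj =>
    obtain ⟨w, i, h⟩ := h
    refine ⟨refl P j * w, i, ?_⟩
    rw [mul_smul, ← h]
    rfl

theorem sgn_refl (β : ι) : sgn b (refl P β) = -1 := by
  obtain ⟨w, i, rfl⟩ := exists_smul_simple (b := b) β
  have : sgn b w * sgn b w⁻¹ = 1 := by rw [← sgn_mul, mul_inv_cancel, sgn, length_one, pow_zero]
  have hi : sgn b (refl P (i : ι)) = -1 := by
    change sgn b (simpleRefl b i) = -1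
    rw [sgn, length_simpleRefl, pow_one]
  rw [refl_smul_eq, sgn_mul, sgn_mul, hi, mul_neg_one, neg_mul, this]

/-! ### The longest element. -/

theorem length_longest_le (w : P.weylGroup) : length b w ≤ length b (longest b) :=
  (Finite.exists_max (length b)).choose_spec w

/-- If `w₀` kept a positive root positive, multiplying by its reflection would give a longer
element. -/
theorem isPos_longest_smul (i : ι) : b.IsPos (longest b • i) ↔ ¬ b.IsPos i := by
  have h : ∀ i, b.IsPos i → ¬ b.IsPos (longest b • i) := fun i hi h =>
    (lt_length_mul_refl hi h).not_ge (length_longest_le _)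
  refine ⟨fun h₁ h₂ => h i h₂ h₁, fun h₁ => ?_⟩
  have := h _ (isPos_negIdx.2 h₁)
  rwa [smul_negIdx, isPos_negIdx, not_not] at this

/-- Every positive root either is an inversion of `w w₀` or is sent by `i ↦ -w₀ i` to an inversion
of `w`; all positive roots together number `l(w₀)`. -/
theorem length_mul_longest (w : P.weylGroup) :
    length b (w * longest b) + length b w = length b (longest b) := by
  classical
  rw [← length_inv w]
  simp only [length_eq_card_inversions]
  have h : inversions b (longest b) = ({i | b.IsPos i} : Finset ι) := by
    ext i
    simp [mem_inversions, isPos_longest_smul]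
  have h' : inversions b (w * longest b) =
      ({i | b.IsPos i} : Finset ι).filter fun i => ¬ b.IsPos ((w * longest b) • i) := by
    ext i
    simp [mem_inversions]
  rw [h, h', ← Finset.card_filter_add_card_filter_not (s := ({i | b.IsPos i} : Finset ι))
    (fun i => ¬ b.IsPos ((w * longest b) • i)), ← length_eq_card_inversions, length_inv,
    length_eq_card_inversions]
  congr 1
  refine (Finset.card_bij (fun i _ => negIdx P (longest b • i)) ?_ ?_ ?_).symm
  · intro i hi
    simp only [Finset.mem_filter, Finset.mem_univ, true_and, not_not] at hi
    rw [mem_inversions, isPos_negIdx, isPos_longest_smul, smul_negIdx, isPos_negIdx, ← mul_smul]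
    tauto
  · intro i _ j _ h
    simpa using congrArg (negIdx P) h
  · intro i hi
    rw [mem_inversions] at hi
    refine ⟨negIdx P ((longest b)⁻¹ • i), ?_, ?_⟩
    · simp only [Finset.mem_filter, Finset.mem_univ, true_and, not_not]
      rw [isPos_negIdx, smul_negIdx, isPos_negIdx, mul_smul, smul_inv_smul, 
        ← isPos_longest_smul, smul_inv_smul]
      exact hi
    · rw [smul_negIdx, smul_inv_smul, negIdx_negIdx]

end Positive

/-! ### Heights of coroots -/

section Heights

variable {ι M N : Type*} [AddCommGroup M] [Module ℝ M] [AddCommGroup N] [Module ℝ N]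
variable {P : RootPairing ι ℝ M N} {b : P.Base}
variable [Fintype ι] [P.IsRootSystem] [P.IsCrystallographic] [P.IsReduced]

theorem isPos_flip_refl_smul {i j : ι} (hj : j ∈ b.support) (h₁ : i ≠ j)
    (h₂ : i ≠ negIdx P j) : b.flip.IsPos (refl P j • i) ↔ b.flip.IsPos i :=
  isPos_refl_smul (P := P.flip) (b := b.flip) hj h₁ h₂

theorem isPos_flip_negIdx {i : ι} : b.flip.IsPos (negIdx P i) ↔ ¬ b.flip.IsPos i :=
  isPos_negIdx (P := P.flip) (b := b.flip)

/-- A root is positive if and only if its coroot is. -/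
theorem isPos_flip_iff (i : ι) : b.flip.IsPos i ↔ b.IsPos i := by
  have hs : ∀ i ∈ b.support, b.flip.IsPos i ↔ b.IsPos i := fun i hi =>
    iff_of_true (b.flip.isPos_of_mem_support hi) (b.isPos_of_mem_support hi)
  have hn : ∀ i, (b.flip.IsPos i ↔ b.IsPos i) →
      (b.flip.IsPos (negIdx P i) ↔ b.IsPos (negIdx P i)) := fun i hi => by
    rw [isPos_negIdx, isPos_flip_negIdx, hi]
  -- Both notions of positivity are unchanged by a simple reflection away from `±` its simple root,
  -- so they agree along this induction.
  induction i using b.induction_reflect with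
  | h₀ i h => exact hn i h
  | h₁ i hi => exact hs i hi
  | h₂ i j h hj =>
    change b.flip.IsPos (refl P j • i) ↔ b.IsPos (refl P j • i)
    by_cases h₁ : i = j
    · rw [h₁]
      exact hn j (hs j hj)
    by_cases h₂ : i = negIdx P j
    · rw [h₂, smul_negIdx, refl_smul_self, negIdx_negIdx]
      exact hs j hj
    · rw [isPos_refl_smul hj h₁ h₂, isPos_flip_refl_smul hj h₁ h₂]
      exact h

/-- The floor in `corootCoeff` loses nothing: coefficients of a coroot are natural numbers up to a
common sign, and for a positive root the sign is excluded by the height in the flipped base. -/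
theorem toCoweightBasis_repr_eq {k : ι} (hk : b.IsPos k) (i : b.support) :
    (corootCoeff b k i : ℝ) = b.toCoweightBasis.repr (P.coroot k) i := by
  obtain ⟨f, -, hf⟩ := b.flip.exists_root_eq_sum_nat_or_neg k
  have hpos : ∀ g : ι → ℤ, P.coroot k = ∑ j ∈ b.support, g j • P.coroot j →
      0 < ∑ j ∈ b.support, g j := fun g hg => by
    have := (isPos_flip_iff k).2 hk
    rwa [RootPairing.Base.isPos_iff, RootPairing.Base.height_eq_sum (f := g) hg] at this
  have hf' : P.coroot k = ∑ j ∈ b.support, f j • P.coroot j := by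
    refine hf.resolve_right fun h => ?_
    have h' := hpos (fun j => -(f j : ℤ)) (by simpa using h)
    rw [Finset.sum_neg_distrib, neg_pos] at h'
    exact h'.not_ge (Finset.sum_nonneg fun j _ => Int.natCast_nonneg _)
  have : b.toCoweightBasis.repr (P.coroot k) i = f i := by
    have h₂ : P.coroot k = ∑ j : b.support, (f j : ℝ) • b.toCoweightBasis j := by
      rw [hf', ← Finset.sum_coe_sort]
      simp [Nat.cast_smul_eq_nsmul]
    rw [h₂, Module.Basis.repr_sum_self]
  rw [corootCoeff, this, Nat.floor_natCast]

/-- The height of the coroot of a positive root. -/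
def coheight (b : P.Base) (k : ι) : ℕ := ∑ i, corootCoeff b k i

/-- The sum of the coefficients in the basis of simple coroots. -/
def coheightMap (b : P.Base) : N →ₗ[ℝ] ℝ := ∑ i, b.toCoweightBasis.coord i

theorem coheightMap_coroot {k : ι} (hk : b.IsPos k) :
    coheightMap b (P.coroot k) = coheight b k := by
  simp [coheightMap, coheight, toCoweightBasis_repr_eq hk]

theorem coheight_pos {k : ι} (hk : b.IsPos k) : 0 < coheight b k := by
  rw [Nat.pos_iff_ne_zero]
  intro h
  rw [coheight, Finset.sum_eq_zero_iff] at h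
  refine P.ne_zero' k (b.toCoweightBasis.repr.map_eq_zero_iff.1 (Finsupp.ext fun i => ?_))
  rw [← toCoweightBasis_repr_eq hk, h i (Finset.mem_univ _)]
  simp

/-- The sum of the positive roots. -/
def twoRho (b : P.Base) : M := by
  classical exact ∑ i with b.IsPos i, P.root i

/-- The reflection `s_i` permutes the positive roots other than `α_i`, so `s_i(2ρ) = 2ρ - 2α_i`. -/
theorem coroot'_twoRho (i : b.support) : P.coroot' i (twoRho b) = 2 := by
  classical
  have hi := b.isPos_of_mem_support i.2
  have h : refl P (i : ι) • twoRho b = twoRho b - (2 : ℝ) • P.root i := by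
    have h₁ : twoRho b = P.root i +
        ∑ k ∈ ({k | b.IsPos k} : Finset ι).erase i, P.root k := by
      rw [Finset.add_sum_erase _ _ (by simpa using hi), twoRho]
    have h₂ : refl P (i : ι) • ∑ k ∈ ({k | b.IsPos k} : Finset ι).erase i, P.root k =
        ∑ k ∈ ({k | b.IsPos k} : Finset ι).erase i, P.root k := by
      rw [Finset.smul_sum]
      have hmem : ∀ k ∈ ({k | b.IsPos k} : Finset ι).erase i, 
          refl P (i : ι) • k ∈ ({k | b.IsPos k} : Finset ι).erase i := by
        intro k hk
        rw [Finset.mem_erase, Finset.mem_filter] at hk ⊢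
        refine ⟨fun h => ?_, Finset.mem_univ _, ?_⟩
        · have h' : k = negIdx P i := smul_left_cancel (refl P (i : ι)) (by
            rw [h, smul_negIdx, refl_smul_self, negIdx_negIdx])
          exact isPos_negIdx.1 (h' ▸ hk.2.2) hi
        · rw [isPos_refl_smul i.2 hk.1]
          · exact hk.2.2
          · rintro rfl
            exact isPos_negIdx.1 hk.2.2 hi
      refine Finset.sum_nbij' (fun k => refl P (i : ι) • k) (fun k => refl P (i : ι) • k)
        hmem hmem ?_ ?_ ?_
      · intro k _
        rw [← mul_smul, refl_mul_self, one_smul]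
      · intro k _
        rw [← mul_smul, refl_mul_self, one_smul]
      · intro k _
        rw [root_smul]
    rw [h₁, smul_add, h₂, ← root_smul, refl_smul_self, root_negIdx, two_smul]
    abel
  rw [refl_smul_weight] at h
  have h' := smul_left_injective ℝ (P.ne_zero (i : ι)) (sub_right_injective h)
  exact h'

theorem toLinearMap_twoRho (n : N) : P.toLinearMap (twoRho b) n = 2 * coheightMap b n := by
  have : P.toLinearMap (twoRho b) = (2 : ℝ) • coheightMap b := by
    refine b.toCoweightBasis.ext fun i => ?_
    have h := coroot'_twoRho (b := b) i
    have h' : coheightMap b (P.coroot i) = 1 := by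
      classical
      simp [coheightMap, Finsupp.single_apply]
    rw [RootPairing.Base.toCoweightBasis_apply, LinearMap.smul_apply, h', smul_eq_mul, mul_one]
    exact h
  rw [this]
  rfl

theorem pairing_refl_smul_left (i j : ι) : P.pairingIn ℤ (refl P j • i) j = -P.pairingIn ℤ i j := by
  rw [refl_smul_idx, ← P.pairingIn_reflectionPerm, P.pairingIn_reflectionPerm_self_right]

theorem root_refl_smul (j i : ι) :
    P.root (refl P j • i) = P.root i - P.pairingIn ℤ i j • P.root j := by
  rw [root_smul]
  exact P.reflection_apply_root' ℤ

theorem coroot_refl_smul (j i : ι) :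
    P.coroot (refl P j • i) = P.coroot i - P.pairingIn ℤ j i • P.coroot j := by
  rw [refl_smul_idx, P.coroot_reflectionPerm, P.coreflection_apply_coroot,
    ← P.algebraMap_pairingIn ℤ, algebraMap_smul]

/-- Otherwise `s_α γ` would be `γ` plus a nonnegative multiple of `α`, hence positive. -/
theorem pairing_pos_of_mem_inversions {α γ : ι} (hα : b.IsPos α)
    (h : γ ∈ inversions b (refl P α)) : 0 < P.pairingIn ℤ γ α := by
  by_contra! hle
  rw [mem_inversions] at h
  have h₁ := b.height_add_zsmul (k := refl P α • γ) (i := γ) (j := α) (z := -P.pairingIn ℤ γ α)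
    (by rw [root_refl_smul, neg_smul, sub_eq_add_neg])
  refine h.2 ?_
  have h₂ := h.1
  rw [RootPairing.Base.isPos_iff] at *
  rw [h₁]
  have := mul_nonneg (neg_nonneg.2 hle) hα.le
  rw [smul_eq_mul]
  lia

theorem self_mem_inversions_refl {α : ι} (hα : b.IsPos α) : α ∈ inversions b (refl P α) := by
  rw [mem_inversions, refl_smul_self, isPos_negIdx, not_not]
  exact ⟨hα, hα⟩

/-- Both sides equal `⟨2ρ, α^∨⟩`. In the sum of `⟨γ, α^∨⟩` over all positive `γ`, the roots that
`s_α` keeps positive cancel, since `s_α` permutes them and reverses the sign of the pairing. -/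
theorem two_mul_coheight {α : ι} (hα : b.IsPos α) :
    (2 * coheight b α : ℤ) = ∑ γ ∈ inversions b (refl P α), P.pairingIn ℤ γ α := by
  classical
  have h : (2 * coheight b α : ℝ) = ∑ γ with b.IsPos γ, P.pairing γ α := by
    rw [← coheightMap_coroot hα, ← toLinearMap_twoRho, twoRho, map_sum, LinearMap.sum_apply]
    rfl
  have h₁ : (2 * coheight b α : ℤ) = ∑ γ with b.IsPos γ, P.pairingIn ℤ γ α := by
    apply Int.cast_injective (α := ℝ)
    push_cast
    rw [h]
    exact Finset.sum_congr rfl fun γ _ => (P.algebraMap_pairingIn ℤ γ α).symm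
  rw [h₁, ← Finset.sum_filter_add_sum_filter_not _ (fun γ => b.IsPos (refl P α • γ)),
    Finset.filter_filter, Finset.filter_filter]
  have h₂ : ∑ γ with b.IsPos γ ∧ b.IsPos (refl P α • γ), P.pairingIn ℤ γ α = 0 := by
    have : ∑ γ with b.IsPos γ ∧ b.IsPos (refl P α • γ), P.pairingIn ℤ γ α =
        ∑ γ with b.IsPos γ ∧ b.IsPos (refl P α • γ), -P.pairingIn ℤ γ α := by
      have hmem : ∀ γ ∈ ({γ | b.IsPos γ ∧ b.IsPos (refl P α • γ)} : Finset ι),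
          refl P α • γ ∈ ({γ | b.IsPos γ ∧ b.IsPos (refl P α • γ)} : Finset ι) := fun γ h => by
        simp only [Finset.mem_filter, Finset.mem_univ, true_and] at h ⊢
        rw [← mul_smul, refl_mul_self, one_smul]
        exact h.symm
      have hinv : ∀ γ ∈ ({γ | b.IsPos γ ∧ b.IsPos (refl P α • γ)} : Finset ι), 
          refl P α • refl P α • γ = γ := fun γ _ => by
        rw [← mul_smul, refl_mul_self, one_smul]
      refine Finset.sum_nbij' (refl P α • ·) (refl P α • ·) hmem hmem hinv hinv fun γ _ => ?_
      rw [pairing_refl_smul_left, neg_neg]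
    rw [Finset.sum_neg_distrib] at this
    lia
  rw [h₂, zero_add]
  rfl

-- The inversion `α` itself contributes 2, whence the `+ 1` beside the length; every other inversion
-- contributes 1 plus an excess. Nonnegativity of the excess gives `length_refl_lt`, and its
-- vanishing characterizes `minRoots`.
open Classical in
theorem two_mul_coheight' {α : ι} (hα : b.IsPos α) :
    (2 * coheight b α : ℤ) = length b (refl P α) + 1 +
      ∑ γ ∈ (inversions b (refl P α)).erase α, (P.pairingIn ℤ γ α - 1) := by
  rw [two_mul_coheight hα, ← Finset.add_sum_erase _ _ (self_mem_inversions_refl hα),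
    Finset.sum_sub_distrib, Finset.sum_const, Finset.card_erase_of_mem
    (self_mem_inversions_refl hα), length_eq_card_inversions, P.pairingIn_same ℤ]
  have : 0 < (inversions b (refl P α)).card := Finset.card_pos.2 ⟨α, self_mem_inversions_refl hα⟩
  rw [nsmul_one]
  push_cast [Nat.cast_sub this]
  ring

open Classical in
theorem length_refl_lt {α : ι} (hα : b.IsPos α) : length b (refl P α) + 1 ≤ 2 * coheight b α := by
  have h := two_mul_coheight' hα
  have : 0 ≤ ∑ γ ∈ (inversions b (refl P α)).erase α, (P.pairingIn ℤ γ α - 1) :=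
    Finset.sum_nonneg fun γ hγ => by
      have := pairing_pos_of_mem_inversions hα (Finset.mem_of_mem_erase hγ)
      lia
  lia

theorem mem_minRoots {α : ι} :
    α ∈ minRoots b ↔ b.IsPos α ∧ length b (refl P α) + 1 = 2 * coheight b α := Iff.rfl

-- For a root of `minRoots` the nonnegative excesses in `two_mul_coheight'` add up to zero, so each
-- one vanishes.
open Classical in
theorem pairing_eq_one_of_mem_minRoots {α γ : ι} (hα : α ∈ minRoots b)
    (hγ : γ ∈ inversions b (refl P α)) (hne : γ ≠ α) : P.pairingIn ℤ γ α = 1 := by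
  rw [mem_minRoots] at hα
  have h := two_mul_coheight' hα.1
  have hnn : ∀ γ ∈ (inversions b (refl P α)).erase α, 0 ≤ P.pairingIn ℤ γ α - 1 := fun γ hγ => by
    have := pairing_pos_of_mem_inversions hα.1 (Finset.mem_of_mem_erase hγ)
    lia
  have h0 : ∑ γ ∈ (inversions b (refl P α)).erase α, (P.pairingIn ℤ γ α - 1) = 0 := by lia
  rw [Finset.sum_eq_zero_iff_of_nonneg hnn] at h0
  have := h0 γ (Finset.mem_erase.2 ⟨hne, hγ⟩)
  lia

end Heights

/-! ### The action of the Weyl group on polynomials -/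

section Action

variable {ι M N : Type*} [AddCommGroup M] [Module ℝ M] [AddCommGroup N] [Module ℝ N]
variable {P : RootPairing ι ℝ M N} {b : P.Base} [P.IsRootSystem]
variable {A : Type*} [CommRing A] [Algebra ℝ A]

theorem coroot'_fundWeight (i : b.support) : P.coroot' i (fundWeight b i) = 1 := by
  change P.toLinearMap (fundWeight b i) (P.coroot i) = 1
  rw [← LinearMap.toPerfPair_apply, fundWeight, LinearEquiv.apply_symm_apply,
    Module.Basis.coord_apply, RootPairing.Base.toCoweightBasis_repr_coroot, Finsupp.single_eq_same]

theorem coroot'_fundWeight_of_ne {i j : b.support} (h : j ≠ i) :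
    P.coroot' j (fundWeight b i) = 0 := by
  change P.toLinearMap (fundWeight b i) (P.coroot j) = 0
  rw [← LinearMap.toPerfPair_apply, fundWeight, LinearEquiv.apply_symm_apply,
    Module.Basis.coord_apply, RootPairing.Base.toCoweightBasis_repr_coroot,
    Finsupp.single_eq_of_ne h.symm]

theorem weight_eq_sum (x : M) : x = ∑ j : b.support, P.coroot' j x • fundWeight b j := by
  refine P.toLinearMap.toPerfPair.injective (b.toCoweightBasis.ext fun i => ?_)
  rw [LinearMap.toPerfPair_apply, LinearMap.toPerfPair_apply,
    RootPairing.Base.toCoweightBasis_apply]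
  change P.coroot' (i : ι) x = P.coroot' (i : ι) _
  rw [map_sum, Finset.sum_eq_single i]
  · rw [map_smul, coroot'_fundWeight, smul_eq_mul, mul_one]
  · intro j _ hj
    rw [map_smul, coroot'_fundWeight_of_ne hj.symm, smul_zero]
  · simp

theorem linPoly_eq_sum (x : M) :
    linPoly A b x = ∑ j : b.support, P.coroot' j x • (X j : MvPolynomial b.support A) := by
  simp [linPoly]

theorem weylAct_linPoly (w : P.weylGroup) (x : M) :
    weylAct A b w (linPoly A b x) = linPoly A b (w • x) := by
  conv_rhs => rw [weight_eq_sum (b := b) x, Finset.smul_sum, map_sum]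
  rw [linPoly_eq_sum, map_sum]
  refine Finset.sum_congr rfl fun j _ => ?_
  rw [AlgHom.map_smul_of_tower, smul_real, map_smul, weylAct, aeval_X]

theorem weylAct_X (w : P.weylGroup) (i : b.support) :
    weylAct A b w (X i) = linPoly A b (w • fundWeight b i) := aeval_X _ _

theorem weylAct_mul (u v : P.weylGroup) (f : MvPolynomial b.support A) :
    weylAct A b (u * v) f = weylAct A b u (weylAct A b v f) := by
  rw [← AlgHom.comp_apply]
  congr 1
  refine MvPolynomial.algHom_ext fun i => ?_
  rw [AlgHom.comp_apply, weylAct_X, weylAct_X, weylAct_linPoly, mul_smul]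

theorem weylAct_one (f : MvPolynomial b.support A) :
    weylAct A b (1 : P.weylGroup) f = f := by
  conv_rhs => rw [← AlgHom.id_apply (R := A) f]
  congr 1
  refine MvPolynomial.algHom_ext fun i => ?_
  rw [weylAct_X, one_smul, linPoly_fundWeight, AlgHom.id_apply]

theorem map_linPoly (x : M) :
    MvPolynomial.map (algebraMap ℝ A) (linPoly ℝ b x) = linPoly A b x := by
  rw [linPoly_eq_sum, linPoly_eq_sum, map_sum]
  refine Finset.sum_congr rfl fun j _ => ?_
  rw [MvPolynomial.smul_eq_C_mul, map_mul, map_C, map_X, Algebra.smul_def,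
    MvPolynomial.algebraMap_apply]

theorem map_weylAct (w : P.weylGroup) (f : MvPolynomial b.support ℝ) :
    MvPolynomial.map (algebraMap ℝ A) (weylAct ℝ b w f) =
      weylAct A b w (MvPolynomial.map (algebraMap ℝ A) f) := by
  induction f using MvPolynomial.induction_on with
  | C a => simp [weylAct]
  | add f g hf hg => simp only [map_add, hf, hg]
  | mul_X f i hf => simp only [map_mul, hf, map_X, weylAct_X, map_linPoly]

end Action

/-! ### Divided differences -/

section DivDiff

variable {ι M N : Type*} [AddCommGroup M] [Module ℝ M] [AddCommGroup N] [Module ℝ N]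
variable {P : RootPairing ι ℝ M N} {b : P.Base} [P.IsRootSystem]
variable {A : Type*} [CommRing A] [Algebra ℝ A] [IsDomain A]

theorem divDiff_eq_of_mul_eq {k : ι} {f g : MvPolynomial b.support A}
    (h : linPoly A b (P.root k) * g = f - weylAct A b (refl P k) f) : divDiff A b k f = g :=
  mul_left_cancel₀ (linPoly_root_ne_zero A b k) (by rw [root_mul_divDiff, h])

theorem divDiff_linPoly_mul (k : ι) (x : M) (f : MvPolynomial b.support A) :
    divDiff A b k (linPoly A b x * f) =
      linPoly A b (refl P k • x) * divDiff A b k f + P.coroot' k x • f := by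
  refine divDiff_eq_of_mul_eq ?_
  rw [mul_add, mul_left_comm, root_mul_divDiff, map_mul, weylAct_linPoly]
  have : linPoly A b (refl P k • x) = linPoly A b x - P.coroot' k x • linPoly A b (P.root k) := by
    rw [refl_smul_weight, map_sub, map_smul]
  rw [this, mul_smul_comm, ← smul_mul_assoc]
  ring

theorem divDiff_mul_of_invariant {k : ι} {F : MvPolynomial b.support A}
    (hF : weylAct A b (refl P k) F = F) (g : MvPolynomial b.support A) :
    divDiff A b k (F * g) = F * divDiff A b k g := by
  refine divDiff_eq_of_mul_eq ?_
  rw [mul_left_comm, root_mul_divDiff, map_mul, hF, mul_sub]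

theorem divDiff_one (k : ι) : divDiff A b k 1 = 0 :=
  divDiff_eq_of_mul_eq (by simp)

theorem map_divDiff (k : ι) (f : MvPolynomial b.support ℝ) :
    MvPolynomial.map (algebraMap ℝ A) (divDiff ℝ b k f) =
      divDiff A b k (MvPolynomial.map (algebraMap ℝ A) f) := by
  refine (divDiff_eq_of_mul_eq ?_).symm
  rw [← map_weylAct, ← map_linPoly, ← map_mul, root_mul_divDiff, map_sub]

/-- The composite of the divided differences along a word in the simple reflections. -/
def wordOp (A : Type*) [CommRing A] [Algebra ℝ A] [IsDomain A] (b : P.Base) (L : List b.support) : Module.End A (MvPolynomial b.support A) :=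
  (L.map fun i : b.support => (divDiff A b (i : ι) : Module.End A _)).prod

@[simp] theorem wordOp_nil : wordOp A b [] = 1 := rfl

@[simp] theorem wordOp_cons (i : b.support) (L : List b.support) (f : MvPolynomial b.support A) :
    wordOp A b (i :: L) f = divDiff A b i (wordOp A b L f) := by
  rw [wordOp, List.map_cons, List.prod_cons]
  rfl

theorem wordOp_append (L L' : List b.support) :
    wordOp A b (L ++ L') = wordOp A b L * wordOp A b L' := by simp [wordOp]

theorem wordOp_one_eq_zero {L : List b.support} (hL : L ≠ []) : wordOp A b L 1 = 0 := by
  induction L with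
  | nil => exact absurd rfl hL
  | cons i L ih =>
    rw [wordOp_cons]
    by_cases h : L = []
    · rw [h, wordOp_nil]
      exact divDiff_one _
    · rw [ih h, map_zero]

theorem map_wordOp (L : List b.support) (f : MvPolynomial b.support ℝ) :
    MvPolynomial.map (algebraMap ℝ A) (wordOp ℝ b L f) =
      wordOp A b L (MvPolynomial.map (algebraMap ℝ A) f) := by
  induction L with
  | nil => rfl
  | cons i L ih => rw [wordOp_cons, wordOp_cons, map_divDiff, ih]

theorem wordOp_mul_of_invariant {F : MvPolynomial b.support A}
    (hF : ∀ w : P.weylGroup, weylAct A b w F = F) (L : List b.support)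
    (g : MvPolynomial b.support A) : wordOp A b L (F * g) = F * wordOp A b L g := by
  induction L with
  | nil => rfl
  | cons i L ih => rw [wordOp_cons, wordOp_cons, ih, divDiff_mul_of_invariant (hF _)]

/-- A twisted Leibniz rule with a prescribed remainder `R` determines a linear operator from its
value at 1. Operators of different words are compared in this way, without the braid relations. -/
theorem end_ext_of_leibniz {D D' : Module.End A (MvPolynomial b.support A)} (w : P.weylGroup)
    (R : b.support → MvPolynomial b.support A → MvPolynomial b.support A)
    (h : ∀ i f, D (X i * f) = linPoly A b (w • fundWeight b i) * D f + R i f)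
    (h' : ∀ i f, D' (X i * f) = linPoly A b (w • fundWeight b i) * D' f + R i f)
    (h₁ : D 1 = D' 1) : D = D' := by
  refine LinearMap.ext fun f => ?_
  induction f using MvPolynomial.induction_on with
  | C a => rw [C_eq_smul_one, map_smul, map_smul, h₁]
  | add f g hf hg => rw [map_add, map_add, hf, hg]
  | mul_X f i hf => rw [mul_comm, h, h', hf]

end DivDiff

/-! ### The operators indexed by the Weyl group -/

section DivDiffW

variable {ι M N : Type*} [AddCommGroup M] [Module ℝ M] [AddCommGroup N] [Module ℝ N]
variable {P : RootPairing ι ℝ M N} {b : P.Base}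
variable [Fintype ι] [P.IsRootSystem] [P.IsCrystallographic] [P.IsReduced]
variable {A : Type*} [CommRing A] [Algebra ℝ A] [IsDomain A]

/-- By the Leibniz rule each letter either reflects the linear form as it passes or is deleted, at
the cost of a scalar. -/
theorem wordOp_linPoly_mul (L : List b.support) (x : M) (f : MvPolynomial b.support A) :
    wordOp A b L (linPoly A b x * f) = linPoly A b (wordProd b L • x) * wordOp A b L f +
      ((deletions b L).map fun p => P.coroot' p.1 x • wordOp A b p.2 f).sum := by
  induction L with
  | nil => rw [wordProd_nil, one_smul, wordOp_nil, deletions, List.map_nil, List.sum_nil, add_zero]; rfl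
  | cons i L ih =>
    have h : P.coroot' i (wordProd b L • x) = P.coroot' ((wordProd b L)⁻¹ • (i : ι)) x := by
      rw [← coroot'_smul (wordProd b L) ((wordProd b L)⁻¹ • (i : ι)), smul_inv_smul]
    rw [wordOp_cons, ih, map_add, divDiff_linPoly_mul, deletions, List.map_cons, List.sum_cons,
      List.map_map, map_list_sum, List.map_map, wordOp_cons, wordProd_cons, mul_smul, h, add_assoc]
    congr 2
    congr 1
    refine List.map_congr_left fun p _ => ?_
    rw [Function.comp_apply, Function.comp_apply, LinearMap.map_smul_of_tower, wordOp_cons]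

theorem divDiffW_eq_wordOp (w : P.weylGroup) : divDiffW A b w = wordOp A b (reducedWord b w) := by
  simp [divDiffW, wordOp]

theorem divDiffW_one : divDiffW A b (1 : P.weylGroup) = 1 := by
  have : reducedWord b (1 : P.weylGroup) = [] := by
    rw [← List.length_eq_zero_iff, length_reducedWord, length_one]
  rw [divDiffW_eq_wordOp, this, wordOp_nil]

open Classical in
/-- `Δ_w` if `w` has length `n`, and zero otherwise. -/
def divDiffOfLength (A : Type*) [CommRing A] [Algebra ℝ A] [IsDomain A] (b : P.Base) (n : ℕ)
    (w : P.weylGroup) : Module.End A (MvPolynomial b.support A) :=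
  if length b w = n then divDiffW A b w else 0

/-- Once operators of words of length `n` depend only on the product, the deletion terms become an
odd function of the root: `s_{-β} = s_β`, while the coroot changes sign. So `sum_deletions` applies.
-/
theorem wordOp_linPoly_mul_of {n : ℕ}
    (hn : ∀ L : List b.support, L.length = n →
      wordOp A b L = divDiffOfLength A b n (wordProd b L))
    {L : List b.support} (hL : L.length = n + 1) (x : M) (f : MvPolynomial b.support A) :
    wordOp A b L (linPoly A b x * f) = linPoly A b (wordProd b L • x) * wordOp A b L f +
      ∑ β ∈ inversions b (wordProd b L),
        P.coroot' β x • divDiffOfLength A b n (wordProd b L * refl P β) f := by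
  have hodd : ∀ i, P.coroot' (negIdx P i) x •
      divDiffOfLength A b n (wordProd b L * refl P (negIdx P i)) f =
      -(P.coroot' i x • divDiffOfLength A b n (wordProd b L * refl P i) f) := fun i => by
    rw [refl_negIdx, RootPairing.coroot', coroot_negIdx, map_neg, LinearMap.neg_apply, neg_smul]
  rw [wordOp_linPoly_mul, ← sum_deletions (F := fun β => P.coroot' β x •
    divDiffOfLength A b n (wordProd b L * refl P β) f) hodd]
  congr 2
  refine List.map_congr_left fun p hp => ?_
  rw [hn p.2 (by have := length_of_mem_deletions hp; lia), wordProd_of_mem_deletions hp]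

/-- The operator of a word is `Δ_w` if the word is reduced, and zero otherwise. -/
theorem wordOp_eq (L : List b.support) :
    wordOp A b L = divDiffOfLength A b L.length (wordProd b L) := by
  suffices ∀ n, ∀ L : List b.support, L.length = n →
      wordOp A b L = divDiffOfLength A b n (wordProd b L) from this _ L rfl
  intro n
  induction n with
  | zero =>
    intro L hL
    rw [List.length_eq_zero_iff.1 hL, wordProd_nil, divDiffOfLength, if_pos length_one,
      divDiffW_one, wordOp_nil]
  | succ n ih =>
    intro L hL
    have hne : ∀ L' : List b.support, L'.length = n + 1 → L' ≠ [] := by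
      rintro _ h rfl
      simp at h
    have key := fun i f => wordOp_linPoly_mul_of ih hL (fundWeight b i) f
    simp only [linPoly_fundWeight] at key
    rw [divDiffOfLength]
    split_ifs with h
    -- The word and the chosen reduced word have the same product, hence the same remainder in the
    -- Leibniz rule.
    · have hL' : (reducedWord b (wordProd b L)).length = n + 1 := by rw [length_reducedWord, h]
      have key' := fun i f => wordOp_linPoly_mul_of ih hL' (fundWeight b i) f
      simp only [linPoly_fundWeight, wordProd_reducedWord] at key'
      rw [divDiffW_eq_wordOp]
      refine end_ext_of_leibniz (wordProd b L) _ key key' ?_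
      rw [wordOp_one_eq_zero (hne _ hL), wordOp_one_eq_zero (hne _ hL')]
    -- Here the product has length at most `n`, and multiplying by the reflection in an inversion
    -- makes it shorter than `n`: all remainders vanish.
    · refine end_ext_of_leibniz (wordProd b L) (fun _ _ => 0) (fun i f => ?_) (by simp) ?_
      · rw [key, Finset.sum_eq_zero fun β hβ => ?_]
        have h₁ := length_mul_refl_lt hβ
        have h₂ := length_le L
        rw [divDiffOfLength, if_neg (by lia), LinearMap.zero_apply, smul_zero]
      · rw [wordOp_one_eq_zero (hne _ hL), LinearMap.zero_apply]

theorem divDiffW_simpleRefl (i : b.support) : divDiffW A b (simpleRefl b i) = divDiff A b i := by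
  have h := wordOp_eq (A := A) [i]
  rw [wordProd_cons, wordProd_nil, mul_one, divDiffOfLength,
    if_pos (by rw [length_simpleRefl]; rfl)] at h
  rw [← h]
  rfl

theorem divDiffW_mul {u v : P.weylGroup} (h : length b (u * v) = length b u + length b v) :
    divDiffW A b u * divDiffW A b v = divDiffW A b (u * v) := by
  have := wordOp_eq (A := A) (reducedWord b u ++ reducedWord b v)
  rwa [wordOp_append, wordProd_append, List.length_append, length_reducedWord,
    length_reducedWord, wordProd_reducedWord, wordProd_reducedWord, divDiffOfLength,
    if_pos h, ← divDiffW_eq_wordOp, ← divDiffW_eq_wordOp] at this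

theorem divDiffW_mul_eq_zero {u v : P.weylGroup} (h : length b (u * v) ≠ length b u + length b v) :
    divDiffW A b u * divDiffW A b v = 0 := by
  have := wordOp_eq (A := A) (reducedWord b u ++ reducedWord b v)
  rwa [wordOp_append, wordProd_append, List.length_append, length_reducedWord,
    length_reducedWord, wordProd_reducedWord, wordProd_reducedWord, divDiffOfLength,
    if_neg h, ← divDiffW_eq_wordOp, ← divDiffW_eq_wordOp] at this

open Classical in
/-- The commutation rule between `Δ_w` and multiplication by a linear polynomial. -/
theorem divDiffW_linPoly_mul (w : P.weylGroup) (x : M) (f : MvPolynomial b.support A) :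
    divDiffW A b w (linPoly A b x * f) = linPoly A b (w • x) * divDiffW A b w f +
      ∑ β ∈ inversions b w with length b (w * refl P β) + 1 = length b w,
        P.coroot' β x • divDiffW A b (w * refl P β) f := by
  rcases h : length b w with _ | n
  · have : inversions b w = ∅ := by
      rw [← Finset.card_eq_zero, ← length_eq_card_inversions, h]
    rw [eq_one_of_length_eq_zero h] at this ⊢
    simp [divDiffW_one]
  · have := wordOp_linPoly_mul_of (A := A) (n := n) (fun L hL => hL ▸ wordOp_eq L)
      (L := reducedWord b w) (by rw [length_reducedWord, h]) x f
    rw [wordProd_reducedWord] at this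
    rw [divDiffW_eq_wordOp, this, Finset.sum_filter]
    congr 1
    refine Finset.sum_congr rfl fun β _ => ?_
    rw [divDiffOfLength]
    simp only [Nat.add_right_cancel_iff]
    split_ifs <;> simp

theorem map_divDiffW (w : P.weylGroup) (f : MvPolynomial b.support ℝ) :
    MvPolynomial.map (algebraMap ℝ A) (divDiffW ℝ b w f) =
      divDiffW A b w (MvPolynomial.map (algebraMap ℝ A) f) := by
  rw [divDiffW_eq_wordOp, divDiffW_eq_wordOp, map_wordOp]

theorem divDiffW_mul_of_invariant {F : MvPolynomial b.support A}
    (hF : ∀ w : P.weylGroup, weylAct A b w F = F) (w : P.weylGroup)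
    (g : MvPolynomial b.support A) : divDiffW A b w (F * g) = F * divDiffW A b w g := by
  rw [divDiffW_eq_wordOp, wordOp_mul_of_invariant hF]

end DivDiffW

/-! ### Products of two reflections -/

section TwoReflections

variable {ι M N : Type*} [AddCommGroup M] [Module ℝ M] [AddCommGroup N] [Module ℝ N]
variable {P : RootPairing ι ℝ M N} {b : P.Base}
variable [Fintype ι] [P.IsRootSystem] [P.IsCrystallographic] [P.IsReduced]

theorem refl_smul_refl_smul (i j : ι) : refl P i • refl P i • j = j := by
  rw [← mul_smul, refl_mul_self, one_smul]

theorem pairing_refl_smul_right (i j : ι) : P.pairingIn ℤ i (refl P i • j) = -P.pairingIn ℤ i j := by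
  rw [refl_smul_idx, P.pairingIn_reflectionPerm, P.pairingIn_reflectionPerm_self_left]

theorem pairing_negIdx_left (i j : ι) : P.pairingIn ℤ (negIdx P i) j = -P.pairingIn ℤ i j :=
  P.pairingIn_reflectionPerm_self_left ℤ i j

theorem pairing_negIdx_right (i j : ι) : P.pairingIn ℤ i (negIdx P j) = -P.pairingIn ℤ i j :=
  P.pairingIn_reflectionPerm_self_right ℤ i j

theorem coheight_eq_of_coroot_eq {i j k : ι} {m n : ℕ} (hi : b.IsPos i) (hj : b.IsPos j)
    (hk : b.IsPos k) (h : P.coroot k = m • P.coroot i + n • P.coroot j) :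
    coheight b k = m * coheight b i + n * coheight b j := by
  have := congrArg (coheightMap b) h
  rw [map_add, map_nsmul, map_nsmul, coheightMap_coroot hi, coheightMap_coroot hj,
    coheightMap_coroot hk, nsmul_eq_mul, nsmul_eq_mul] at this
  exact_mod_cast this

theorem coheight_add {i j k : ι} (hi : b.IsPos i) (hj : b.IsPos j)
    (hk : b.IsPos k) (h : P.coroot k = P.coroot i + P.coroot j) :
    coheight b k = coheight b i + coheight b j := by
  simpa using coheight_eq_of_coroot_eq (m := 1) (n := 1) hi hj hk (by simpa using h)

theorem corootCoeff_add {i j k : ι} (hi : b.IsPos i) (hj : b.IsPos j)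
    (hk : b.IsPos k) (h : P.coroot k = P.coroot i + P.coroot j) (s : b.support) :
    corootCoeff b k s = corootCoeff b i s + corootCoeff b j s := by
  have : (corootCoeff b k s : ℝ) = corootCoeff b i s + corootCoeff b j s := by
    rw [toCoweightBasis_repr_eq hi, toCoweightBasis_repr_eq hj, toCoweightBasis_repr_eq hk, h,
      map_add, Finsupp.add_apply]
  exact_mod_cast this

theorem qMonomial_add {i j k : ι} (hi : b.IsPos i) (hj : b.IsPos j)
    (hk : b.IsPos k) (h : P.coroot k = P.coroot i + P.coroot j) :
    qMonomial b k = qMonomial b i * qMonomial b j := by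
  simp only [qMonomial, corootCoeff_add hi hj hk h, pow_add, Finset.prod_mul_distrib]

theorem height_eq_of_root_eq {i j k : ι} {m n : ℤ}
    (h : P.root k = m • P.root i + n • P.root j) :
    b.height k = m * b.height i + n * b.height j := by
  obtain ⟨f, -, -, hf⟩ := b.exists_root_eq_sum_int i
  obtain ⟨g, -, -, hg⟩ := b.exists_root_eq_sum_int j
  have hfg : P.root k = ∑ l ∈ b.support, (m • f + n • g) l • P.root l := by
    simp_rw [Pi.add_apply, Pi.smul_apply, add_smul, smul_assoc, Finset.sum_add_distrib,
      ← Finset.smul_sum, ← hf, ← hg, h]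
  rw [RootPairing.Base.height_eq_sum hf, RootPairing.Base.height_eq_sum hg,
    RootPairing.Base.height_eq_sum hfg, Finset.mul_sum, Finset.mul_sum, ← Finset.sum_add_distrib]
  rfl

theorem height_refl_smul (j i : ι) :
    b.height (refl P j • i) = b.height i - P.pairingIn ℤ i j * b.height j := by
  rw [height_eq_of_root_eq (m := 1) (n := -P.pairingIn ℤ i j) (i := i) (j := j)
    (by rw [root_refl_smul, one_smul, neg_smul, sub_eq_add_neg])]
  ring

/-- The pairs `(δ, γ)` that index the commutators of the `Δ_{s_δ}` with linear polynomials. -/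
def IsCoverPair (b : P.Base) (δ γ : ι) : Prop :=
  δ ∈ minRoots b ∧ γ ∈ inversions b (refl P δ) ∧ γ ≠ δ ∧
    length b (refl P δ * refl P γ) + 1 = length b (refl P δ)

/-- The pairs `(α, β)` for which `Δ_{s_α} Δ_{s_β}` does not vanish. -/
def IsReducedPair (b : P.Base) (α β : ι) : Prop :=
  α ∈ minRoots b ∧ β ∈ minRoots b ∧
    length b (refl P α * refl P β) = length b (refl P α) + length b (refl P β)

/-- The squeezing argument: lengths attain their bounds. -/
theorem isReducedPair_of_length_le {α β : ι} (hα : b.IsPos α) (hβ : b.IsPos β)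
    (h : 2 * (coheight b α + coheight b β) ≤ length b (refl P α * refl P β) + 2) :
    IsReducedPair b α β := by
  have h₁ := length_refl_lt hα
  have h₂ := length_refl_lt hβ
  have h₃ := length_mul_le (b := b) (refl P α) (refl P β)
  exact ⟨mem_minRoots.2 ⟨hα, by lia⟩, mem_minRoots.2 ⟨hβ, by lia⟩, by lia⟩

theorem IsReducedPair.isPos_left {α β : ι} (h : IsReducedPair b α β) : b.IsPos α := h.1.1

theorem IsReducedPair.isPos_right {α β : ι} (h : IsReducedPair b α β) : b.IsPos β := h.2.1.1

theorem IsReducedPair.length_add_two {α β : ι} (h : IsReducedPair b α β) :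
    length b (refl P α * refl P β) + 2 = 2 * (coheight b α + coheight b β) := by
  have h₁ := (mem_minRoots.1 h.1).2
  have h₂ := (mem_minRoots.1 h.2.1).2
  have h₃ := h.2.2
  lia

theorem IsReducedPair.inv {α β : ι} (h : IsReducedPair b α β) : 
    length b (refl P β * refl P α) = length b (refl P β) + length b (refl P α) := by
  rw [← length_inv, mul_inv_rev, refl_inv, refl_inv, h.2.2, add_comm]

theorem length_mul_eq_isPos_smul {w : P.weylGroup} {β : ι} (hβ : b.IsPos β)
    (h : length b (w * refl P β) = length b w + length b (refl P β)) : b.IsPos (w • β) := by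
  by_contra hn
  have := length_mul_refl_lt (mem_inversions.2 ⟨hβ, hn⟩)
  lia

theorem IsReducedPair.isPos_smul {α β : ι} (h : IsReducedPair b α β) :
    b.IsPos (refl P α • β) := length_mul_eq_isPos_smul h.isPos_right h.2.2

theorem IsReducedPair.isPos_smul' {α β : ι} (h : IsReducedPair b α β) :
    b.IsPos (refl P β • α) := length_mul_eq_isPos_smul h.isPos_left h.inv

theorem IsReducedPair.ne {α β : ι} (h : IsReducedPair b α β) : α ≠ β := by
  rintro rfl
  have := h.isPos_smul
  rw [refl_smul_self, isPos_negIdx] at this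
  exact this h.isPos_left

/-- In a reduced pair, the roots are orthogonal or one of the pairings is `-1`. -/
theorem IsReducedPair.pairing_cases {α β : ι} (h : IsReducedPair b α β) :
    (P.pairingIn ℤ α β = 0 ∧ P.pairingIn ℤ β α = 0) ∨
    (P.pairingIn ℤ α β = -1 ∧ P.pairingIn ℤ β α < 0) ∨
    (P.pairingIn ℤ α β < -1 ∧ P.pairingIn ℤ β α = -1) := by
  have h₁ := h.isPos_smul
  have h₂ := h.isPos_smul'
  have hα := h.isPos_left
  have hβ := h.isPos_right
  rw [RootPairing.Base.isPos_iff] at h₁ h₂ hα hβ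
  rw [height_refl_smul] at h₁ h₂
  have hne := h.ne
  -- The possible values of the two pairings are finitely many. Positive heights of `s_α β` and `s_β
  -- α` exclude the positive values, and `(-2, -2)` would mean `α = -β`.
  have hne' : α ≠ negIdx P β := fun h' => isPos_negIdx.1 (h' ▸ h.isPos_left) h.isPos_right
  have hset := P.pairingIn_pairingIn_mem_set_of_isCrystal_of_isRed α β
  simp only [Set.mem_insert_iff, Set.mem_singleton_iff, Prod.mk.injEq] at hset
  have h22 : ¬(P.pairingIn ℤ α β = -2 ∧ P.pairingIn ℤ β α = -2) := fun h => hne' <|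
    P.root.injective <| by rw [root_negIdx, (P.pairingIn_neg_two_neg_two_iff ℤ α β).1 h]
  rcases hset with h | h | h | h | h | h | h | h | h | h | h | h | h <;>
    rw [h.1] at h₂ h22 <;> rw [h.2] at h₁ h22 <;> lia

theorem IsCoverPair.isPos_left {δ γ : ι} (h : IsCoverPair b δ γ) : b.IsPos δ := h.1.1

theorem IsCoverPair.isPos_right {δ γ : ι} (h : IsCoverPair b δ γ) : b.IsPos γ :=
  (mem_inversions.1 h.2.1).1

theorem IsCoverPair.pairing {δ γ : ι} (h : IsCoverPair b δ γ) : P.pairingIn ℤ γ δ = 1 :=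
  pairing_eq_one_of_mem_minRoots h.1 h.2.1 h.2.2.1

theorem IsCoverPair.length_add_two {δ γ : ι} (h : IsCoverPair b δ γ) :
    length b (refl P δ * refl P γ) + 2 = 2 * coheight b δ := by
  have h₁ := (mem_minRoots.1 h.1).2
  have h₂ := h.2.2.2
  lia

/-- The complement `γ' = δ - γ = -s_δ γ` in a cover pair. -/
def complement (P : RootPairing ι ℝ M N) (δ γ : ι) : ι := negIdx P (refl P δ • γ)

theorem complement_complement (δ γ : ι) : complement P δ (complement P δ γ) = γ := by
  rw [complement, complement, smul_negIdx, refl_smul_refl_smul, negIdx_negIdx]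

/-- Length is invariant under inversion, so passing to the complement preserves the cover condition.
-/
theorem refl_mul_refl_complement (δ γ : ι) :
    refl P δ * refl P (complement P δ γ) = (refl P δ * refl P γ)⁻¹ := by
  rw [complement, refl_negIdx, refl_smul_eq, refl_inv, mul_inv_rev, refl_inv, refl_inv,
    ← mul_assoc, ← mul_assoc, refl_mul_self, one_mul]

theorem IsCoverPair.complement {δ γ : ι} (h : IsCoverPair b δ γ) :
    IsCoverPair b δ (complement P δ γ) := by
  refine ⟨h.1, ?_, ?_, ?_⟩
  · rw [mem_inversions, QFlag.complement, isPos_negIdx, smul_negIdx, isPos_negIdx,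
      refl_smul_refl_smul, not_not]
    exact (mem_inversions.1 h.2.1).symm
  · intro h'
    have := congrArg (QFlag.complement P δ) h'
    rw [complement_complement, QFlag.complement, refl_smul_self, negIdx_negIdx] at this
    exact h.2.2.1 this
  · rw [refl_mul_refl_complement, length_inv]
    exact h.2.2.2

theorem coroot_refl_smul_of_pairing {δ γ : ι} (h : P.pairingIn ℤ γ δ = 1) :
    P.coroot (refl P γ • δ) = P.coroot δ - P.coroot γ := by
  rw [coroot_refl_smul, h, one_smul]

theorem root_complement {δ γ : ι} (h : P.pairingIn ℤ γ δ = 1) :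
    P.root (complement P δ γ) = P.root δ - P.root γ := by
  rw [complement, root_negIdx, root_refl_smul, h, one_smul, neg_sub]

theorem coroot_complement (δ γ : ι) :
    P.coroot (complement P δ γ) = P.pairingIn ℤ δ γ • P.coroot δ - P.coroot γ := by
  rw [complement, coroot_negIdx, coroot_refl_smul, neg_sub]

/-- The case of an angle of thirty degrees does not occur for cover pairs. -/
theorem IsCoverPair.not_isPos_aux {δ γ ε : ι} (h : IsCoverPair b δ γ)
    (h₃ : P.pairingIn ℤ δ γ = 3) (hn : ¬ b.IsPos (refl P γ • δ)) (hε : b.IsPos ε)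
    (he : ε = refl P (negIdx P (refl P γ • δ)) • γ) : False := by
  have hγδ := h.pairing
  set δ₁ := negIdx P (refl P γ • δ) with hδ₁
  have hpos : b.IsPos δ₁ := isPos_negIdx.2 hn
  have hc : P.coroot δ₁ = P.coroot γ - P.coroot δ := by
    rw [hδ₁, coroot_negIdx, coroot_refl_smul_of_pairing hγδ, neg_sub]
  have hp : P.pairingIn ℤ δ₁ γ = 3 := by
    rw [hδ₁, pairing_negIdx_left, pairing_refl_smul_left, h₃, neg_neg]
  have hcε : P.coroot ε = P.coroot γ - (3 : ℤ) • P.coroot δ₁ := by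
    rw [he, coroot_refl_smul, hp]
  -- The same product is rewritten with `δ₁^∨ = γ^∨ - δ^∨` and `ε^∨ = γ^∨ - 3 δ₁^∨`. Since `δ^∨ =
  -- ε^∨ + 2 δ₁^∨`, its length `2 ht(δ^∨) - 2` exceeds the bound `2 ht(δ₁^∨) + 2 ht(ε^∨) - 2` by `2
  -- ht(δ₁^∨)`.
  have hw : refl P δ * refl P γ = refl P δ₁ * refl P ε := by
    rw [refl_mul_refl' δ γ, he, ← refl_mul_refl' γ δ₁, hδ₁, refl_negIdx]
  have hht := coheight_eq_of_coroot_eq (k := δ) (i := ε) (j := δ₁) (m := 1) (n := 2) hε hpos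
    h.isPos_left (by
      have : P.coroot δ = P.coroot γ - P.coroot δ₁ := by rw [hc]; abel
      rw [this, hcε]
      module)
  have h₁ := h.length_add_two
  have h₂ := length_mul_le (b := b) (refl P δ₁) (refl P ε)
  have h₄ := length_refl_lt hε
  have h₅ := length_refl_lt hpos
  have h₆ := coheight_pos hpos
  rw [hw] at h₁
  lia

/-- One of the two candidate decompositions attached to a cover pair is positive. -/
theorem IsCoverPair.isPos_or {δ γ : ι} (h : IsCoverPair b δ γ) :
    b.IsPos (refl P γ • δ) ∨ b.IsPos (refl P (QFlag.complement P δ γ) • δ) := by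
  have hγδ := h.pairing
  have h' := h.complement
  have hγδ' := h'.pairing
  have hδ := h.isPos_left
  have hγ := h.isPos_right
  have hγ' := h'.isPos_right
  have hp : P.pairingIn ℤ δ (QFlag.complement P δ γ) = P.pairingIn ℤ δ γ := by
    rw [QFlag.complement, pairing_negIdx_right, pairing_refl_smul_right, neg_neg]
  by_contra! hcon
  have hne := h.2.2.1
  have hset := P.pairingIn_pairingIn_mem_set_of_isCrystal_of_isRed γ δ
  have hht : b.height (QFlag.complement P δ γ) = b.height δ - b.height γ := 
    b.height_sub (root_complement hγδ)
  have h₁ := hcon.1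
  have h₂ := hcon.2
  simp only [RootPairing.Base.isPos_iff, height_refl_smul, hp, hht] at h₁ h₂ hδ hγ hγ'
  -- Adding the two height inequalities gives `(2 - p) ht(δ) ≤ 0` with `p = ⟨δ, γ^∨⟩`. The value `p
  -- = 2` would make `s_γ δ` of height zero.
  have hp3 : P.pairingIn ℤ δ γ = 3 := by
    simp only [Set.mem_insert_iff, Set.mem_singleton_iff, Prod.mk.injEq] at hset
    have hnz := b.height_ne_zero (refl P γ • δ)
    rw [height_refl_smul] at hnz
    rcases hset with h | h | h | h | h | h | h | h | h | h | h | h | h <;>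
      rw [h.1] at hγδ <;> rw [h.2] at h₁ h₂ hnz <;> lia
  have hroot : ∀ {ν : ι}, P.pairingIn ℤ ν δ = 1 → P.pairingIn ℤ δ ν = 3 →
      b.height (refl P (negIdx P (refl P ν • δ)) • ν) = b.height δ - 2 * b.height ν := by
    intro ν h₁ h₃
    rw [refl_negIdx, height_refl_smul, height_refl_smul]
    have : P.pairingIn ℤ ν (refl P ν • δ) = -1 := by rw [pairing_refl_smul_right, h₁]
    rw [this, h₃]
    ring
  -- The auxiliary roots built from `γ` and from its complement have heights `ht(δ) - 2 ht(γ)` and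
  -- the opposite number, so one of them is positive and `not_isPos_aux` applies to it.
  rcases RootPairing.Base.IsPos.or_neg b (refl P (negIdx P (refl P γ • δ)) • γ) with hε | hε
  · exact h.not_isPos_aux hp3 hcon.1 hε rfl
  · refine h'.not_isPos_aux (by rw [hp, hp3]) hcon.2 ?_ rfl
    have hε' := isPos_negIdx.1 hε
    have hnz := b.height_ne_zero (refl P (negIdx P (refl P γ • δ)) • γ)
    rw [RootPairing.Base.isPos_iff] at hε' ⊢
    rw [hroot hγδ' (by rw [hp, hp3]), hht]
    rw [hroot hγδ hp3] at hε' hnz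
    lia

end TwoReflections

/-! ### The operators `Λ` commute -/

section Commute

variable {ι M N : Type*} [AddCommGroup M] [Module ℝ M] [AddCommGroup N] [Module ℝ N]
variable {P : RootPairing ι ℝ M N} {b : P.Base}
variable [Fintype ι] [P.IsRootSystem] [P.IsCrystallographic] [P.IsReduced]

theorem IsReducedPair.swap {α β : ι} (h : IsReducedPair b α β) : IsReducedPair b β α :=
  ⟨h.2.1, h.1, h.inv⟩

theorem coroot_refl_smul_of_pairing_neg {α β : ι} (h : P.pairingIn ℤ α β = -1) :
    P.coroot (refl P α • β) = P.coroot α + P.coroot β := by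
  rw [coroot_refl_smul, h, neg_smul, one_smul, sub_neg_eq_add, add_comm]

/-- Put `δ = s_α β`, so that `δ^∨ = α^∨ + β^∨` and `s_α s_β = s_δ s_α`. This product has length `2
ht(δ^∨) - 2` and is shorter than `s_δ`, whose length is at most `2 ht(δ^∨) - 1`; so both conditions
hold with equality. -/
theorem IsReducedPair.isCoverPair {α β : ι} (h : IsReducedPair b α β)
    (h₁ : P.pairingIn ℤ α β = -1) (h₂ : P.pairingIn ℤ β α < 0) :
    IsCoverPair b (refl P α • β) α := by
  have hα := h.isPos_left
  have hβ := h.isPos_right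
  have hδ := h.isPos_smul
  have hht := coheight_add hα hβ hδ (coroot_refl_smul_of_pairing_neg h₁)
  have hl := h.length_add_two
  rw [refl_mul_refl] at hl
  have hinv : α ∈ inversions b (refl P (refl P α • β)) := by
    refine mem_inversions.2 ⟨hα, ?_⟩
    -- The height of `s_δ α` is `(1 + ⟨β, α^∨⟩) ht(α) - ht(β)`, which is negative.
    rw [RootPairing.Base.isPos_iff] at *
    rw [height_refl_smul, pairing_refl_smul_right, h₁, height_refl_smul]
    have := mul_le_mul_of_nonneg_right (show P.pairingIn ℤ β α ≤ -1 by lia) hα.le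
    lia
  have h₃ := length_mul_refl_lt hinv
  have h₄ := length_refl_lt hδ
  have h₅ := coheight_pos hα
  have h₆ := coheight_pos hβ
  refine ⟨mem_minRoots.2 ⟨hδ, by lia⟩, hinv, ?_, by lia⟩
  intro h'
  rw [← h', refl_mul_self, length_one] at hl
  lia

/-- Here `s_δ s_γ = s_γ s_{s_γ δ}` and `δ^∨` is the sum of the coroots of `γ` and `s_γ δ`, so the
length of the product is the largest possible and both factors attain their bounds. -/
theorem IsCoverPair.isReducedPair {δ γ : ι} (h : IsCoverPair b δ γ)
    (hp : b.IsPos (refl P γ • δ)) : IsReducedPair b γ (refl P γ • δ) := by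
  refine isReducedPair_of_length_le h.isPos_right hp ?_
  have hht := coheight_add h.isPos_right hp h.isPos_left
    (by rw [coroot_refl_smul_of_pairing h.pairing, add_sub_cancel])
  rw [← refl_mul_refl', h.length_add_two, hht]

theorem pairing_complement (δ γ : ι) :
    P.pairingIn ℤ δ (complement P δ γ) = P.pairingIn ℤ δ γ := by
  rw [complement, pairing_negIdx_right, pairing_refl_smul_right, neg_neg]

open Classical in
/-- The bijection from non-orthogonal reduced pairs to cover pairs. -/
def toCoverPair (P : RootPairing ι ℝ M N) [P.IsCrystallographic] (p : ι × ι) : ι × ι :=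
  if P.pairingIn ℤ p.1 p.2 = -1 then (refl P p.1 • p.2, p.1)
  -- Here the pair is read in the reverse order; the complement inverts `s_β s_α` and so restores
  -- `s_α s_β`.
  else (refl P p.2 • p.1, complement P (refl P p.2 • p.1) p.2)

open Classical in
/-- The bijection from cover pairs to non-orthogonal reduced pairs. -/
def toReducedPair (b : P.Base) (p : ι × ι) : ι × ι :=
  if b.IsPos (refl P p.2 • p.1) then (p.2, refl P p.2 • p.1)
  else (refl P (complement P p.1 p.2) • p.1, complement P p.1 p.2)

theorem IsReducedPair.toCoverPair {p : ι × ι} (h : IsReducedPair b p.1 p.2)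
    (hp : P.pairingIn ℤ p.1 p.2 ≠ 0) :
    IsCoverPair b (toCoverPair P p).1 (toCoverPair P p).2 := by
  rw [QFlag.toCoverPair]
  rcases h.pairing_cases with h' | h' | h'
  · exact absurd h'.1 hp
  · rw [if_pos h'.1]
    exact h.isCoverPair h'.1 h'.2
  · rw [if_neg (by lia)]
    exact (h.swap.isCoverPair h'.2 (by lia)).complement

theorem IsCoverPair.toReducedPair {p : ι × ι} (h : IsCoverPair b p.1 p.2) :
    IsReducedPair b (toReducedPair b p).1 (toReducedPair b p).2 ∧
      P.pairingIn ℤ (toReducedPair b p).1 (toReducedPair b p).2 ≠ 0 := by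
  rw [QFlag.toReducedPair]
  split_ifs with hp
  · refine ⟨h.isReducedPair hp, ?_⟩
    rw [pairing_refl_smul_right, h.pairing]
    decide
  · refine ⟨(h.complement.isReducedPair (h.isPos_or.resolve_left hp)).swap, ?_⟩
    rw [pairing_refl_smul_left, pairing_complement, neg_ne_zero]
    intro h0
    have := h.pairing
    rw [(P.pairingIn_eq_zero_iff (S := ℤ)).1 h0] at this
    exact zero_ne_one this

theorem IsReducedPair.toReducedPair_toCoverPair {p : ι × ι} (h : IsReducedPair b p.1 p.2)
    (hp : P.pairingIn ℤ p.1 p.2 ≠ 0) : toReducedPair b (QFlag.toCoverPair P p) = p := by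
  rw [QFlag.toCoverPair]
  rcases h.pairing_cases with h' | h' | h'
  · exact absurd h'.1 hp
  · rw [if_pos h'.1, toReducedPair, refl_smul_refl_smul, if_pos h.isPos_right]
  · rw [if_neg (by lia), toReducedPair, complement_complement, refl_smul_refl_smul, if_neg]
    -- The first branch of `toReducedPair` has to fail: with `a = ⟨α, β^∨⟩`, which is `-2` or `-3`,
    -- the root tested there has height `(1 + a) ht(α) - a (a + 2) ht(β) < 0`.
    have hδ : P.pairingIn ℤ p.2 (refl P p.2 • p.1) = 1 := by
      rw [pairing_refl_smul_right, h'.2, neg_neg]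
    have hht := b.height_sub (root_complement hδ)
    have hα := h.isPos_left
    have hβ := h.isPos_right
    have hset := P.pairingIn_pairingIn_mem_set_of_isCrystal_of_isRed p.1 p.2
    simp only [Set.mem_insert_iff, Set.mem_singleton_iff, Prod.mk.injEq] at hset
    rw [RootPairing.Base.isPos_iff] at *
    rw [height_refl_smul, pairing_complement, pairing_refl_smul_left, hht, height_refl_smul]
    rcases hset with h | h | h | h | h | h | h | h | h | h | h | h | h <;> rw [h.1] at h' ⊢ <;> lia

theorem IsCoverPair.toCoverPair_toReducedPair {p : ι × ι} (h : IsCoverPair b p.1 p.2) :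
    toCoverPair P (QFlag.toReducedPair b p) = p := by
  rw [QFlag.toReducedPair]
  split_ifs with hp
  · rw [toCoverPair, if_pos (by rw [pairing_refl_smul_right, h.pairing]), refl_smul_refl_smul]
  · rw [toCoverPair, if_neg, refl_smul_refl_smul, complement_complement]
    rw [pairing_refl_smul_left, pairing_complement, neg_inj]
    intro h1
    -- If `⟨δ, γ^∨⟩ = 1`, then `s_γ δ` is `δ - γ`, the complement of `γ`, which is positive.
    refine hp ?_
    have := h.complement.isPos_right
    rw [RootPairing.Base.isPos_iff] at *
    rw [b.height_sub (root_complement h.pairing)] at this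
    rwa [height_refl_smul, h1, one_mul]

/-- The coefficient of `α^∨ ∧ β^∨` evaluated on two weights. -/
def wedge (P : RootPairing ι ℝ M N) (x y : M) (α β : ι) : ℝ :=
  P.coroot' α x * P.coroot' β y - P.coroot' α y * P.coroot' β x

theorem wedge_eq (x y : M) (α β : ι) : wedge P x y α β =
    P.toLinearMap x (P.coroot α) * P.toLinearMap y (P.coroot β) -
      P.toLinearMap y (P.coroot α) * P.toLinearMap x (P.coroot β) := rfl

theorem wedge_self (x y : M) (α : ι) : wedge P x y α α = 0 := by
  rw [wedge]
  ring

variable (b) in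
/-- The term of a cover pair in the commutator of two operators `Λ`. -/
def coverTerm (x y : M) (f : QPoly b) (p : ι × ι) : QPoly b :=
  wedge P x y p.1 p.2 • qMonomial b p.1 • divDiffW (QRing b) b (refl P p.1 * refl P p.2) f

variable (b) in
/-- The term of a reduced pair in the commutator of two operators `Λ`. -/
def reducedTerm (x y : M) (f : QPoly b) (p : ι × ι) : QPoly b :=
  wedge P x y p.1 p.2 • (qMonomial b p.1 * qMonomial b p.2) •
    divDiffW (QRing b) b (refl P p.1 * refl P p.2) f

/-- The Weyl group elements and the monomials agree because `δ^∨ = α^∨ + β^∨`. The sign is that of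
`(α^∨ + β^∨) ∧ α^∨ = -α^∨ ∧ β^∨`, or of the analogous identity for the complement of `β`. -/
theorem IsReducedPair.reducedTerm_eq {p : ι × ι} (h : IsReducedPair b p.1 p.2)
    (hp : P.pairingIn ℤ p.1 p.2 ≠ 0) (x y : M) (f : QPoly b) :
    reducedTerm b x y f p = -coverTerm b x y f (QFlag.toCoverPair P p) := by
  rw [QFlag.toCoverPair, reducedTerm, coverTerm]
  rcases h.pairing_cases with h' | h' | h'
  · exact absurd h'.1 hp
  · have hc := coroot_refl_smul_of_pairing_neg h'.1
    have hw : wedge P x y (refl P p.1 • p.2) p.1 = -wedge P x y p.1 p.2 := by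
      rw [wedge_eq, wedge_eq, hc, map_add, map_add]
      ring
    rw [if_pos h'.1]
    dsimp only
    rw [← refl_mul_refl, hw, neg_smul, neg_neg,
      qMonomial_add h.isPos_left h.isPos_right h.isPos_smul hc]
  · have hc := coroot_refl_smul_of_pairing_neg h'.2
    have hw : wedge P x y (refl P p.2 • p.1) (complement P (refl P p.2 • p.1) p.2) =
        -wedge P x y p.1 p.2 := by
      rw [wedge_eq, wedge_eq, coroot_complement, map_sub, map_sub, map_zsmul, map_zsmul, hc,
        map_add, map_add]
      simp only [zsmul_eq_mul]
      ring
    rw [if_neg (by lia)]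
    dsimp only
    rw [refl_mul_refl_complement, mul_inv_rev, refl_inv, refl_inv, ← refl_mul_refl', hw, neg_smul,
      neg_neg, qMonomial_add h.isPos_right h.isPos_left h.isPos_smul' hc, mul_comm (qMonomial b p.2)]

-- Orthogonal reflections commute, so swapping the pair changes only the sign of the wedge.
open Classical in
theorem sum_reducedTerm_orthogonal (x y : M) (f : QPoly b) :
    ∑ p : ι × ι with IsReducedPair b p.1 p.2 ∧ P.pairingIn ℤ p.1 p.2 = 0,
      reducedTerm b x y f p = 0 := by
  refine Finset.sum_involution (fun p _ => p.swap) ?_ ?_ ?_ ?_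
  · intro p hp
    have h0 := (Finset.mem_filter.1 hp).2.2
    have hs : refl P p.1 • p.2 = p.2 := P.root.injective (by
      rw [root_refl_smul, (P.pairingIn_eq_zero_iff (S := ℤ)).1 h0, zero_smul, sub_zero])
    rw [reducedTerm, reducedTerm, Prod.fst_swap, Prod.snd_swap, refl_mul_refl p.1, hs,
      mul_comm (qMonomial b p.2), ← add_smul]
    have : wedge P x y p.1 p.2 + wedge P x y p.2 p.1 = 0 := by
      rw [wedge, wedge]
      ring
    rw [this, zero_smul]
  · intro p hp _ h
    have h1 := (Finset.mem_filter.1 hp).2.1.ne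
    exact h1 (congrArg Prod.snd h)
  · intro p hp
    have := (Finset.mem_filter.1 hp).2
    refine Finset.mem_filter.2 ⟨Finset.mem_univ _, this.1.swap, ?_⟩
    exact (P.pairingIn_eq_zero_iff (S := ℤ)).1 this.2
  · exact fun p _ => Prod.swap_swap p

open Classical in
theorem sum_coverTerm_add_sum_reducedTerm (x y : M) (f : QPoly b) :
    ∑ p : ι × ι with IsCoverPair b p.1 p.2, coverTerm b x y f p +
      ∑ p : ι × ι with IsReducedPair b p.1 p.2, reducedTerm b x y f p = 0 := by
  rw [← Finset.sum_filter_add_sum_filter_not ({p : ι × ι | IsReducedPair b p.1 p.2} : Finset _)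
    (fun p => P.pairingIn ℤ p.1 p.2 = 0), Finset.filter_filter, Finset.filter_filter,
    sum_reducedTerm_orthogonal, zero_add]
  rw [add_comm, ← eq_neg_iff_add_eq_zero, ← Finset.sum_neg_distrib]
  refine Finset.sum_nbij' (QFlag.toCoverPair P) (QFlag.toReducedPair b) ?_ ?_ ?_ ?_ ?_
  · intro p hp
    simp only [Finset.mem_filter, Finset.mem_univ, true_and] at hp ⊢
    exact hp.1.toCoverPair hp.2
  · intro p hp
    simp only [Finset.mem_filter, Finset.mem_univ, true_and] at hp ⊢
    exact hp.toReducedPair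
  · intro p hp
    simp only [Finset.mem_filter, Finset.mem_univ, true_and] at hp
    exact hp.1.toReducedPair_toCoverPair hp.2
  · intro p hp
    simp only [Finset.mem_filter, Finset.mem_univ, true_and] at hp
    exact hp.toCoverPair_toReducedPair
  · intro p hp
    simp only [Finset.mem_filter, Finset.mem_univ, true_and] at hp
    exact hp.1.reducedTerm_eq hp.2 x y f

/-! ### The commutator of two operators `Λ`. -/

variable (b) in
open Classical in
/-- The quantum part of the operator `Λ` of a weight. -/
def quantumPart (x : M) (f : QPoly b) : QPoly b :=
  ∑ k with k ∈ minRoots b, P.coroot' k x • qMonomial b k • divDiffW (QRing b) b (refl P k) f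

theorem lambdaOp_apply (j : b.support) (f : QPoly b) :
    lambdaOp b j f = linPoly (QRing b) b (fundWeight b j) * f +
      quantumPart b (fundWeight b j) f := by
  rw [lambdaOp, LinearMap.add_apply, LinearMap.sum_apply, linPoly_fundWeight, quantumPart]
  congr 1
  refine Finset.sum_congr rfl fun k _ => ?_
  rw [LinearMap.smul_apply, mul_smul, ← algebraMap_eq, algebraMap_smul]
  rfl

theorem quantumPart_add (x : M) (f g : QPoly b) :
    quantumPart b x (f + g) = quantumPart b x f + quantumPart b x g := by
  simp only [quantumPart, map_add, smul_add, Finset.sum_add_distrib]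

theorem smul_leibniz_term {R S κ : Type*} [CommRing R] [CommRing S] [Algebra ℝ R] [Algebra ℝ S]
    [Algebra R S] [IsScalarTower ℝ R S] (c d : ℝ) (q : R) (l k f : S) (s : Finset κ) (e : κ → ℝ)
    (g : κ → S) : c • q • ((l - d • k) * f + ∑ β ∈ s, e β • g β) =
      l * c • q • f - (c * d) • q • (k * f) + ∑ β ∈ s, (c * e β) • q • g β := by
  rw [smul_add, smul_add, Finset.smul_sum, Finset.smul_sum]
  congr 1
  · simp only [Algebra.smul_def, map_mul]
    ring
  · refine Finset.sum_congr rfl fun β _ => ?_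
    rw [mul_smul, smul_comm q]

-- The middle sum comes from `s_α y = y - y(α^∨) α`. It is symmetric in `x` and `y`, so it drops out
-- of the commutator.
open Classical in
theorem quantumPart_linPoly_mul (x y : M) (f : QPoly b) :
    quantumPart b x (linPoly (QRing b) b y * f) = linPoly (QRing b) b y * quantumPart b x f -
      (∑ k with k ∈ minRoots b, (P.coroot' k x * P.coroot' k y) • qMonomial b k •
        (linPoly (QRing b) b (P.root k) * divDiffW (QRing b) b (refl P k) f)) +
      ∑ p : ι × ι with p.1 ∈ minRoots b ∧ p.2 ∈ inversions b (refl P p.1) ∧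
          length b (refl P p.1 * refl P p.2) + 1 = length b (refl P p.1),
        (P.coroot' p.1 x * P.coroot' p.2 y) • qMonomial b p.1 •
          divDiffW (QRing b) b (refl P p.1 * refl P p.2) f := by
  have h : ∑ p : ι × ι with p.1 ∈ minRoots b ∧ p.2 ∈ inversions b (refl P p.1) ∧
          length b (refl P p.1 * refl P p.2) + 1 = length b (refl P p.1),
        (P.coroot' p.1 x * P.coroot' p.2 y) • qMonomial b p.1 •
          divDiffW (QRing b) b (refl P p.1 * refl P p.2) f =
      ∑ k with k ∈ minRoots b, ∑ β ∈ inversions b (refl P k) with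
          length b (refl P k * refl P β) + 1 = length b (refl P k),
        (P.coroot' k x * P.coroot' β y) • qMonomial b k •
          divDiffW (QRing b) b (refl P k * refl P β) f := by
    refine Finset.sum_finset_product _ _ (fun k => (inversions b (refl P k)).filter fun β =>
      length b (refl P k * refl P β) + 1 = length b (refl P k)) (fun p => ?_)
    simp only [Finset.mem_filter, Finset.mem_univ, true_and]
  rw [h, quantumPart, quantumPart, Finset.mul_sum, ← Finset.sum_sub_distrib,
    ← Finset.sum_add_distrib]
  refine Finset.sum_congr rfl fun k _ => ?_
  rw [divDiffW_linPoly_mul, refl_smul_weight, map_sub, map_smul]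
  exact smul_leibniz_term _ _ _ _ _ _ _ _ _

open Classical in
theorem quantumPart_quantumPart (x y : M) (f : QPoly b) :
    quantumPart b x (quantumPart b y f) = ∑ p : ι × ι with IsReducedPair b p.1 p.2,
      (P.coroot' p.1 x * P.coroot' p.2 y) • (qMonomial b p.1 * qMonomial b p.2) •
        divDiffW (QRing b) b (refl P p.1 * refl P p.2) f := by
  have h : ∀ k m : ι, divDiffW (QRing b) b (refl P k) (divDiffW (QRing b) b (refl P m) f) =
      if length b (refl P k * refl P m) = length b (refl P k) + length b (refl P m) then
        divDiffW (QRing b) b (refl P k * refl P m) f else 0 := fun k m => by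
    split_ifs with h
    · rw [← divDiffW_mul h]
      rfl
    · exact LinearMap.congr_fun (divDiffW_mul_eq_zero h) f
  simp only [quantumPart, map_sum, Finset.smul_sum]
  rw [← Finset.sum_product', Finset.sum_filter]
  rw [← Finset.sum_filter_add_sum_filter_not Finset.univ 
    (fun p : ι × ι => p.1 ∈ minRoots b ∧ p.2 ∈ minRoots b)]
  rw [Finset.sum_eq_zero (s := Finset.filter (fun p : ι × ι => ¬ _) _), add_zero]
  · refine Finset.sum_congr (by ext; simp) fun p hp => ?_
    have hp' : p.1 ∈ minRoots b ∧ p.2 ∈ minRoots b := by simpa using hp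
    rw [LinearMap.map_smul_of_tower, LinearMap.map_smul, h]
    simp only [IsReducedPair, hp'.1, hp'.2, true_and]
    split_ifs with hl
    · rw [mul_smul, mul_smul, smul_comm (qMonomial b p.1)]
    · simp
  · intro p hp
    rw [Finset.mem_filter] at hp
    exact if_neg fun h => hp.2 ⟨h.1, h.2.1⟩

/-- The operators `Λ_j` commute. -/
theorem lambdaOp_commute (i j : b.support) : Commute (lambdaOp b i) (lambdaOp b j) := by
  classical
  refine LinearMap.ext fun f => ?_
  change lambdaOp b i (lambdaOp b j f) = lambdaOp b j (lambdaOp b i f)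
  simp only [lambdaOp_apply]
  generalize fundWeight b i = x
  generalize fundWeight b j = y
  have key := sum_coverTerm_add_sum_reducedTerm x y f
  have h₁ : ∀ p : ι × ι, coverTerm b x y f p =
      (P.coroot' p.1 x * P.coroot' p.2 y) • qMonomial b p.1 •
          divDiffW (QRing b) b (refl P p.1 * refl P p.2) f -
      (P.coroot' p.1 y * P.coroot' p.2 x) • qMonomial b p.1 •
          divDiffW (QRing b) b (refl P p.1 * refl P p.2) f := fun p => by
    rw [coverTerm, wedge, sub_smul]
  have h₂ : ∑ p : ι × ι with IsCoverPair b p.1 p.2, coverTerm b x y f p =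
      ∑ p : ι × ι with p.1 ∈ minRoots b ∧ p.2 ∈ inversions b (refl P p.1) ∧
          length b (refl P p.1 * refl P p.2) + 1 = length b (refl P p.1),
        coverTerm b x y f p := by
    -- The additional pairs are those with equal entries, where the wedge vanishes.
    refine Finset.sum_subset ?_ ?_
    · intro p hp
      simp only [Finset.mem_filter, Finset.mem_univ, true_and] at hp ⊢
      exact ⟨hp.1, hp.2.1, hp.2.2.2⟩
    · intro p hp hp'
      simp only [Finset.mem_filter, Finset.mem_univ, true_and] at hp hp'
      have : p.2 = p.1 := by
        by_contra hne
        exact hp' ⟨hp.1, hp.2.1, hne, hp.2.2⟩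
      rw [coverTerm, this, wedge_self, zero_smul]
  have h₃ : ∀ p : ι × ι, reducedTerm b x y f p =
      (P.coroot' p.1 x * P.coroot' p.2 y) • (qMonomial b p.1 * qMonomial b p.2) •
        divDiffW (QRing b) b (refl P p.1 * refl P p.2) f -
      (P.coroot' p.1 y * P.coroot' p.2 x) • (qMonomial b p.1 * qMonomial b p.2) •
        divDiffW (QRing b) b (refl P p.1 * refl P p.2) f := fun p => by
    rw [reducedTerm, wedge, sub_smul]
  rw [h₂, Finset.sum_congr rfl fun p _ => h₁ p, Finset.sum_sub_distrib,
    Finset.sum_congr rfl fun p _ => h₃ p, Finset.sum_sub_distrib] at key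
  rw [quantumPart_add, quantumPart_add, quantumPart_linPoly_mul, quantumPart_linPoly_mul,
    quantumPart_quantumPart, quantumPart_quantumPart]
  have hsymm : ∀ k : ι, P.coroot' k y * P.coroot' k x = P.coroot' k x * P.coroot' k y :=
    fun k => mul_comm _ _
  simp only [hsymm]
  rw [← sub_eq_zero, ← key]
  ring

end Commute

/-! ### Homogeneity -/

section Homogeneity

variable {ι M N : Type*} [AddCommGroup M] [Module ℝ M] [AddCommGroup N] [Module ℝ N]
variable {P : RootPairing ι ℝ M N} {b : P.Base}
variable [Fintype ι] [P.IsRootSystem] [P.IsCrystallographic] [P.IsReduced]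
variable {A : Type*} [CommRing A] [Algebra ℝ A]

/-- Homogeneous polynomials of degree `n + 1` are sums of products of a variable and a homogeneous
polynomial of degree `n`; scalars are absorbed in the second factor. -/
theorem homogeneous_succ_induction {σ R : Type*} [CommRing R]
    {p : MvPolynomial σ R → Prop} (h0 : p 0) (hadd : ∀ f g, p f → p g → p (f + g)) {n : ℕ}
    (hX : ∀ (i : σ) (g : MvPolynomial σ R), g.IsHomogeneous n → p (X i * g))
    {f : MvPolynomial σ R} (hf : f.IsHomogeneous (n + 1)) : p f := by
  rw [← mem_homogeneousSubmodule, ← homogeneousSubmodule_one_pow, pow_succ,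
    homogeneousSubmodule_one_pow] at hf
  refine Submodule.mul_induction_on hf (fun g hg x hx => ?_) hadd
  rw [homogeneousSubmodule_one_eq_span_X] at hx
  revert g
  induction hx using Submodule.span_induction with
  | mem x hx =>
    obtain ⟨i, rfl⟩ := hx
    intro g hg
    rw [mul_comm]
    exact hX i g hg
  | zero => exact fun g _ => by rwa [mul_zero]
  | add x y _ _ hx hy =>
    intro g hg
    rw [mul_add]
    exact hadd _ _ (hx g hg) (hy g hg)
  | smul c x _ hx =>
    intro g hg
    rw [mul_smul_comm, ← smul_mul_assoc]
    exact hx _ (Submodule.smul_mem _ c hg)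

theorem isHomogeneous_real_smul {f : MvPolynomial b.support A} {n : ℕ} (hf : f.IsHomogeneous n)
    (c : ℝ) : (c • f).IsHomogeneous n := by
  rw [← algebraMap_smul A c f]
  exact Submodule.smul_mem (homogeneousSubmodule _ _ n) _ hf

theorem isHomogeneous_linPoly (x : M) : (linPoly A b x).IsHomogeneous 1 := by
  rw [linPoly_eq_sum]
  exact IsHomogeneous.sum _ _ _ fun j _ => isHomogeneous_real_smul (isHomogeneous_X _ _) _

theorem isHomogeneous_weylAct (w : P.weylGroup) {f : MvPolynomial b.support A} {n : ℕ}
    (hf : f.IsHomogeneous n) : (weylAct A b w f).IsHomogeneous n := by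
  have := hf.aeval (fun i => linPoly A b (w • fundWeight b i)) fun i => isHomogeneous_linPoly _
  rwa [one_mul] at this

theorem eq_C_of_isHomogeneous_zero {f : MvPolynomial b.support A} (hf : f.IsHomogeneous 0) :
    f = C (constantCoeff f) := by
  have h := homogeneousComponent_zero f
  rwa [homogeneousComponent_of_mem hf, if_pos rfl] at h

theorem constantCoeff_eq_zero_of_isHomogeneous {f : MvPolynomial b.support A} {n : ℕ}
    (hf : f.IsHomogeneous n) (hn : n ≠ 0) : constantCoeff f = 0 := by
  rw [constantCoeff_eq]
  exact hf.coeff_eq_zero (by simpa using hn.symm)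

variable [IsDomain A]

theorem divDiff_C (k : ι) (a : A) : divDiff A b k (C a) = 0 := by
  rw [C_eq_smul_one, map_smul, divDiff_one, smul_zero]

theorem divDiff_X_mul (k : ι) (i : b.support) (f : MvPolynomial b.support A) :
    divDiff A b k (X i * f) = linPoly A b (refl P k • fundWeight b i) * divDiff A b k f +
      P.coroot' k (fundWeight b i) • f := by
  rw [← divDiff_linPoly_mul, linPoly_fundWeight]

theorem divDiff_eq_zero_of_isHomogeneous {k : ι} {f : MvPolynomial b.support A}
    (hf : f.IsHomogeneous 0) : divDiff A b k f = 0 := by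
  rw [eq_C_of_isHomogeneous_zero hf, divDiff_C]

theorem isHomogeneous_divDiff {k : ι} {f : MvPolynomial b.support A} {n : ℕ}
    (hf : f.IsHomogeneous (n + 1)) : (divDiff A b k f).IsHomogeneous n := by
  induction n generalizing f with
  | zero =>
    refine homogeneous_succ_induction (p := fun f => (divDiff A b k f).IsHomogeneous 0) ?_ ?_ ?_ hf
    · rw [map_zero]
      exact isHomogeneous_zero _ _ _
    · intro f g hf hg
      rw [map_add]
      exact hf.add hg
    · intro i g hg
      rw [divDiff_X_mul, divDiff_eq_zero_of_isHomogeneous hg, mul_zero, zero_add]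
      exact isHomogeneous_real_smul hg _
  | succ n ih =>
    refine homogeneous_succ_induction (p := fun f => (divDiff A b k f).IsHomogeneous (n + 1))
      ?_ ?_ ?_ hf
    · rw [map_zero]
      exact isHomogeneous_zero _ _ _
    · intro f g hf hg
      rw [map_add]
      exact hf.add hg
    · intro i g hg
      rw [divDiff_X_mul]
      refine IsHomogeneous.add ?_ (isHomogeneous_real_smul hg _)
      rw [add_comm]
      exact (isHomogeneous_linPoly _).mul (ih hg)

theorem isHomogeneous_divDiffW (w : P.weylGroup) {f : MvPolynomial b.support A} {n : ℕ}
    (hf : f.IsHomogeneous (n + length b w)) : (divDiffW A b w f).IsHomogeneous n := by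
  rw [divDiffW_eq_wordOp]
  rw [← length_reducedWord] at hf
  generalize reducedWord b w = L at hf
  induction L generalizing n with
  | nil => exact hf
  | cons i L ih =>
    rw [wordOp_cons]
    refine isHomogeneous_divDiff (ih ?_)
    rwa [add_assoc, add_comm 1]

theorem divDiffW_eq_zero_of_isHomogeneous {w : P.weylGroup} {f : MvPolynomial b.support A}
    {n : ℕ} (hf : f.IsHomogeneous n) (hn : n < length b w) : divDiffW A b w f = 0 := by
  rw [divDiffW_eq_wordOp]
  rw [← length_reducedWord] at hn
  generalize reducedWord b w = L at hn
  -- The induction also has to track the degree, in order to recognize the step at which a constant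
  -- is differentiated.
  suffices ∀ L : List b.support, (n < L.length → wordOp A b L f = 0) ∧
      ∀ m, n = m + L.length → (wordOp A b L f).IsHomogeneous m from (this L).1 hn
  intro L
  induction L with
  | nil => exact ⟨fun h => absurd h (Nat.not_lt_zero _), fun m hm => by rwa [hm] at hf⟩
  | cons i L ih =>
    simp only [wordOp_cons, List.length_cons]
    refine ⟨fun h => ?_, fun m hm => isHomogeneous_divDiff (ih.2 _ (by lia))⟩
    rcases Nat.lt_succ_iff_lt_or_eq.1 h with h | h
    · rw [ih.1 h, map_zero]
    · exact divDiff_eq_zero_of_isHomogeneous (ih.2 0 (by lia))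

theorem constantCoeff_divDiffW_of_ne {w : P.weylGroup} {f : MvPolynomial b.support A} {n : ℕ}
    (hf : f.IsHomogeneous n) (hn : n ≠ length b w) : constantCoeff (divDiffW A b w f) = 0 := by
  rcases lt_or_gt_of_ne hn with h | h
  · rw [divDiffW_eq_zero_of_isHomogeneous hf h, map_zero]
  · obtain ⟨m, rfl⟩ := Nat.exists_eq_add_of_lt h
    refine constantCoeff_eq_zero_of_isHomogeneous (n := m + 1) ?_ (Nat.succ_ne_zero m)
    refine isHomogeneous_divDiffW w ?_
    convert hf using 1
    ring

end Homogeneity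

/-! ### Antisymmetrization -/

section Antisymmetrization

variable {ι M N : Type*} [AddCommGroup M] [Module ℝ M] [AddCommGroup N] [Module ℝ N]
variable {P : RootPairing ι ℝ M N} {b : P.Base}
variable [Fintype ι] [P.IsRootSystem] [P.IsCrystallographic] [P.IsReduced]

instance fintype_weylGroup : Fintype P.weylGroup := Fintype.ofFinite _

variable (b) in
/-- The antisymmetrization `∑ w, sgn(w) w f`. -/
def antisymm (f : MvPolynomial b.support ℝ) : MvPolynomial b.support ℝ :=
  ∑ w : P.weylGroup, sgn b w • weylAct ℝ b w f

theorem weylAct_antisymm (u : P.weylGroup) (f : MvPolynomial b.support ℝ) :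
    weylAct ℝ b u (antisymm b f) = sgn b u • antisymm b f := by
  rw [antisymm, map_sum, Finset.smul_sum]
  refine Fintype.sum_equiv (Equiv.mulLeft u) _ _ fun w => ?_
  rw [Equiv.coe_mulLeft, map_zsmul, ← weylAct_mul, sgn_mul, smul_smul, ← mul_assoc, sgn_sq, one_mul]

theorem root_dvd_antisymm (k : ι) (f : MvPolynomial b.support ℝ) :
    linPoly ℝ b (P.root k) ∣ antisymm b f := by
  have h := dvd_sub_weylAct ℝ b k (antisymm b f)
  rw [weylAct_antisymm, sgn_refl, neg_smul, one_smul, sub_neg_eq_add] at h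
  -- On an antisymmetric polynomial `f - s_α f` is `2 f`, and 2 is invertible.
  have h' : antisymm b f = C (2⁻¹ : ℝ) * (antisymm b f + antisymm b f) := by
    rw [← two_mul, ← mul_assoc, ← map_ofNat C 2, ← C_mul, inv_mul_cancel₀ two_ne_zero, C_1, one_mul]
  rw [h']
  exact h.mul_left _

theorem antisymm_mul_of_invariant {F : MvPolynomial b.support ℝ}
    (hF : ∀ w : P.weylGroup, weylAct ℝ b w F = F) (f : MvPolynomial b.support ℝ) :
    antisymm b (f * F) = antisymm b f * F := by
  simp only [antisymm, map_mul, hF, Finset.sum_mul, smul_mul_assoc]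

variable (b) in
/-- The product of the positive roots. -/
def posProd : MvPolynomial b.support ℝ := by
  classical exact ∏ k with b.IsPos k, linPoly ℝ b (P.root k)

theorem topPoly_eq : topPoly b = (Nat.card P.weylGroup : ℝ)⁻¹ • posProd b := rfl

theorem posProd_ne_zero : posProd b ≠ 0 :=
  Finset.prod_ne_zero_iff.2 fun k _ => linPoly_root_ne_zero ℝ b k

theorem weylAct_simpleRefl_posProd (i : b.support) :
    weylAct ℝ b (simpleRefl b i) (posProd b) = -posProd b := by
  classical
  have hi := b.isPos_of_mem_support i.2
  have h₁ : posProd b = linPoly ℝ b (P.root i) *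
      ∏ k ∈ ({k | b.IsPos k} : Finset ι).erase i, linPoly ℝ b (P.root k) := by
    rw [Finset.mul_prod_erase _ (fun k => linPoly ℝ b (P.root k)) (by simpa using hi), posProd]
  have h₂ : weylAct ℝ b (simpleRefl b i)
      (∏ k ∈ ({k | b.IsPos k} : Finset ι).erase i, linPoly ℝ b (P.root k)) =
      ∏ k ∈ ({k | b.IsPos k} : Finset ι).erase i, linPoly ℝ b (P.root k) := by
    rw [map_prod]
    have hmem : ∀ k ∈ ({k | b.IsPos k} : Finset ι).erase i,
        refl P (i : ι) • k ∈ ({k | b.IsPos k} : Finset ι).erase i := by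
      intro k hk
      rw [Finset.mem_erase, Finset.mem_filter] at hk ⊢
      refine ⟨fun h => ?_, Finset.mem_univ _, ?_⟩
      · have h' : k = negIdx P i := smul_left_cancel (refl P (i : ι)) (by
          rw [h, smul_negIdx, refl_smul_self, negIdx_negIdx])
        exact isPos_negIdx.1 (h' ▸ hk.2.2) hi
      · rw [isPos_refl_smul i.2 hk.1]
        · exact hk.2.2
        · rintro rfl
          exact isPos_negIdx.1 hk.2.2 hi
    refine Finset.prod_nbij' (refl P (i : ι) • ·) (refl P (i : ι) • ·) hmem hmem
      (fun k _ => refl_smul_refl_smul _ _) (fun k _ => refl_smul_refl_smul _ _) fun k _ => ?_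
    rw [weylAct_linPoly, root_smul]
    rfl
  rw [h₁, map_mul, h₂, weylAct_linPoly, simpleRefl, ← root_smul, refl_smul_self, root_negIdx,
    map_neg, neg_mul]

theorem weylAct_posProd (w : P.weylGroup) :
    weylAct ℝ b w (posProd b) = sgn b w • posProd b := by
  rw [sgn, ← length_reducedWord]
  conv_lhs => rw [← wordProd_reducedWord (b := b) w]
  generalize reducedWord b w = L
  induction L with
  | nil => simp [weylAct_one]
  | cons i L ih =>
    rw [wordProd_cons, weylAct_mul, ih, map_zsmul, weylAct_simpleRefl_posProd, List.length_cons,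
      pow_succ, mul_neg_one, neg_smul, smul_neg]

theorem antisymm_posProd :
    antisymm b (posProd b) = (Nat.card P.weylGroup : ℝ) • posProd b := by
  simp only [antisymm, weylAct_posProd, smul_smul, sgn_sq, one_smul]
  rw [Finset.sum_const, Finset.card_univ, Nat.card_eq_fintype_card, Nat.cast_smul_eq_nsmul]

theorem coeff_linPoly (x : M) (j : b.support) :
    coeff (Finsupp.single j 1) (linPoly ℝ b x) = P.coroot' j x := by
  classical
  rw [linPoly_eq_sum, coeff_sum, Finset.sum_eq_single j]
  · simp
  · intro i _ hi
    rw [coeff_smul, coeff_X, if_neg, smul_zero]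
    exact fun h => hi (Finsupp.single_left_injective one_ne_zero h)
  · simp

theorem linPoly_injective : Function.Injective (linPoly ℝ b) := by
  intro x y h
  rw [weight_eq_sum (b := b) x, weight_eq_sum (b := b) y]
  exact Finset.sum_congr rfl fun j _ => by rw [← coeff_linPoly, h, coeff_linPoly]

theorem irreducible_linPoly_root (k : ι) : Irreducible (linPoly ℝ b (P.root k)) := by
  have hne := linPoly_root_ne_zero ℝ b k
  refine irreducible_of_totalDegree_eq_one ((isHomogeneous_linPoly _).totalDegree hne) ?_
  intro x hx
  rw [isUnit_iff_ne_zero]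
  rintro rfl
  exact hne (MvPolynomial.ext _ _ fun i => by simpa using hx i)

/-- Divisibility between linear forms is proportionality, and proportional roots of a reduced system
are equal or opposite. -/
theorem not_linPoly_root_dvd {i j : ι} (hi : b.IsPos i) (hj : b.IsPos j) (hij : i ≠ j) :
    ¬ linPoly ℝ b (P.root i) ∣ linPoly ℝ b (P.root j) := by
  rintro ⟨h, hh⟩
  have hni := linPoly_root_ne_zero ℝ b i
  have hnj := linPoly_root_ne_zero ℝ b j
  have hnh : h ≠ 0 := by
    rintro rfl
    exact hnj (by rw [hh, mul_zero])
  have hd := congrArg totalDegree hh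
  rw [totalDegree_mul_of_isDomain hni hnh, (isHomogeneous_linPoly _).totalDegree hni,
    (isHomogeneous_linPoly _).totalDegree hnj] at hd
  obtain ⟨r, rfl⟩ : ∃ r, h = C r := ⟨_, totalDegree_eq_zero_iff_eq_C.1 (by lia)⟩
  rw [mul_comm, ← smul_eq_C_mul, ← map_smul] at hh
  have hr := linPoly_injective hh
  rcases RootPairing.IsReduced.eq_or_eq_neg (P := P) i j (fun hli => by
    rw [LinearIndependent.pair_iff] at hli
    have := hli r (-1) (by rw [hr]; simp)
    simp at this) with h | h
  · exact hij (P.root.injective h)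
  · rw [← root_negIdx] at h
    rw [P.root.injective h, isPos_negIdx] at hi
    exact hi hj

/-- Each positive root divides the antisymmetrization, and distinct positive roots are coprime
irreducible polynomials. -/
theorem posProd_dvd_antisymm (f : MvPolynomial b.support ℝ) : posProd b ∣ antisymm b f := by
  classical
  refine Finset.prod_dvd_of_isRelPrime (fun i hi j hj hij => ?_) fun k _ => root_dvd_antisymm k f
  have hi' : b.IsPos i := by simpa using hi
  have hj' : b.IsPos j := by simpa using hj
  exact (irreducible_linPoly_root i).isRelPrime_iff_not_dvd.2 (not_linPoly_root_dvd hi' hj' hij)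

theorem card_weylGroup_ne_zero : (Nat.card P.weylGroup : ℝ) ≠ 0 :=
  Nat.cast_ne_zero.2 Nat.card_pos.ne'

/-- Antisymmetrization is linear over invariants, so it sends `I_W` to multiples of `posProd` whose
cofactor has no constant term; but it sends `topPoly` to `posProd` itself. -/
theorem topPoly_notMem_invIdeal : topPoly b ∉ invIdeal b := by
  intro hmem
  -- The arbitrary factor `g` lets the claim pass from generators to the whole ideal.
  have key : ∀ f ∈ invIdeal b, ∀ g, ∃ h, antisymm b (g * f) = posProd b * h ∧
      constantCoeff h = 0 := by
    intro f hf
    induction hf using Submodule.span_induction with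
    | mem F hF =>
      intro g
      obtain ⟨⟨d, hd, hFd⟩, hF⟩ := hF
      obtain ⟨h, hh⟩ := posProd_dvd_antisymm g
      refine ⟨h * F, by rw [antisymm_mul_of_invariant hF, hh, mul_assoc], ?_⟩
      rw [map_mul, constantCoeff_eq_zero_of_isHomogeneous hFd hd.ne', mul_zero]
    | zero => exact fun g => ⟨0, by simp [antisymm], map_zero _⟩
    | add x y _ _ hx hy =>
      intro g
      obtain ⟨h₁, hh₁, hz₁⟩ := hx g
      obtain ⟨h₂, hh₂, hz₂⟩ := hy g
      refine ⟨h₁ + h₂, ?_, by rw [map_add, hz₁, hz₂, add_zero]⟩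
      rw [mul_add (posProd b), ← hh₁, ← hh₂, mul_add]
      simp only [antisymm, map_add, smul_add, Finset.sum_add_distrib]
    | smul a x _ hx =>
      intro g
      obtain ⟨h, hh⟩ := hx (g * a)
      exact ⟨h, by rw [smul_eq_mul, ← mul_assoc]; exact hh.1, hh.2⟩
  obtain ⟨h, hh, hz⟩ := key _ hmem 1
  have h₁ : antisymm b (1 * topPoly b) = posProd b := by
    have : antisymm b (topPoly b) = (Nat.card P.weylGroup : ℝ)⁻¹ • antisymm b (posProd b) := by
      rw [topPoly_eq, antisymm, antisymm, Finset.smul_sum]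
      refine Finset.sum_congr rfl fun w _ => ?_
      rw [map_smul, smul_comm]
    rw [one_mul, this, antisymm_posProd, smul_smul, inv_mul_cancel₀ card_weylGroup_ne_zero,
      one_smul]
  rw [h₁] at hh
  have h₂ : h = 1 := mul_left_cancel₀ (posProd_ne_zero (b := b)) (by rw [← hh, mul_one])
  rw [h₂, map_one] at hz
  exact one_ne_zero hz

end Antisymmetrization

/-! ### Schubert classes -/

section Schubert

variable {ι M N : Type*} [AddCommGroup M] [Module ℝ M] [AddCommGroup N] [Module ℝ N]
variable {P : RootPairing ι ℝ M N} {b : P.Base}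
variable [Fintype ι] [P.IsRootSystem] [P.IsCrystallographic] [P.IsReduced]

theorem constantCoeff_divDiffW_mul (u v : P.weylGroup) {f : MvPolynomial b.support ℝ}
    (h : constantCoeff (divDiffW ℝ b (u * v) f) = 0) :
    constantCoeff (divDiffW ℝ b u (divDiffW ℝ b v f)) = 0 := by
  change constantCoeff ((divDiffW ℝ b u * divDiffW ℝ b v) f) = 0
  by_cases hl : length b (u * v) = length b u + length b v
  · rwa [divDiffW_mul hl]
  · rw [divDiffW_mul_eq_zero hl, LinearMap.zero_apply, map_zero]

theorem weylAct_mem_invIdeal (w : P.weylGroup) {f : MvPolynomial b.support ℝ}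
    (hf : f ∈ invIdeal b) : weylAct ℝ b w f ∈ invIdeal b := by
  have : invIdeal b ≤ (invIdeal b).comap (weylAct ℝ b w) := by
    refine Ideal.span_le.2 fun F hF => ?_
    change weylAct ℝ b w F ∈ invIdeal b
    rw [hF.2]
    exact Ideal.subset_span hF
  exact this hf

/-- `f - s_i f` is `α_i Δ_i f`; along a word these differences telescope, because `I_W` is stable
under the Weyl group. -/
theorem sub_weylAct_mem_invIdeal {f : MvPolynomial b.support ℝ}
    (h : ∀ i : b.support, divDiff ℝ b i f ∈ invIdeal b) (w : P.weylGroup) :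
    f - weylAct ℝ b w f ∈ invIdeal b := by
  rw [← wordProd_reducedWord (b := b) w]
  generalize reducedWord b w = L
  induction L with
  | nil => rw [wordProd_nil, weylAct_one, sub_self]; exact zero_mem _
  | cons i L ih =>
    have h₁ : f - weylAct ℝ b (simpleRefl b i) f ∈ invIdeal b := by
      rw [simpleRefl, ← root_mul_divDiff]
      exact Ideal.mul_mem_left _ _ (h i)
    have h₂ := weylAct_mem_invIdeal (simpleRefl b i) ih
    rw [map_sub] at h₂
    rw [wordProd_cons, weylAct_mul, ← sub_add_sub_cancel]
    exact add_mem h₁ h₂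

/-- A homogeneous polynomial killed by the functionals `f ↦ (Δ_w f)(0)` lies in `I_W`. -/
theorem mem_invIdeal_of_forall_divDiffW {n : ℕ} {f : MvPolynomial b.support ℝ}
    (hf : f.IsHomogeneous n) (h : ∀ w : P.weylGroup, constantCoeff (divDiffW ℝ b w f) = 0) :
    f ∈ invIdeal b := by
  induction n generalizing f with
  | zero =>
    have h₁ := h 1
    rw [divDiffW_one, Module.End.one_apply] at h₁
    rw [eq_C_of_isHomogeneous_zero hf, h₁, map_zero]
    exact zero_mem _
  | succ n ih =>
    -- By induction every `Δ_i f` lies in `I_W`, so `f` is congruent to all `w f`. Their sum is an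
    -- invariant of positive degree, hence in `I_W`, and it is congruent to `|W| f`.
    have hs := sub_weylAct_mem_invIdeal (b := b) (f := f) fun i => by
      refine ih (isHomogeneous_divDiff hf) fun w => ?_
      rw [← divDiffW_simpleRefl]
      exact constantCoeff_divDiffW_mul _ _ (h _)
    have hinv : ∑ w : P.weylGroup, weylAct ℝ b w f ∈ invIdeal b := by
      refine Ideal.subset_span ⟨⟨n + 1, n.succ_pos,
        IsHomogeneous.sum _ _ _ fun w _ => isHomogeneous_weylAct w hf⟩, fun u => ?_⟩
      rw [map_sum]
      exact Fintype.sum_equiv (Equiv.mulLeft u) _ _ fun w => (weylAct_mul u w f).symm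
    have hsum : (Nat.card P.weylGroup : ℝ) • f =
        ∑ w : P.weylGroup, (f - weylAct ℝ b w f) + ∑ w : P.weylGroup, weylAct ℝ b w f := by
      rw [Finset.sum_sub_distrib, sub_add_cancel, Finset.sum_const, Finset.card_univ,
        Nat.card_eq_fintype_card, Nat.cast_smul_eq_nsmul]
    have hmem : (Nat.card P.weylGroup : ℝ) • f ∈ invIdeal b := by
      rw [hsum]
      exact add_mem (sum_mem fun w _ => hs w) hinv
    rw [← inv_smul_smul₀ (card_weylGroup_ne_zero (P := P)) f, smul_eq_C_mul _ (_⁻¹)]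
    exact Ideal.mul_mem_left _ _ hmem

theorem eq_longest_of_length_eq {w : P.weylGroup} (h : length b w = length b (longest b)) :
    w = longest b := by
  have h₁ := length_mul_longest (b := b) w
  have h₂ := length_mul_longest (b := b) (longest b)
  have h₃ := eq_one_of_length_eq_zero (b := b) (w := w * longest b) (by lia)
  have h₄ := eq_one_of_length_eq_zero (b := b) (w := longest b * longest b) (by lia)
  exact mul_right_cancel (h₃.trans h₄.symm)

theorem isHomogeneous_topPoly : (topPoly b).IsHomogeneous (length b (longest b)) := by
  classical
  have h : length b (longest b) = ∑ k with b.IsPos k, 1 := by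
    rw [length_eq_card_inversions, Finset.card_eq_sum_ones]
    refine Finset.sum_congr (Finset.ext fun k => ?_) fun _ _ => rfl
    simp [mem_inversions, isPos_longest_smul]
  rw [h, topPoly_eq]
  exact isHomogeneous_real_smul (IsHomogeneous.prod _ _ _ fun k _ => isHomogeneous_linPoly _) _

variable (b) in
/-- The value of `Δ_{w₀}` at `c_{w₀}`. -/
def topValue : ℝ := constantCoeff (divDiffW ℝ b (longest b) (topPoly b))

theorem divDiffW_longest_topPoly : divDiffW ℝ b (longest b) (topPoly b) = C (topValue b) :=
  eq_C_of_isHomogeneous_zero (isHomogeneous_divDiffW _ (by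
    rw [zero_add]
    exact isHomogeneous_topPoly))

theorem constantCoeff_divDiffW_topPoly {w : P.weylGroup} (h : w ≠ longest b) :
    constantCoeff (divDiffW ℝ b w (topPoly b)) = 0 :=
  constantCoeff_divDiffW_of_ne isHomogeneous_topPoly fun h' => h (eq_longest_of_length_eq h'.symm)

/-- For `w ≠ w₀` the value `(Δ_w c_{w₀})(0)` vanishes by degree. If it vanished for `w₀` too,
`c_{w₀}` would lie in `I_W`. -/
theorem topValue_ne_zero : topValue b ≠ 0 := fun h =>
  topPoly_notMem_invIdeal (mem_invIdeal_of_forall_divDiffW isHomogeneous_topPoly fun w => by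
    by_cases hw : w = longest b
    · rw [hw]
      exact h
    · exact constantCoeff_divDiffW_topPoly hw)

theorem length_add_length_inv_mul_longest (w : P.weylGroup) :
    length b w + length b (w⁻¹ * longest b) = length b (longest b) := by
  rw [← length_mul_longest (b := b) w⁻¹, length_inv, add_comm]

theorem isHomogeneous_bggPoly (w : P.weylGroup) : (bggPoly b w).IsHomogeneous (length b w) :=
  isHomogeneous_divDiffW _ (by
    rw [length_add_length_inv_mul_longest]
    exact isHomogeneous_topPoly)

theorem divDiffW_bggPoly (w : P.weylGroup) : divDiffW ℝ b w (bggPoly b w) = C (topValue b) := by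
  have h : length b (w * (w⁻¹ * longest b)) = length b w + length b (w⁻¹ * longest b) := by
    rw [mul_inv_cancel_left, length_add_length_inv_mul_longest]
  change (divDiffW ℝ b w * divDiffW ℝ b (w⁻¹ * longest b)) (topPoly b) = _
  rw [divDiffW_mul h, mul_inv_cancel_left, divDiffW_longest_topPoly]

/-- With `divDiffW_bggPoly`, this makes the `c_w` dual to the functionals `f ↦ (Δ_u f)(0)`, up to
the factor `topValue`. -/
theorem constantCoeff_divDiffW_bggPoly {u w : P.weylGroup} (h : u ≠ w) :
    constantCoeff (divDiffW ℝ b u (bggPoly b w)) = 0 := by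
  refine constantCoeff_divDiffW_mul _ _ (constantCoeff_divDiffW_topPoly fun h' => h ?_)
  rw [← mul_assoc, mul_eq_right, mul_inv_eq_one] at h'
  exact h'

open Classical in
theorem span_range_schubert : Submodule.span ℝ (Set.range (schubert b)) = ⊤ := by
  refine Submodule.eq_top_iff'.2 fun x => ?_
  obtain ⟨f, rfl⟩ := Ideal.Quotient.mk_surjective x
  rw [← sum_homogeneousComponent f, map_sum]
  refine sum_mem fun n _ => ?_
  have hf := homogeneousComponent_isHomogeneous n f
  generalize homogeneousComponent n f = g at hf
  -- The coefficients come from this duality: the difference `g - s` is killed by every functional,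
  -- hence lies in `I_W`.
  set c : P.weylGroup → ℝ := fun w => constantCoeff (divDiffW ℝ b w g) / topValue b with hc
  set s : MvPolynomial b.support ℝ := ∑ w : P.weylGroup with length b w = n, c w • bggPoly b w
    with hs
  have hmem : g - s ∈ invIdeal b := by
    refine mem_invIdeal_of_forall_divDiffW (n := n) (hf.sub (IsHomogeneous.sum _ _ _ fun w hw =>
      isHomogeneous_real_smul ?_ _)) fun u => ?_
    · rw [← (Finset.mem_filter.1 hw).2]
      exact isHomogeneous_bggPoly w
    · have h₁ : ∀ w, constantCoeff (divDiffW ℝ b u (c w • bggPoly b w)) =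
          if u = w then constantCoeff (divDiffW ℝ b u g) else 0 := by
        intro w
        rw [map_smul, smul_eq_C_mul, map_mul, constantCoeff_C]
        split_ifs with h
        · rw [h, divDiffW_bggPoly, constantCoeff_C, hc]
          exact div_mul_cancel₀ _ topValue_ne_zero
        · rw [constantCoeff_divDiffW_bggPoly h, mul_zero]
      rw [map_sub, map_sub, hs, map_sum, map_sum, Finset.sum_congr rfl fun w _ => h₁ w,
        Finset.sum_ite_eq]
      split_ifs with h
      · exact sub_self _
      · rw [sub_zero]
        refine constantCoeff_divDiffW_of_ne hf fun h' => h ?_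
        exact Finset.mem_filter.2 ⟨Finset.mem_univ _, h'.symm⟩
  have hmk : (Ideal.Quotient.mk (invIdeal b) g : Coh b) = ∑ w : P.weylGroup with length b w = n,
      c w • schubert b w := by
    rw [Ideal.Quotient.eq.2 hmem, hs, map_sum]
    rfl
  rw [hmk]
  exact sum_mem fun w _ => Submodule.smul_mem _ _ (Submodule.subset_span ⟨w, rfl⟩)

end Schubert

/-! ### The pairing -/

section Pairing

variable {ι M N : Type*} [AddCommGroup M] [Module ℝ M] [AddCommGroup N] [Module ℝ N]
variable {P : RootPairing ι ℝ M N} {b : P.Base}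
variable [Fintype ι] [P.IsRootSystem] [P.IsCrystallographic] [P.IsReduced]
variable {A : Type*} [CommRing A] [Algebra ℝ A] [IsDomain A]

/-- The bilinear form `(f, g) ↦ (Δ_{w₀} (f g))(0)`. -/
def topPairing (A : Type*) [CommRing A] [Algebra ℝ A] [IsDomain A] (b : P.Base) :
    LinearMap.BilinForm A (MvPolynomial b.support A) :=
  (LinearMap.mul A (MvPolynomial b.support A)).compr₂
    ((lcoeff A 0).comp (divDiffW A b (longest b)))

theorem topPairing_apply (f g : MvPolynomial b.support A) :
    topPairing A b f g = constantCoeff (divDiffW A b (longest b) (f * g)) := rfl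

theorem topPairing_comm (f g : MvPolynomial b.support A) :
    topPairing A b f g = topPairing A b g f := by
  rw [topPairing_apply, topPairing_apply, mul_comm]

theorem topPairing_mul (f g h : MvPolynomial b.support A) :
    topPairing A b (f * g) h = topPairing A b g (f * h) := by
  rw [topPairing_apply, topPairing_apply, mul_left_comm, mul_assoc]

/-- The difference of the two integrands is `Δ_i (s_i f · g)`, and `Δ_{w₀} Δ_i = 0` since `w₀` has
maximal length. -/
theorem topPairing_divDiff (i : b.support) (f g : MvPolynomial b.support A) :
    topPairing A b (divDiff A b i f) g = topPairing A b f (divDiff A b i g) := by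
  have h₁ : divDiff A b i (weylAct A b (refl P i) f * g) = f * divDiff A b i g -
      divDiff A b i f * g := by
    refine divDiff_eq_of_mul_eq ?_
    rw [mul_sub, mul_left_comm, ← mul_assoc _ _ g, root_mul_divDiff, root_mul_divDiff, map_mul,
      ← weylAct_mul, refl_mul_self, weylAct_one]
    ring
  have h₂ : divDiffW A b (longest b) * divDiffW A b (simpleRefl b i) = 0 := by
    refine divDiffW_mul_eq_zero fun h => ?_
    have := length_longest_le (b := b) (longest b * simpleRefl b i)
    rw [length_simpleRefl] at h
    lia
  have h₃ := LinearMap.congr_fun h₂ (weylAct A b (refl P i) f * g)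
  rw [Module.End.mul_apply, divDiffW_simpleRefl, h₁, map_sub, LinearMap.zero_apply,
    sub_eq_zero] at h₃
  rw [topPairing_apply, topPairing_apply, h₃]

/-- Each letter is self-adjoint, and the reversal of a reduced word of `w` is a reduced word of
`w⁻¹`. -/
theorem topPairing_divDiffW (w : P.weylGroup) (f g : MvPolynomial b.support A) :
    topPairing A b (divDiffW A b w f) g = topPairing A b f (divDiffW A b w⁻¹ g) := by
  have h₁ : ∀ (L : List b.support) (f g : MvPolynomial b.support A),
      topPairing A b (wordOp A b L f) g = topPairing A b f (wordOp A b L.reverse g) := by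
    intro L
    induction L with
    | nil => exact fun _ _ => rfl
    | cons i L ih =>
      intro f g
      rw [wordOp_cons, topPairing_divDiff, ih, List.reverse_cons, wordOp_append]
      rfl
  have h₂ : ∀ L : List b.support, wordProd b L.reverse = (wordProd b L)⁻¹ := by
    intro L
    induction L with
    | nil => simp
    | cons i L ih =>
      rw [List.reverse_cons, wordProd_append, ih, wordProd_cons, wordProd_cons, wordProd_nil,
        mul_one, mul_inv_rev]
      simp only [simpleRefl, refl_inv]
  rw [divDiffW_eq_wordOp, h₁, wordOp_eq, h₂, wordProd_reducedWord, divDiffOfLength, if_pos]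
  rw [List.length_reverse, length_reducedWord, length_inv]

variable {S : Set (MvPolynomial b.support A)}

theorem divDiffW_mem_span (hS : ∀ F ∈ S, ∀ w : P.weylGroup, weylAct A b w F = F)
    {f : MvPolynomial b.support A} (hf : f ∈ Ideal.span S) (w : P.weylGroup) :
    divDiffW A b w f ∈ Ideal.span S := by
  -- As the operator is not linear over all polynomials, multiplication by `g` is built into the
  -- induction.
  suffices ∀ g, divDiffW A b w (f * g) ∈ Ideal.span S by simpa using this 1
  induction hf using Submodule.span_induction with
  | mem F hF =>
    intro g
    rw [divDiffW_mul_of_invariant (hS F hF)]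
    exact Ideal.mul_mem_right _ _ (Ideal.subset_span hF)
  | zero => exact fun g => by simp
  | add x y _ _ hx hy => 
    intro g
    rw [add_mul, map_add]
    exact add_mem (hx g) (hy g)
  | smul a x _ hx =>
    intro g
    rw [smul_eq_mul, mul_comm a, mul_assoc]
    exact hx _

theorem topPairing_eq_zero (hS : ∀ F ∈ S, ∀ w : P.weylGroup, weylAct A b w F = F)
    (hS' : ∀ F ∈ S, constantCoeff F = 0) {f : MvPolynomial b.support A} (hf : f ∈ Ideal.span S)
    (g : MvPolynomial b.support A) : topPairing A b f g = 0 := by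
  have hle : Ideal.span S ≤ RingHom.ker constantCoeff := Ideal.span_le.2 hS'
  exact hle (divDiffW_mem_span hS (Ideal.mul_mem_right _ _ hf) _)

theorem topPairing_invIdeal {f : MvPolynomial b.support ℝ} (hf : f ∈ invIdeal b)
    (g : MvPolynomial b.support ℝ) : topPairing ℝ b f g = 0 :=
  topPairing_eq_zero (fun _ hF => hF.2) (fun _ hF =>
    constantCoeff_eq_zero_of_isHomogeneous hF.1.choose_spec.2 hF.1.choose_spec.1.ne') hf g

variable (b) in
/-- The generators of the ideal `I_W ⊗ ℝ[q]`. -/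
def quantGenerators : Set (QPoly b) :=
  MvPolynomial.map (algebraMap ℝ (QRing b)) '' {f | (∃ d, 0 < d ∧ f.IsHomogeneous d) ∧
    ∀ w : P.weylGroup, weylAct ℝ b w f = f}

theorem quantIdeal_eq_span : quantIdeal b = Ideal.span (quantGenerators b) :=
  Ideal.map_span _ _

theorem weylAct_of_mem_quantGenerators (F : QPoly b) (hF : F ∈ quantGenerators b)
    (w : P.weylGroup) : weylAct (QRing b) b w F = F := by
  obtain ⟨f, hf, rfl⟩ := hF
  rw [← map_weylAct, hf.2]

theorem constantCoeff_of_mem_quantGenerators (F : QPoly b) (hF : F ∈ quantGenerators b) :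
    constantCoeff F = 0 := by
  obtain ⟨f, ⟨⟨d, hd, hf⟩, -⟩, rfl⟩ := hF
  rw [constantCoeff_map, constantCoeff_eq_zero_of_isHomogeneous hf hd.ne', map_zero]

theorem topPairing_quantIdeal {f : QPoly b} (hf : f ∈ quantIdeal b) (g : QPoly b) :
    topPairing (QRing b) b f g = 0 := by
  rw [quantIdeal_eq_span] at hf
  exact topPairing_eq_zero weylAct_of_mem_quantGenerators constantCoeff_of_mem_quantGenerators hf g

theorem divDiffW_mem_quantIdeal {f : QPoly b} (hf : f ∈ quantIdeal b) (w : P.weylGroup) :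
    divDiffW (QRing b) b w f ∈ quantIdeal b := by
  rw [quantIdeal_eq_span] at hf ⊢
  exact divDiffW_mem_span weylAct_of_mem_quantGenerators hf w

/-- A bilinear map descends along a surjective linear map whose kernel it kills. -/
theorem exists_bilinear_lift {R E F G : Type*} [CommRing R] [AddCommGroup E] [AddCommGroup F]
    [AddCommGroup G] [Module R E] [Module R F] [Module R G] {π : E →ₗ[R] F}
    (hπ : Function.Surjective π) (β : E →ₗ[R] E →ₗ[R] G) (h₁ : ∀ x y, π x = 0 → β x y = 0)
    (h₂ : ∀ x y, π y = 0 → β x y = 0) :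
    ∃ B : F →ₗ[R] F →ₗ[R] G, ∀ x y, B (π x) (π y) = β x y := by
  have key : ∀ x x' y y', π x = π x' → π y = π y' → β x y = β x' y' := by
    intro x x' y y' hx hy
    have e₁ := h₁ (x - x') y (by rw [map_sub, hx, sub_self])
    have e₂ := h₂ x' (y - y') (by rw [map_sub, hy, sub_self])
    rw [map_sub, LinearMap.sub_apply, sub_eq_zero] at e₁
    rw [map_sub, sub_eq_zero] at e₂
    exact e₁.trans e₂
  have hs := Function.surjInv_eq hπ
  set s := Function.surjInv hπ
  refine ⟨LinearMap.mk₂ R (fun x y => β (s x) (s y)) ?_ ?_ ?_ ?_, fun x y => ?_⟩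
  · intro x x' y
    rw [← LinearMap.add_apply, ← map_add]
    exact key _ _ _ _ (by rw [map_add, hs, hs, hs]) rfl
  · intro c x y
    rw [← LinearMap.smul_apply, ← map_smul]
    exact key _ _ _ _ (by rw [map_smul, hs, hs]) rfl
  · intro x y y'
    rw [← map_add]
    exact key _ _ _ _ rfl (by rw [map_add, hs, hs, hs])
  · intro c x y
    rw [← map_smul]
    exact key _ _ _ _ rfl (by rw [map_smul, hs, hs])
  · exact key _ _ _ _ (hs _) (hs _)

theorem topPairing_bggPoly (v : P.weylGroup) :
    topPairing ℝ b (bggPoly b (longest b * v)) (bggPoly b v) = topValue b * topValue b := by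
  -- Moving the operator across turns `c_v` into the constant `topValue`; applying `Δ_{w₀}` to the
  -- remaining `c_{w₀}` gives the second factor.
  have h : ((longest b * v)⁻¹ * longest b)⁻¹ = v := by group
  rw [bggPoly, topPairing_divDiffW, h, divDiffW_bggPoly, topPairing_comm, topPairing_apply,
    ← smul_eq_C_mul, map_smul, divDiffW_longest_topPoly, smul_eq_C_mul, map_mul, constantCoeff_C]

theorem topPairing_bggPoly_of_ne {u v : P.weylGroup} (h : u ≠ longest b * v) :
    topPairing ℝ b (bggPoly b u) (bggPoly b v) = 0 := by
  rw [bggPoly, topPairing_divDiffW, bggPoly]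
  set a := (u⁻¹ * longest b)⁻¹ with ha
  set e := v⁻¹ * longest b with he
  have hne : a * e ≠ longest b := by
    intro h'
    apply h
    have : u = longest b * (a * e) * (longest b)⁻¹ * v := by
      rw [ha, he]
      group
    rw [this, h', mul_inv_cancel_right]
  change topPairing ℝ b (topPoly b) ((divDiffW ℝ b a * divDiffW ℝ b e) (topPoly b)) = 0
  by_cases hl : length b (a * e) = length b a + length b e
  · have hlt : length b (a * e) < length b (longest b) :=
      lt_of_le_of_ne (length_longest_le _) fun h' => hne (eq_longest_of_length_eq h')
    -- The product to which `Δ_{w₀}` is applied has degree `l(w₀) + (m + 1)`, too large to leave a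
    -- constant term.
    obtain ⟨m, hm⟩ := Nat.exists_eq_add_of_lt hlt
    rw [divDiffW_mul hl, topPairing_apply]
    have hd : m + 1 + length b (a * e) = length b (longest b) := by lia
    refine constantCoeff_divDiffW_of_ne (n := length b (longest b) + (m + 1))
      (isHomogeneous_topPoly.mul (isHomogeneous_divDiffW _ ?_)) (by lia)
    rw [hd]
    exact isHomogeneous_topPoly
  · rw [divDiffW_mul_eq_zero hl, LinearMap.zero_apply, map_zero]

theorem isPoincarePairing_unique {B B' : LinearMap.BilinForm ℝ (Coh b)}
    (hB : IsPoincarePairing b B) (hB' : IsPoincarePairing b B') : B' = B := by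
  refine LinearMap.ext_on_range (v := schubert b) span_range_schubert fun u => ?_
  refine LinearMap.ext_on_range (v := schubert b) span_range_schubert fun v => ?_
  by_cases h : u = longest b * v
  · rw [h, hB.1, hB'.1]
  · rw [hB.2 u v h, hB'.2 u v h]

theorem exists_isPoincarePairing (b : P.Base) : ∃ B : LinearMap.BilinForm ℝ (Coh b),
    IsPoincarePairing b B ∧ ∀ f g : MvPolynomial b.support ℝ,
      B (Ideal.Quotient.mk _ f) (Ideal.Quotient.mk _ g) =
        (topValue b * topValue b)⁻¹ * topPairing ℝ b f g := by
  have hker : ∀ f : MvPolynomial b.support ℝ,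
      (Ideal.Quotient.mkₐ ℝ (invIdeal b)).toLinearMap f = 0 → f ∈ invIdeal b := fun f hf =>
    Ideal.Quotient.eq_zero_iff_mem.1 hf
  obtain ⟨B, hB⟩ := exists_bilinear_lift (π := (Ideal.Quotient.mkₐ ℝ (invIdeal b)).toLinearMap)
    (Ideal.Quotient.mkₐ_surjective ℝ _) ((topValue b * topValue b)⁻¹ • topPairing ℝ b)
    (fun f g hf => by
      rw [LinearMap.smul_apply, LinearMap.smul_apply, topPairing_invIdeal (hker f hf), smul_zero])
    (fun f g hg => by
      rw [LinearMap.smul_apply, LinearMap.smul_apply, topPairing_comm,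
        topPairing_invIdeal (hker g hg), smul_zero])
  have hB' : ∀ f g : MvPolynomial b.support ℝ,
      B (Ideal.Quotient.mk _ f) (Ideal.Quotient.mk _ g) =
        (topValue b * topValue b)⁻¹ * topPairing ℝ b f g := hB
  have hne : topValue b * topValue b ≠ 0 := mul_ne_zero topValue_ne_zero topValue_ne_zero
  refine ⟨B, ⟨fun v => ?_, fun u v h => ?_⟩, hB'⟩
  · rw [schubert, schubert, hB', topPairing_bggPoly, inv_mul_cancel₀ hne]
  · rw [schubert, schubert, hB', topPairing_bggPoly_of_ne h, mul_zero]

theorem topPairing_map (f g : MvPolynomial b.support ℝ) :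
    topPairing (QRing b) b (MvPolynomial.map (algebraMap ℝ (QRing b)) f)
      (MvPolynomial.map (algebraMap ℝ (QRing b)) g) = C (topPairing ℝ b f g) := by
  rw [topPairing_apply, ← map_mul, ← map_divDiffW, constantCoeff_map]
  rfl

theorem qClass_surjective : Function.Surjective (qClass b) := Ideal.Quotient.mk_surjective

theorem qClass_eq_zero_iff {f : QPoly b} : qClass b f = 0 ↔ f ∈ quantIdeal b :=
  Ideal.Quotient.eq_zero_iff_mem

theorem incl_mk (f : MvPolynomial b.support ℝ) : incl b (Ideal.Quotient.mk _ f) =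
    qClass b (MvPolynomial.map (algebraMap ℝ (QRing b)) f) := Ideal.quotientMap_mk

theorem exists_isExtension {B : LinearMap.BilinForm ℝ (Coh b)}
    (hB : ∀ f g : MvPolynomial b.support ℝ,
      B (Ideal.Quotient.mk _ f) (Ideal.Quotient.mk _ g) =
        (topValue b * topValue b)⁻¹ * topPairing ℝ b f g) :
    ∃ Bq : LinearMap.BilinForm (QRing b) (QCoh b), IsExtension b B Bq ∧ ∀ f g : QPoly b,
      Bq (qClass b f) (qClass b g) =
        C (topValue b * topValue b)⁻¹ * topPairing (QRing b) b f g := by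
  obtain ⟨Bq, hBq⟩ := exists_bilinear_lift (π := qClass b) qClass_surjective
    ((C (topValue b * topValue b)⁻¹ : QRing b) • topPairing (QRing b) b)
    (fun f g hf => by
      rw [LinearMap.smul_apply, LinearMap.smul_apply,
        topPairing_quantIdeal (qClass_eq_zero_iff.1 hf), smul_zero])
    (fun f g hg => by
      rw [LinearMap.smul_apply, LinearMap.smul_apply, topPairing_comm,
        topPairing_quantIdeal (qClass_eq_zero_iff.1 hg), smul_zero])
  refine ⟨Bq, fun x y => ?_, hBq⟩
  obtain ⟨f, rfl⟩ := Ideal.Quotient.mk_surjective x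
  obtain ⟨g, rfl⟩ := Ideal.Quotient.mk_surjective y
  rw [incl_mk, incl_mk, hBq, hB, LinearMap.smul_apply, LinearMap.smul_apply, topPairing_map,
    smul_eq_mul, C_mul]

theorem span_range_incl : Submodule.span (QRing b) (Set.range (incl b)) = ⊤ := by
  refine Submodule.eq_top_iff'.2 fun x => ?_
  obtain ⟨f, rfl⟩ := qClass_surjective x
  rw [f.as_sum, map_sum]
  refine sum_mem fun n _ => ?_
  have : monomial n (coeff n f) = coeff n f • (monomial n 1 : QPoly b) := by
    rw [smul_monomial, smul_eq_mul, mul_one]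
  rw [this, map_smul]
  refine Submodule.smul_mem _ _ (Submodule.subset_span ⟨Ideal.Quotient.mk _ (monomial n 1), ?_⟩)
  rw [incl_mk, map_monomial, map_one]

theorem isExtension_unique {B : LinearMap.BilinForm ℝ (Coh b)}
    {Bq Bq' : LinearMap.BilinForm (QRing b) (QCoh b)} (h : IsExtension b B Bq)
    (h' : IsExtension b B Bq') : Bq' = Bq := by
  refine LinearMap.ext_on_range (v := incl b) span_range_incl fun x => ?_
  refine LinearMap.ext_on_range (v := incl b) span_range_incl fun y => ?_
  rw [h, h']

end Pairing

/-! ### Evaluation at commuting operators -/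

section EvalOp

variable {σ R V : Type*} [Fintype σ] [CommRing R] [AddCommGroup V] [Module R V]
variable {T : σ → Module.End R V}

theorem evalOp_monomial (n : σ →₀ ℕ) (c : R) : evalOp T (monomial n c) =
    c • ((Finset.univ.toList).map fun i => T i ^ n i).prod := by
  have h : monomial n c = c • basisMonomials σ R n := by
    rw [coe_basisMonomials, smul_monomial, smul_eq_mul, mul_one]
  rw [h, map_smul, evalOp, Module.Basis.constr_basis]

theorem evalOp_C (c : R) : evalOp T (C c) = c • 1 := by
  rw [← monomial_zero', evalOp_monomial]
  simp

theorem evalOp_X_mul (hT : ∀ i j, Commute (T i) (T j)) (j : σ) (f : MvPolynomial σ R) :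
    evalOp T (X j * f) = T j * evalOp T f := by
  classical
  -- An extra factor `T_j` moves left through the ordered product from its own slot; for the
  -- induction on the list it must be recorded whether that slot occurs.
  have key : ∀ (L : List σ), L.Nodup → ∀ n : σ →₀ ℕ,
      (L.map fun i => T i ^ (Finsupp.single j 1 + n : σ →₀ ℕ) i).prod =
        (if j ∈ L then T j else 1) * (L.map fun i => T i ^ n i).prod := by
    intro L hL n
    induction L with
    | nil => simp
    | cons i L ih =>
      rw [List.nodup_cons] at hL
      rw [List.map_cons, List.prod_cons, ih hL.2, List.map_cons, List.prod_cons]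
      by_cases h : i = j
      · subst h
        simp [hL.1, pow_add, mul_assoc]
      · have h' : j ≠ i := fun h' => h h'.symm
        by_cases hm : j ∈ L
        · simp only [hm, List.mem_cons, or_true, if_true, Finsupp.add_apply,
            Finsupp.single_eq_of_ne h, zero_add, ← mul_assoc]
          rw [((hT i j).pow_left (n i)).eq]
        · simp [hm, h', Finsupp.single_eq_of_ne h]
  induction f using MvPolynomial.induction_on' with
  | monomial n c =>
    rw [X, monomial_mul, one_mul, evalOp_monomial, evalOp_monomial,
      key _ (Finset.nodup_toList _), if_pos (by simp), mul_smul_comm]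
  | add f g hf hg => rw [mul_add, map_add, map_add, mul_add, hf, hg]

theorem evalOp_mul (hT : ∀ i j, Commute (T i) (T j)) (f g : MvPolynomial σ R) :
    evalOp T (f * g) = evalOp T f * evalOp T g := by
  induction f using MvPolynomial.induction_on with
  | C a => rw [← smul_eq_C_mul, map_smul, evalOp_C, smul_mul_assoc, one_mul]
  | add f h hf hh => rw [add_mul, map_add, map_add, add_mul, hf, hh]
  | mul_X f j hf => rw [mul_comm f, mul_assoc, evalOp_X_mul hT, evalOp_X_mul hT, hf, mul_assoc]

end EvalOp

/-! ### Graded pieces of `ℝ[λ, q]` -/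

section Graded

variable {ι M N : Type*} [AddCommGroup M] [Module ℝ M] [AddCommGroup N] [Module ℝ N]
variable {P : RootPairing ι ℝ M N} {b : P.Base}

variable (b) in
/-- The elements of `ℝ[λ, q]` that are homogeneous of degree `d`, where `deg λ_i = 2` and
`deg q_i = 4`, and of degree less than `n` in the `λ_i`. -/
def gradedLT (d n : ℕ) : Submodule ℝ (QPoly b) :=
  Submodule.span ℝ {F | ∃ (p : QRing b) (f : MvPolynomial b.support ℝ) (m k : ℕ),
    p.IsHomogeneous m ∧ f.IsHomogeneous k ∧ 2 * k + 4 * m = d ∧ k < n ∧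
      F = C p * MvPolynomial.map (algebraMap ℝ (QRing b)) f}

theorem C_mul_map_mem_gradedLT {p : QRing b} {f : MvPolynomial b.support ℝ} {m k d n : ℕ}
    (hp : p.IsHomogeneous m) (hf : f.IsHomogeneous k) (hd : 2 * k + 4 * m = d) (hk : k < n) :
    C p * MvPolynomial.map (algebraMap ℝ (QRing b)) f ∈ gradedLT b d n :=
  Submodule.subset_span ⟨p, f, m, k, hp, hf, hd, hk, rfl⟩

theorem map_mem_gradedLT {f : MvPolynomial b.support ℝ} {k d n : ℕ} (hf : f.IsHomogeneous k)
    (hd : 2 * k = d) (hk : k < n) :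
    MvPolynomial.map (algebraMap ℝ (QRing b)) f ∈ gradedLT b d n := by
  rw [← one_mul (MvPolynomial.map _ f), ← C_1]
  exact C_mul_map_mem_gradedLT (isHomogeneous_one _ _) hf (by lia) hk

theorem map_mem_of_mem_gradedLT {E : Type*} [AddCommGroup E] [Module ℝ E] {S : Submodule ℝ E}
    {φ : QPoly b →ₗ[ℝ] E} {d n : ℕ}
    (h : ∀ (p : QRing b) (f : MvPolynomial b.support ℝ) (m k : ℕ), p.IsHomogeneous m →
      f.IsHomogeneous k → 2 * k + 4 * m = d → k < n →
        φ (C p * MvPolynomial.map (algebraMap ℝ (QRing b)) f) ∈ S)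
    {F : QPoly b} (hF : F ∈ gradedLT b d n) : φ F ∈ S := by
  have : gradedLT b d n ≤ S.comap φ := by
    refine Submodule.span_le.2 ?_
    rintro _ ⟨p, f, m, k, hp, hf, hd, hk, rfl⟩
    exact h p f m k hp hf hd hk
  exact this hF

theorem gradedLT_mono {d n n' : ℕ} (h : n ≤ n') {F : QPoly b} (hF : F ∈ gradedLT b d n) :
    F ∈ gradedLT b d n' :=
  map_mem_of_mem_gradedLT (φ := LinearMap.id)
    (fun _ _ _ _ hp hf hd hk => C_mul_map_mem_gradedLT hp hf hd (hk.trans_le h)) hF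

/-- In total degree `d` the `λ`-degree never exceeds `d / 2`, so the bound `d + 1` imposes no
condition. -/
theorem gradedLT_le {d n : ℕ} {F : QPoly b} (hF : F ∈ gradedLT b d n) :
    F ∈ gradedLT b d (d + 1) :=
  map_mem_of_mem_gradedLT (φ := LinearMap.id)
    (fun _ _ _ _ hp hf hd _ => C_mul_map_mem_gradedLT hp hf hd (by lia)) hF

theorem gradedLT_zero {d : ℕ} {F : QPoly b} (hF : F ∈ gradedLT b d 0) : F = 0 :=
  (Submodule.mem_bot ℝ).1 (map_mem_of_mem_gradedLT (φ := LinearMap.id)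
    (fun _ _ _ _ _ _ _ hk => absurd hk (Nat.not_lt_zero _)) hF)

theorem smul_mem_gradedLT {p : QRing b} {m d n : ℕ} (hp : p.IsHomogeneous m) {F : QPoly b}
    (hF : F ∈ gradedLT b d n) : p • F ∈ gradedLT b (d + 4 * m) n :=
  map_mem_of_mem_gradedLT (φ := (LinearMap.lsmul (QRing b) (QPoly b) p).restrictScalars ℝ)
    (fun p' f m' k hp' hf hd hk => by
      change p • (C p' * MvPolynomial.map (algebraMap ℝ (QRing b)) f) ∈ _
      rw [smul_eq_C_mul, ← mul_assoc, ← C_mul]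
      exact C_mul_map_mem_gradedLT (hp.mul hp') hf (by lia) hk) hF

theorem mul_mem_gradedLT {d n d' n' : ℕ} {F G : QPoly b} (hF : F ∈ gradedLT b d n)
    (hG : G ∈ gradedLT b d' n') : F * G ∈ gradedLT b (d + d') (d + d' + 1) :=
  map_mem_of_mem_gradedLT (φ := LinearMap.mulRight ℝ G)
    (fun p f m k hp hf hd hk => by
      change C p * _ * G ∈ _
      refine map_mem_of_mem_gradedLT (φ := LinearMap.mulLeft ℝ
        (C p * MvPolynomial.map (algebraMap ℝ (QRing b)) f)) (fun p' f' m' k' hp' hf' hd' hk' => ?_) hG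
      change C p * _ * (C p' * _) ∈ _
      rw [mul_mul_mul_comm, ← C_mul, ← map_mul]
      exact C_mul_map_mem_gradedLT (hp.mul hp') (hf.mul hf') (by lia) (by lia)) hF

theorem X_mul_mem_gradedLT {d n : ℕ} (i : b.support) {F : QPoly b} (hF : F ∈ gradedLT b d n) :
    X i * F ∈ gradedLT b (d + 2) (n + 1) :=
  map_mem_of_mem_gradedLT (φ := LinearMap.mulLeft ℝ (X i))
    (fun p f m k hp hf hd hk => by
      change X i * (C p * _) ∈ _
      rw [mul_left_comm, ← map_X (algebraMap ℝ (QRing b)), ← map_mul]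
      exact C_mul_map_mem_gradedLT hp ((isHomogeneous_X _ i).mul hf) (by lia) (by lia)) hF

theorem monomial_monomial_mem_gradedLT (n m : b.support →₀ ℕ) :
    (monomial n (monomial m 1) : QPoly b) ∈
      gradedLT b (2 * n.degree + 4 * m.degree) (n.degree + 1) := by
  have h : (monomial n (monomial m 1) : QPoly b) = C (monomial m 1) *
      MvPolynomial.map (algebraMap ℝ (QRing b)) (monomial n 1) := by
    rw [map_monomial, C_mul_monomial, (algebraMap ℝ (QRing b)).map_one, mul_one]
  rw [h]
  exact C_mul_map_mem_gradedLT (isHomogeneous_monomial _ rfl) (isHomogeneous_monomial _ rfl) rfl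
    (Nat.lt_succ_self _)

theorem monomial_monomial_induction {p : QPoly b → Prop}
    (hm : ∀ n m, p (monomial n (monomial m 1))) (hadd : ∀ F G, p F → p G → p (F + G))
    (hsmul : ∀ (c : ℝ) (F : QPoly b), p F → p ((C c : QRing b) • F)) (F : QPoly b) : p F := by
  induction F using MvPolynomial.induction_on' with
  | monomial n a =>
    induction a using MvPolynomial.induction_on' with
    | monomial m c =>
      have h : (monomial n (monomial m c) : QPoly b) =
          (C c : QRing b) • monomial n (monomial m 1) := by
        rw [smul_monomial, smul_eq_mul, C_mul_monomial, mul_one]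
      rw [h]
      exact hsmul _ _ (hm _ _)
    | add f g hf hg =>
      rw [map_add]
      exact hadd _ _ hf hg
  | add f g hf hg => exact hadd _ _ hf hg

end Graded

/-! ### The map `ψ` -/

section Psi

variable {ι M N : Type*} [AddCommGroup M] [Module ℝ M] [AddCommGroup N] [Module ℝ N]
variable {P : RootPairing ι ℝ M N} {b : P.Base}
variable [Fintype ι] [P.IsRootSystem] [P.IsCrystallographic] [P.IsReduced]

theorem isHomogeneous_qMonomial (k : ι) : (qMonomial b k).IsHomogeneous (coheight b k) :=
  IsHomogeneous.prod _ _ _ fun i _ => by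
    have := (isHomogeneous_X ℝ i).pow (corootCoeff b k i)
    rwa [one_mul] at this

/-- For `α` in `minRoots`, `q^{α^∨}` adds `4 ht(α^∨)` to the degree and `Δ_{s_α}` removes `2 (2
ht(α^∨) - 1)`: a net gain of 2. The `λ`-degree drops by at least 1. -/
theorem quantumPart_mem_gradedLT (x : M) {d n : ℕ} {F : QPoly b}
    (hF : F ∈ gradedLT b d (n + 1)) : quantumPart b x F ∈ gradedLT b (d + 2) n := by
  refine sum_mem fun α hα => Submodule.smul_mem _ _ ?_
  simp only [Finset.mem_filter, Finset.mem_univ, true_and] at hα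
  obtain ⟨hpos, hlen⟩ := mem_minRoots.1 hα
  have hc := coheight_pos hpos
  refine map_mem_of_mem_gradedLT (φ := ((LinearMap.lsmul (QRing b) (QPoly b)
    (qMonomial b α)).comp (divDiffW (QRing b) b (refl P α))).restrictScalars ℝ)
    (fun p f m k hp hf hd hk => ?_) hF
  change qMonomial b α • divDiffW (QRing b) b (refl P α)
    (C p * MvPolynomial.map (algebraMap ℝ (QRing b)) f) ∈ _
  rw [← smul_eq_C_mul, map_smul, ← map_divDiffW, smul_smul, smul_eq_C_mul]
  rcases lt_or_ge k (length b (refl P α)) with h | h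
  · rw [divDiffW_eq_zero_of_isHomogeneous hf h, map_zero, mul_zero]
    exact zero_mem _
  · obtain ⟨k', rfl⟩ := Nat.exists_eq_add_of_le' h
    exact C_mul_map_mem_gradedLT ((isHomogeneous_qMonomial α).mul hp) (isHomogeneous_divDiffW _ hf)
      (by lia) (by lia)

theorem lambdaOp_apply_eq (j : b.support) (F : QPoly b) :
    lambdaOp b j F = X j * F + quantumPart b (fundWeight b j) F := by
  rw [lambdaOp_apply, linPoly_fundWeight]

theorem psi_apply (F : QPoly b) : psi b F = evalOp (lambdaOp b) F 1 := rfl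

theorem psi_X_mul (j : b.support) (F : QPoly b) : psi b (X j * F) = lambdaOp b j (psi b F) := by
  rw [psi_apply, psi_apply, evalOp_X_mul lambdaOp_commute, Module.End.mul_apply]

theorem psi_C (p : QRing b) : psi b (C p) = C p := by
  rw [psi_apply, evalOp_C, LinearMap.smul_apply, Module.End.one_apply, ← C_eq_smul_one]

theorem psi_mul (F G : QPoly b) : psi b (F * G) = evalOp (lambdaOp b) F (psi b G) := by
  rw [psi_apply, psi_apply, evalOp_mul lambdaOp_commute, Module.End.mul_apply]

/-- This is the unitriangularity of `ψ`: each `Λ_i` is multiplication by `λ_i` plus a part that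
lowers the `λ`-degree. -/
theorem psi_map_sub_mem_gradedLT {f : MvPolynomial b.support ℝ} {k : ℕ}
    (hf : f.IsHomogeneous k) :
    psi b (MvPolynomial.map (algebraMap ℝ (QRing b)) f) -
      MvPolynomial.map (algebraMap ℝ (QRing b)) f ∈ gradedLT b (2 * k) k := by
  induction k generalizing f with
  | zero =>
    rw [eq_C_of_isHomogeneous_zero hf, map_C, psi_C, sub_self]
    exact zero_mem _
  | succ k ih =>
    refine homogeneous_succ_induction (p := fun f =>
      psi b (MvPolynomial.map (algebraMap ℝ (QRing b)) f) -
        MvPolynomial.map (algebraMap ℝ (QRing b)) f ∈ gradedLT b (2 * (k + 1)) (k + 1)) ?_ ?_ ?_ hf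
    · rw [map_zero, map_zero, sub_zero]
      exact zero_mem _
    · intro f g hf hg
      rw [map_add, map_add, add_sub_add_comm]
      exact add_mem hf hg
    · intro i g hg
      have h₁ := ih hg
      have h₂ := add_mem (gradedLT_mono (Nat.le_succ k) h₁)
        (map_mem_gradedLT hg rfl (Nat.lt_succ_self k))
      rw [sub_add_cancel] at h₂
      rw [map_mul, map_X, psi_X_mul, lambdaOp_apply_eq, add_sub_right_comm, ← mul_sub]
      exact add_mem (X_mul_mem_gradedLT i h₁)
        (gradedLT_mono (Nat.le_succ k) (quantumPart_mem_gradedLT _ h₂))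

theorem psi_sub_mem_gradedLT {d n : ℕ} {F : QPoly b} (hF : F ∈ gradedLT b d (n + 1)) :
    psi b F - F ∈ gradedLT b d n :=
  map_mem_of_mem_gradedLT (φ := (psi b - LinearMap.id).restrictScalars ℝ)
    (fun p f m k hp hf hd hk => by
      change psi b (C p * _) - C p * _ ∈ _
      rw [← smul_eq_C_mul, map_smul, ← smul_sub, ← hd]
      exact gradedLT_mono (Nat.le_of_lt_succ hk) (smul_mem_gradedLT hp
        (psi_map_sub_mem_gradedLT hf))) hF

theorem psi_mem_gradedLT {d : ℕ} {F : QPoly b} (hF : F ∈ gradedLT b d (d + 1)) :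
    psi b F ∈ gradedLT b d (d + 1) := by
  have := add_mem (gradedLT_mono (Nat.le_succ d) (psi_sub_mem_gradedLT hF)) hF
  rwa [sub_add_cancel] at this

/-- `F` is corrected by a preimage of `ψ F - F`, which has smaller `λ`-degree. The preimage stays in
the same graded piece, as the grading of `⋆` requires. -/
theorem exists_psi_eq_of_mem_gradedLT {d n : ℕ} {F : QPoly b} (hF : F ∈ gradedLT b d n) :
    ∃ G ∈ gradedLT b d n, psi b G = F := by
  induction n generalizing F with
  | zero => exact ⟨0, zero_mem _, by rw [map_zero, gradedLT_zero hF]⟩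
  | succ n ih =>
    obtain ⟨G, hG, hG'⟩ := ih (psi_sub_mem_gradedLT hF)
    exact ⟨F - G, sub_mem hF (gradedLT_mono (Nat.le_succ n) hG), by
      rw [map_sub, hG', sub_sub_cancel]⟩

theorem pow_psi_sub_one_eq_zero {d n : ℕ} {F : QPoly b} (hF : F ∈ gradedLT b d n) :
    ((psi b - 1 : Module.End (QRing b) (QPoly b)) ^ n) F = 0 := by
  induction n generalizing F with
  | zero => exact gradedLT_zero hF
  | succ n ih =>
    rw [pow_succ]
    exact ih (psi_sub_mem_gradedLT hF)

theorem exists_pow_psi_sub_one_eq_zero (F : QPoly b) :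
    ∃ n, ((psi b - 1 : Module.End (QRing b) (QPoly b)) ^ n) F = 0 := by
  induction F using monomial_monomial_induction with
  | hm n m => exact ⟨_, pow_psi_sub_one_eq_zero (monomial_monomial_mem_gradedLT n m)⟩
  | hadd x y hx hy =>
    obtain ⟨n, hn⟩ := hx
    obtain ⟨m, hm⟩ := hy
    refine ⟨m + n, ?_⟩
    have h₁ : ((psi b - 1 : Module.End (QRing b) (QPoly b)) ^ (m + n)) x = 0 := by
      rw [pow_add, Module.End.mul_apply, hn, map_zero]
    have h₂ : ((psi b - 1 : Module.End (QRing b) (QPoly b)) ^ (m + n)) y = 0 := by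
      rw [add_comm, pow_add, Module.End.mul_apply, hm, map_zero]
    rw [map_add, h₁, h₂, add_zero]
  | hsmul c x hx =>
    obtain ⟨n, hn⟩ := hx
    exact ⟨n, by rw [map_smul, hn, smul_zero]⟩

/-- On the kernel `ψ - 1` acts as `-1`, yet some power of it kills each element. -/
theorem psi_injective : Function.Injective (psi b) := by
  refine (injective_iff_map_eq_zero _).2 fun F hF => ?_
  obtain ⟨n, hn⟩ := exists_pow_psi_sub_one_eq_zero F
  have h : ∀ n, ((psi b - 1 : Module.End (QRing b) (QPoly b)) ^ n) F = (-1) ^ n * F := by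
    intro n
    induction n with
    | zero => simp
    | succ n ih =>
      rw [pow_succ, Module.End.mul_apply, LinearMap.sub_apply, hF, Module.End.one_apply, zero_sub,
        map_neg, ih, pow_succ]
      ring
  rw [h] at hn
  exact (mul_eq_zero.1 hn).resolve_left (pow_ne_zero _ (neg_ne_zero.2 one_ne_zero))

theorem psi_surjective : Function.Surjective (psi b) := by
  intro F
  induction F using monomial_monomial_induction with
  | hm n m =>
    obtain ⟨G, -, hG⟩ := exists_psi_eq_of_mem_gradedLT (monomial_monomial_mem_gradedLT (b := b) n m)
    exact ⟨G, hG⟩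
  | hadd x y hx hy =>
    obtain ⟨G, rfl⟩ := hx
    obtain ⟨H, rfl⟩ := hy
    exact ⟨G + H, map_add _ _ _⟩
  | hsmul c x hx =>
    obtain ⟨G, rfl⟩ := hx
    exact ⟨(C c : QRing b) • G, map_smul _ _ _⟩

theorem psi_bijective : Function.Bijective (psi b) := ⟨psi_injective, psi_surjective⟩

theorem psi_psiInv (F : QPoly b) : psi b (psiInv b F) = F :=
  Function.rightInverse_invFun psi_surjective F

end Psi

/-! ### The quantum product -/

section Star

variable {ι M N : Type*} [AddCommGroup M] [Module ℝ M] [AddCommGroup N] [Module ℝ N]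
variable {P : RootPairing ι ℝ M N} {b : P.Base}
variable [Fintype ι] [P.IsRootSystem] [P.IsCrystallographic] [P.IsReduced]

/-- The ideal is generated by Weyl invariants, over which every `Δ_w` is linear. -/
theorem lambdaOp_mem_quantIdeal (j : b.support) {F : QPoly b} (hF : F ∈ quantIdeal b) :
    lambdaOp b j F ∈ quantIdeal b := by
  rw [lambdaOp_apply_eq]
  refine add_mem (Ideal.mul_mem_left _ _ hF) (sum_mem fun k _ => ?_)
  refine Submodule.smul_of_tower_mem _ _ (Submodule.smul_of_tower_mem _ _ ?_)
  exact divDiffW_mem_quantIdeal hF _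

theorem evalOp_lambdaOp_mem_quantIdeal (G : QPoly b) {F : QPoly b} (hF : F ∈ quantIdeal b) :
    evalOp (lambdaOp b) G F ∈ quantIdeal b := by
  induction G using MvPolynomial.induction_on with
  | C a =>
    rw [evalOp_C, LinearMap.smul_apply, Module.End.one_apply, smul_eq_C_mul]
    exact Ideal.mul_mem_left _ _ hF
  | add G H hG hH =>
    rw [map_add, LinearMap.add_apply]
    exact add_mem hG hH
  | mul_X G j hG =>
    rw [mul_comm, evalOp_X_mul lambdaOp_commute, Module.End.mul_apply]
    exact lambdaOp_mem_quantIdeal j hG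

/-- The adjoint of `Δ_{s_α}` is `Δ_{s_α⁻¹}`, which is the same operator. -/
theorem topPairing_lambdaOp (j : b.support) (F G : QPoly b) :
    topPairing (QRing b) b (lambdaOp b j F) G = topPairing (QRing b) b F (lambdaOp b j G) := by
  rw [lambdaOp_apply_eq, lambdaOp_apply_eq, map_add, LinearMap.add_apply, map_add,
    topPairing_mul]
  congr 1
  rw [quantumPart, quantumPart, map_sum, LinearMap.sum_apply, map_sum]
  refine Finset.sum_congr rfl fun k _ => ?_
  have hs : ∀ (c : ℝ) (H : QPoly b), c • H = algebraMap ℝ (QRing b) c • H := fun c H =>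
    (algebraMap_smul (QRing b) c H).symm
  rw [hs, hs, map_smul, map_smul, map_smul,
    map_smul, LinearMap.smul_apply, LinearMap.smul_apply, topPairing_divDiffW, refl_inv]

theorem topPairing_evalOp_lambdaOp (H F G : QPoly b) :
    topPairing (QRing b) b (evalOp (lambdaOp b) H F) G =
      topPairing (QRing b) b F (evalOp (lambdaOp b) H G) := by
  induction H using MvPolynomial.induction_on generalizing F G with
  | C a =>
    rw [evalOp_C, LinearMap.smul_apply, LinearMap.smul_apply, Module.End.one_apply,
      Module.End.one_apply, map_smul, map_smul, LinearMap.smul_apply]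
  | add H K hH hK =>
    rw [map_add, LinearMap.add_apply, LinearMap.add_apply, map_add, map_add, LinearMap.add_apply,
      hH, hK]
  | mul_X H j hH =>
    -- Passing to the adjoint reverses the order of the factors, so `Λ_j` is placed on the left for
    -- one side and on the right for the other.
    have h₁ : evalOp (lambdaOp b) (H * X j) = lambdaOp b j * evalOp (lambdaOp b) H := by
      rw [mul_comm, evalOp_X_mul lambdaOp_commute]
    have h₂ : evalOp (lambdaOp b) (H * X j) = evalOp (lambdaOp b) H * lambdaOp b j := by
      rw [evalOp_mul lambdaOp_commute, ← mul_one (X j), evalOp_X_mul lambdaOp_commute, ← C_1,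
        evalOp_C, one_smul, mul_one]
    nth_rewrite 1 [h₁]
    rw [h₂, Module.End.mul_apply, Module.End.mul_apply, topPairing_lambdaOp, hH]

-- The product is multiplication of polynomials, transported by `ψ`. It descends because `ψ(F G)`
-- arises from either of `ψ(F)` and `ψ(G)` by a polynomial in the `Λ_j`, and these preserve the
-- ideal.
variable (b) in
theorem exists_star : ∃ star : QCoh b →ₗ[QRing b] QCoh b →ₗ[QRing b] QCoh b,
    ∀ F G : QPoly b, star (qClass b (psi b F)) (qClass b (psi b G)) =
      qClass b (psi b (F * G)) := by
  obtain ⟨star, h⟩ := exists_bilinear_lift (π := (qClass b).comp (psi b))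
    (qClass_surjective.comp psi_surjective)
    ((LinearMap.mul (QRing b) (QPoly b)).compr₂ ((qClass b).comp (psi b)))
    (fun F G h => by
      change qClass b (psi b (F * G)) = 0
      rw [mul_comm, psi_mul]
      exact qClass_eq_zero_iff.2 (evalOp_lambdaOp_mem_quantIdeal _ (qClass_eq_zero_iff.1 h)))
    (fun F G h => by
      change qClass b (psi b (F * G)) = 0
      rw [psi_mul]
      exact qClass_eq_zero_iff.2 (evalOp_lambdaOp_mem_quantIdeal _ (qClass_eq_zero_iff.1 h)))
  exact ⟨star, h⟩

theorem exists_qClass_psi_eq (x : QCoh b) : ∃ F, qClass b (psi b F) = x :=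
  (qClass_surjective.comp psi_surjective) x

theorem topPairing_psi_mul (F G H : QPoly b) :
    topPairing (QRing b) b (psi b (F * G)) (psi b H) =
      topPairing (QRing b) b (psi b F) (psi b (G * H)) := by
  rw [mul_comm, psi_mul, psi_mul, topPairing_evalOp_lambdaOp]

end Star

/-! ### The grading of `ℋ ⊗ ℝ[q]` -/

section Grading

variable {ι M N : Type*} [AddCommGroup M] [Module ℝ M] [AddCommGroup N] [Module ℝ N]
variable {P : RootPairing ι ℝ M N} {b : P.Base}
variable [Fintype ι] [P.IsRootSystem] [P.IsCrystallographic] [P.IsReduced]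

theorem qClass_mem_gradedPiece {d n : ℕ} {F : QPoly b} (hF : F ∈ gradedLT b d n) :
    qClass b F ∈ gradedPiece b d :=
  map_mem_of_mem_gradedLT (φ := (qClass b).restrictScalars ℝ)
    (fun p f m k hp hf hd hk => by
      change qClass b (C p * MvPolynomial.map (algebraMap ℝ (QRing b)) f) ∈ _
      rw [p.as_sum, f.as_sum, map_sum, map_sum, Finset.sum_mul_sum, map_sum]
      refine sum_mem fun u hu => ?_
      rw [map_sum]
      refine sum_mem fun v hv => ?_
      have h : (C (monomial u (coeff u p)) * MvPolynomial.map (algebraMap ℝ (QRing b))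
          (monomial v (coeff v f)) : QPoly b) =
          (coeff u p * coeff v f) • monomial v (monomial u 1) := by
        rw [map_monomial, C_mul_monomial, algebraMap_eq, mul_comm, C_mul_monomial, smul_monomial,
          smul_monomial, smul_eq_mul, mul_one, mul_comm]
      rw [h]
      change (qClass b).restrictScalars ℝ (_ • _) ∈ _
      rw [map_smul]
      refine Submodule.smul_mem _ _ (Submodule.subset_span ⟨v, u, ?_, rfl⟩)
      have hu' : Finsupp.weight 1 u = m := hp (mem_support_iff.1 hu)
      have hv' : Finsupp.weight 1 v = k := hf (mem_support_iff.1 hv)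
      rw [Pi.one_def, ← Finsupp.degree_eq_weight_one] at hu' hv'
      rw [hu', hv', hd]) hF

theorem exists_mem_gradedLT {d : ℕ} {x : QCoh b} (hx : x ∈ gradedPiece b d) :
    ∃ F ∈ gradedLT b d (d + 1), qClass b F = x := by
  have : gradedPiece b d ≤ (gradedLT b d (d + 1)).map ((qClass b).restrictScalars ℝ) := by
    refine Submodule.span_le.2 ?_
    rintro _ ⟨n, m, rfl, rfl⟩
    exact ⟨_, gradedLT_le (monomial_monomial_mem_gradedLT n m), rfl⟩
  exact this hx

/-- Homogeneous classes have homogeneous representatives, and `ψ` and taking preimages under it both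
preserve the degree. -/
theorem star_mem_gradedPiece {star : QCoh b →ₗ[QRing b] QCoh b →ₗ[QRing b] QCoh b}
    (hstar : ∀ F G : QPoly b, star (qClass b (psi b F)) (qClass b (psi b G)) =
      qClass b (psi b (F * G))) {d e : ℕ} {x y : QCoh b} (hx : x ∈ gradedPiece b d)
    (hy : y ∈ gradedPiece b e) : star x y ∈ gradedPiece b (d + e) := by
  obtain ⟨F, hF, rfl⟩ := exists_mem_gradedLT hx
  obtain ⟨G, hG, rfl⟩ := exists_mem_gradedLT hy
  obtain ⟨F', hF', rfl⟩ := exists_psi_eq_of_mem_gradedLT hF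
  obtain ⟨G', hG', rfl⟩ := exists_psi_eq_of_mem_gradedLT hG
  rw [hstar]
  exact qClass_mem_gradedPiece (psi_mem_gradedLT (mul_mem_gradedLT hF' hG'))

/-! ### Separating the degrees by a formal parameter. -/

section DegreeHom

variable {S : Type*} [CommRing S] (φ : QPoly b →+* S)

/-- The ring homomorphism `φ`, with `λ_i` multiplied by `T ^ 2` and `q_i` by `T ^ 4`. -/
def degreeHom : QPoly b →+* Polynomial S :=
  eval₂Hom (eval₂Hom (Polynomial.C.comp (φ.comp (C.comp C)))
    fun i => Polynomial.C (φ (C (X i))) * Polynomial.X ^ 4)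
    fun i => Polynomial.C (φ (X i)) * Polynomial.X ^ 2

theorem degreeHom_C_C (c : ℝ) : degreeHom φ (C (C c)) = Polynomial.C (φ (C (C c))) := by
  rw [degreeHom, coe_eval₂Hom, eval₂_C, coe_eval₂Hom, eval₂_C]
  rfl

theorem degreeHom_C {p : QRing b} {m : ℕ} (hp : p.IsHomogeneous m) :
    degreeHom φ (C p) = Polynomial.C (φ (C p)) * Polynomial.X ^ (4 * m) := by
  induction m generalizing p with
  | zero => rw [eq_C_of_isHomogeneous_zero hp, degreeHom_C_C, mul_zero, pow_zero, mul_one]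
  | succ m ih =>
    refine homogeneous_succ_induction (p := fun p => degreeHom φ (C p) =
      Polynomial.C (φ (C p)) * Polynomial.X ^ (4 * (m + 1))) ?_ ?_ ?_ hp
    · simp
    · intro f g hf hg
      rw [C_add, map_add, hf, hg, map_add, map_add, add_mul]
    · intro i g hg
      have h : degreeHom φ (C (X i)) = Polynomial.C (φ (C (X i))) * Polynomial.X ^ 4 := by
        rw [degreeHom, coe_eval₂Hom, eval₂_C, coe_eval₂Hom, eval₂_X]
      rw [C_mul, map_mul, ih hg, h, map_mul, map_mul]
      ring

theorem degreeHom_map {f : MvPolynomial b.support ℝ} {k : ℕ} (hf : f.IsHomogeneous k) :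
    degreeHom φ (MvPolynomial.map (algebraMap ℝ (QRing b)) f) =
      Polynomial.C (φ (MvPolynomial.map (algebraMap ℝ (QRing b)) f)) *
        Polynomial.X ^ (2 * k) := by
  induction k generalizing f with
  | zero =>
    rw [eq_C_of_isHomogeneous_zero hf, map_C, algebraMap_eq, degreeHom_C_C, mul_zero, pow_zero,
      mul_one]
  | succ k ih =>
    refine homogeneous_succ_induction (p := fun f =>
      degreeHom φ (MvPolynomial.map (algebraMap ℝ (QRing b)) f) =
      Polynomial.C (φ (MvPolynomial.map (algebraMap ℝ (QRing b)) f)) *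
        Polynomial.X ^ (2 * (k + 1))) ?_ ?_ ?_ hf
    · simp
    · intro f g hf hg
      rw [map_add, map_add, hf, hg, map_add, map_add, add_mul]
    · intro i g hg
      have h : degreeHom φ (X i) = Polynomial.C (φ (X i)) * Polynomial.X ^ 2 := by
        rw [degreeHom, coe_eval₂Hom, eval₂_X]
      rw [map_mul, map_mul, map_X, ih hg, h, map_mul, map_mul]
      ring

/-- The ideal has homogeneous generators, and on a homogeneous element the map is the value of `φ`
times a power of `T`. -/
theorem degreeHom_of_mem_quantIdeal (hφ : ∀ F ∈ quantIdeal b, φ F = 0) {F : QPoly b}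
    (hF : F ∈ quantIdeal b) : degreeHom φ F = 0 := by
  have hle : quantIdeal b ≤ RingHom.ker (degreeHom φ) := by
    have hmem : ∀ F ∈ quantGenerators b, φ F = 0 := fun F hF => hφ F (by
      rw [quantIdeal_eq_span]
      exact Ideal.subset_span hF)
    rw [quantIdeal_eq_span, Ideal.span_le]
    intro F hF
    have h₀ := hmem F hF
    obtain ⟨f, ⟨⟨d, -, hf⟩, -⟩, rfl⟩ := hF
    rw [SetLike.mem_coe, RingHom.mem_ker, degreeHom_map φ hf, h₀, Polynomial.C_0, zero_mul]
  exact hle hF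

theorem degreeHom_of_mem_gradedLT {d n : ℕ} {F : QPoly b} (hF : F ∈ gradedLT b d n) :
    degreeHom φ F = Polynomial.C (φ F) * Polynomial.X ^ d := by
  induction hF using Submodule.span_induction with
  | mem x hx =>
    obtain ⟨p, f, m, k, hp, hf, rfl, -, rfl⟩ := hx
    rw [map_mul, degreeHom_C φ hp, degreeHom_map φ hf, map_mul, map_mul]
    ring
  | zero => simp
  | add x y _ _ hx hy => rw [map_add, hx, hy, map_add, map_add, add_mul]
  | smul c x _ hx =>
    have h : c • x = C (C c) * x := Algebra.smul_def c x
    rw [h, map_mul, hx, degreeHom_C_C, map_mul, map_mul, mul_assoc]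

end DegreeHom

theorem isInternal_gradedPiece (b : P.Base) : DirectSum.IsInternal (gradedPiece b) := by
  have hker : ∀ F ∈ quantIdeal b, Ideal.Quotient.mk (quantIdeal b) F = 0 := fun F hF =>
    Ideal.Quotient.eq_zero_iff_mem.2 hF
  set Θ := degreeHom (b := b) (S := QCoh b) (Ideal.Quotient.mk (quantIdeal b)) with hΘ
  rw [DirectSum.isInternal_submodule_iff_iSupIndep_and_iSup_eq_top]
  constructor
  · intro d
    rw [Submodule.disjoint_def]
    intro x hx hx'
    obtain ⟨F, hF, rfl⟩ := exists_mem_gradedLT hx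
    -- The coefficient of `T ^ d` in `Θ` depends only on the class. It vanishes on a suitable
    -- representative from the other pieces, and on `F` it is the class of `F`.
    obtain ⟨G, hG, hG'⟩ : ∃ G, qClass b G = qClass b F ∧ (Θ G).coeff d = 0 := by
      refine Submodule.iSup_induction _ (motive := fun x => ∃ G, qClass b G = x ∧
        (Θ G).coeff d = 0) hx' (fun e y hy => ?_) ⟨0, map_zero _, by simp⟩ ?_
      · by_cases he : e = d
        · simp only [he, ne_eq, not_true_eq_false, iSup_false] at hy
          exact ⟨0, by rw [(Submodule.mem_bot ℝ).1 hy, map_zero], by simp⟩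
        · simp only [ne_eq, he, not_false_eq_true, iSup_pos] at hy
          obtain ⟨G, hG, rfl⟩ := exists_mem_gradedLT hy
          refine ⟨G, rfl, ?_⟩
          rw [hΘ, degreeHom_of_mem_gradedLT _ hG, Polynomial.coeff_C_mul_X_pow,
            if_neg fun h => he h.symm]
      · rintro _ _ ⟨G, rfl, hG⟩ ⟨H, rfl, hH⟩
        exact ⟨G + H, map_add _ _ _, by rw [map_add, Polynomial.coeff_add, hG, hH, add_zero]⟩
    have h₁ : Θ F = Θ G := by
      rw [← sub_eq_zero, ← map_sub]
      refine degreeHom_of_mem_quantIdeal _ hker (qClass_eq_zero_iff.1 ?_)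
      rw [map_sub, hG, sub_self]
    rw [← h₁, hΘ, degreeHom_of_mem_gradedLT _ hF, Polynomial.coeff_C_mul_X_pow, if_pos rfl] at hG'
    exact hG'
  · refine Submodule.eq_top_iff'.2 fun x => ?_
    obtain ⟨F, rfl⟩ := qClass_surjective x
    induction F using monomial_monomial_induction with
    | hm n m => exact Submodule.mem_iSup_of_mem _ (Submodule.subset_span ⟨n, m, rfl, rfl⟩)
    | hadd F G hF hG =>
      rw [map_add]
      exact add_mem hF hG
    | hsmul c F hF =>
      have h : qClass b ((C c : QRing b) • F) = c • qClass b F := by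
        rw [map_smul, ← algebraMap_eq, algebraMap_smul]
      rw [h]
      exact Submodule.smul_mem _ _ hF

end Grading

end QFlag

end

/-! ### Assembly of the quantum product and its properties. -/

theorem mainTheorem1 {ι M N : Type*} [Fintype ι] [AddCommGroup M] [Module ℝ M]
    [AddCommGroup N] [Module ℝ N] (P : RootPairing ι ℝ M N) [P.IsRootSystem]
    [P.IsCrystallographic] [P.IsReduced] [P.IsIrreducible] (b : P.Base) :
    -- the operators `Λ_i` commute and `ψ` is invertible, so that the formula for `⋆` makes sense
    (∀ i j : b.support, Commute (QFlag.lambdaOp b i) (QFlag.lambdaOp b j)) ∧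
    Function.Bijective (QFlag.psi b) ∧
    -- there is a well-defined `ℝ[q]`-bilinear product given by the formula
    ∃ star : QFlag.QCoh b →ₗ[QFlag.QRing b] QFlag.QCoh b →ₗ[QFlag.QRing b] QFlag.QCoh b,
      (∀ f g : QFlag.QPoly b, star (QFlag.qClass b f) (QFlag.qClass b g) =
        QFlag.qClass b (QFlag.psi b (QFlag.psiInv b f * QFlag.psiInv b g))) ∧
      (∀ x y, star x y = star y x) ∧
      (∀ x y z, star (star x y) z = star x (star y z)) ∧
      -- grading
      DirectSum.IsInternal (QFlag.gradedPiece b) ∧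
      (∀ d e : ℕ, ∀ x ∈ QFlag.gradedPiece b d, ∀ y ∈ QFlag.gradedPiece b e,
        star x y ∈ QFlag.gradedPiece b (d + e)) ∧
      -- the Poincaré pairing, its bilinear extension, and the Frobenius property
      ∃ (B : LinearMap.BilinForm ℝ (QFlag.Coh b))
        (Bq : LinearMap.BilinForm (QFlag.QRing b) (QFlag.QCoh b)),
        QFlag.IsPoincarePairing b B ∧ (∀ B', QFlag.IsPoincarePairing b B' → B' = B) ∧
        QFlag.IsExtension b B Bq ∧ (∀ Bq', QFlag.IsExtension b B Bq' → Bq' = Bq) ∧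
        ∀ x y z : QFlag.QCoh b, Bq (star x y) z = Bq x (star y z) := by
  obtain ⟨star, hstar⟩ := QFlag.exists_star b
  obtain ⟨B, hB, hform⟩ := QFlag.exists_isPoincarePairing b
  obtain ⟨Bq, hBq, hqform⟩ := QFlag.exists_isExtension hform
  refine ⟨QFlag.lambdaOp_commute, QFlag.psi_bijective, star, fun f g => ?_, fun x y => ?_,
    fun x y z => ?_, QFlag.isInternal_gradedPiece b,
    fun d e x hx y hy => QFlag.star_mem_gradedPiece hstar hx hy, B, Bq, hB,
    fun B' hB' => QFlag.isPoincarePairing_unique hB hB', hBq,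
    fun Bq' hBq' => QFlag.isExtension_unique hBq hBq', fun x y z => ?_⟩
  · rw [← hstar, QFlag.psi_psiInv, QFlag.psi_psiInv]
  -- Every class is that of some `ψ(F)`, and on such classes the product is multiplication of
  -- polynomials.
  · obtain ⟨F, rfl⟩ := QFlag.exists_qClass_psi_eq x
    obtain ⟨G, rfl⟩ := QFlag.exists_qClass_psi_eq y
    rw [hstar, hstar, mul_comm]
  · obtain ⟨F, rfl⟩ := QFlag.exists_qClass_psi_eq x
    obtain ⟨G, rfl⟩ := QFlag.exists_qClass_psi_eq y
    obtain ⟨H, rfl⟩ := QFlag.exists_qClass_psi_eq z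
    rw [hstar, hstar, hstar, hstar, mul_assoc]
  · obtain ⟨F, rfl⟩ := QFlag.exists_qClass_psi_eq x
    obtain ⟨G, rfl⟩ := QFlag.exists_qClass_psi_eq y
    obtain ⟨H, rfl⟩ := QFlag.exists_qClass_psi_eq z
    rw [hstar, hstar, hqform, hqform, QFlag.topPairing_psi_mul]
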